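/- For $p\ge 1$ let $\|A\|_p=\big(\mathrm{Tr}\,(A^*A)^{p/2}\big)^{1/p}$ be the Schatten norm of a complex matrix $A$. For a linear map $\Phi$ from $\mathbb C^{d\times d}$ to $\mathbb C^{e\times e}$ let $\nu_p(\Phi)=\sup_\rho\|\Phi(\rho)\|_p$ be its maximal output $p$-norm, where the supremum runs over all states $\rho\in\mathbb C^{d\times d}$ (positive semidefinite matrices of trace one). The map $\Phi$ is positivity-preserving if $\Phi(A)\ge 0$ for every $A\ge 0$, trace-preserving if $\mathrm{Tr}\,\Phi(A)=\mathrm{Tr}\,A$ for every $A$, and completely positive if it is positivity-preserving and $\Phi\otimes I_k$ is positivity-preserving for every dimension $k$, where $I_k$ is the identity map on $\mathbb C^{k\times k}$. **Theorem 1.** Let $\Phi$ be a trace-preserving, positivity-preserving (not necessarily completely positive) linear map on the complex $2\times 2$ matrices, and let $\Omega:\mathbb C^{d\times d}\to\mathbb C^{e\times e}$ be any completely positive linear map between finite-dimensional matrix algebras. Then, for $p=2$ and for all real $p\ge 4$, $$\nu_p(\Phi\otimes\Omega)=\nu_p(\Phi)\,\nu_p(\Omega).$$ -/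

import Mathlib

open scoped Kronecker ComplexOrder

noncomputable section

namespace QuantumMap

/-- The Schatten `p`-norm `‖A‖_p = (Tr (A* A)^{p/2})^{1/p}` of a complex matrix; the real power of
the positive semidefinite matrix `A* A` is taken in the functional calculus. -/
def schattenNorm {m n : Type*} [Fintype m] [Fintype n] [DecidableEq n]
    (p : ℝ) (A : Matrix m n ℂ) : ℝ :=
  (cfc (fun x : ℝ => x ^ (p / 2)) (A.conjTranspose * A)).trace.re ^ (1 / p)

/-- States (density matrices): positive semidefinite matrices of trace one. -/
def states (d : Type*) [Fintype d] : Set (Matrix d d ℂ) :=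
  {ρ | ρ.PosSemidef ∧ ρ.trace = 1}

/-- The maximal output `p`-norm `ν_p(Φ)`, the supremum of `‖Φ(ρ)‖_p` over all states `ρ`. -/
def maxOutputNorm {d e : Type*} [Fintype d] [Fintype e] [DecidableEq e]
    (p : ℝ) (Φ : Matrix d d ℂ →ₗ[ℂ] Matrix e e ℂ) : ℝ :=
  sSup ((fun ρ => schattenNorm p (Φ ρ)) '' states d)

/-- The tensor product `Φ ⊗ Ω` of linear maps on matrices, where `M_d ⊗ M_{d'}` is identified with
`M_{d × d'}` through the Kronecker product. -/
def tensorMap {d e d' e' : Type*} [Fintype d] [DecidableEq d] [Fintype e] [DecidableEq e]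
    [Fintype d'] [DecidableEq d'] [Fintype e'] [DecidableEq e']
    (Φ : Matrix d d ℂ →ₗ[ℂ] Matrix e e ℂ) (Ω : Matrix d' d' ℂ →ₗ[ℂ] Matrix e' e' ℂ) :
    Matrix (d × d') (d × d') ℂ →ₗ[ℂ] Matrix (e × e') (e × e') ℂ :=
  (kroneckerLinearEquiv e e e' e' ℂ).toLinearMap ∘ₗ
    TensorProduct.map Φ Ω ∘ₗ (kroneckerLinearEquiv d d d' d' ℂ).symm.toLinearMap

/-- `Φ(A) ≥ 0` for every `A ≥ 0`. -/
def IsPositivityPreserving {d e : Type*}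
    (Φ : Matrix d d ℂ →ₗ[ℂ] Matrix e e ℂ) : Prop :=
  ∀ A : Matrix d d ℂ, A.PosSemidef → (Φ A).PosSemidef

/-- `Tr Φ(A) = Tr A` for every `A`. -/
def IsTracePreserving {d e : Type*} [Fintype d] [Fintype e]
    (Φ : Matrix d d ℂ →ₗ[ℂ] Matrix e e ℂ) : Prop :=
  ∀ A : Matrix d d ℂ, (Φ A).trace = A.trace

/-- Complete positivity: `Φ` and all the maps `Φ ⊗ I_k` are positivity-preserving. -/
def IsCompletelyPositive {d e : Type*} [Fintype d] [DecidableEq d] [Fintype e] [DecidableEq e]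
    (Φ : Matrix d d ℂ →ₗ[ℂ] Matrix e e ℂ) : Prop :=
  IsPositivityPreserving Φ ∧
    ∀ k : ℕ, IsPositivityPreserving
      (tensorMap Φ (LinearMap.id : Matrix (Fin k) (Fin k) ℂ →ₗ[ℂ] Matrix (Fin k) (Fin k) ℂ))

theorem tensorMap_kronecker {d e d' e' : Type*} [Fintype d] [DecidableEq d] [Fintype e]
    [DecidableEq e] [Fintype d'] [DecidableEq d'] [Fintype e'] [DecidableEq e']
    (Φ : Matrix d d ℂ →ₗ[ℂ] Matrix e e ℂ) (Ω : Matrix d' d' ℂ →ₗ[ℂ] Matrix e' e' ℂ)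
    (A : Matrix d d ℂ) (B : Matrix d' d' ℂ) :
    tensorMap Φ Ω (A ⊗ₖ B) = Φ A ⊗ₖ Ω B := by
  simp [tensorMap]

/-- The Schatten norm in terms of the eigenvalues of `A* A`. -/
theorem schattenNorm_eq_sum {m n : Type*} [Fintype m] [Fintype n] [DecidableEq n]
    (p : ℝ) (A : Matrix m n ℂ) :
    schattenNorm p A = (∑ i, (Matrix.isHermitian_conjTranspose_mul_self A).eigenvalues i
      ^ (p / 2)) ^ (1 / p) := by
  have h := Matrix.isHermitian_conjTranspose_mul_self A
  rw [schattenNorm, h.cfc_eq, Matrix.IsHermitian.cfc, Unitary.conjStarAlgAut_apply,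
    Matrix.trace_mul_cycle]
  simp [Matrix.trace]

theorem states_nonempty (d : Type*) [Fintype d] [Nonempty d] : (states d).Nonempty := by
  classical
  obtain ⟨i⟩ := ‹Nonempty d›
  refine ⟨Matrix.diagonal (Pi.single i 1), Matrix.PosSemidef.diagonal ?_, ?_⟩
  · intro j
    by_cases h : j = i
    · subst h; simp
    · simp [h]
  · simp [Matrix.trace]

open scoped Matrix.Norms.Elementwise MatrixOrder in
/-- The supremum that defines `maxOutputNorm` is over a bounded set. -/
theorem bddAbove_schattenNorm_image {d e : Type*} [Fintype d] [Fintype e] [DecidableEq e]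
    {p : ℝ} (hp : 0 ≤ p) (Φ : Matrix d d ℂ →ₗ[ℂ] Matrix e e ℂ) :
    BddAbove ((fun ρ => schattenNorm p (Φ ρ)) '' states d) := by
  classical
  have hs : ∀ ρ ∈ states d, ‖ρ‖ ≤ Fintype.card d := by
    rintro ρ ⟨h, ht⟩
    obtain ⟨B, rfl⟩ := CStarAlgebra.nonneg_iff_eq_star_mul_self.1 h.nonneg
    rw [Matrix.star_eq_conjTranspose] at ht ⊢
    have h1 : ∑ i, ∑ k, ‖B k i‖ ^ 2 = 1 := by
      have h2 : (∑ i, ∑ k, (‖B k i‖ : ℂ) ^ 2) = 1 := by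
        rw [← ht]
        simp [Matrix.trace, Matrix.mul_apply, Complex.conj_mul']
      exact_mod_cast h2
    have hB : ∀ k i, ‖B k i‖ ≤ 1 := by
      intro k i
      have h3 : ‖B k i‖ ^ 2 ≤ ∑ k, ‖B k i‖ ^ 2 :=
        Finset.single_le_sum (f := fun k => ‖B k i‖ ^ 2) (fun _ _ => by positivity)
          (Finset.mem_univ k)
      have h4 : ∑ k, ‖B k i‖ ^ 2 ≤ ∑ i, ∑ k, ‖B k i‖ ^ 2 :=
        Finset.single_le_sum (f := fun i => ∑ k, ‖B k i‖ ^ 2) (fun _ _ => by positivity)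
          (Finset.mem_univ i)
      nlinarith [norm_nonneg (B k i)]
    rw [Matrix.norm_le_iff (by positivity)]
    intro i j
    rw [Matrix.mul_apply]
    refine (norm_sum_le _ _).trans ?_
    calc _ ≤ ∑ _k : d, (1 : ℝ) := Finset.sum_le_sum fun k _ => by
            rw [norm_mul, Matrix.conjTranspose_apply, norm_star]
            exact mul_le_one₀ (hB k i) (norm_nonneg _) (hB k j)
      _ = _ := by simp
  obtain ⟨C, hC⟩ : ∃ C : ℝ, ∀ ρ ∈ states d, ‖Φ ρ‖ ≤ C := by
    refine ⟨∑ i : d, ∑ j : d, Fintype.card d * ‖Φ (Matrix.single i j 1)‖, fun ρ hρ => ?_⟩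
    have h1 : Φ ρ = ∑ i, ∑ j, ρ i j • Φ (Matrix.single i j 1) := by
      conv_lhs => rw [Matrix.matrix_eq_sum_single ρ]
      simp only [map_sum, ← map_smul, Matrix.smul_single, smul_eq_mul, mul_one]
    rw [h1]
    refine (norm_sum_le _ _).trans (Finset.sum_le_sum fun i _ => ?_)
    refine (norm_sum_le _ _).trans (Finset.sum_le_sum fun j _ => ?_)
    rw [norm_smul]
    gcongr
    exact (Matrix.norm_entry_le_entrywise_sup_norm _).trans (hs ρ hρ)
  refine ⟨(∑ _i : e, (∑ _i : e, ∑ _k : e, C ^ 2) ^ (p / 2)) ^ (1 / p), ?_⟩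
  rintro _ ⟨ρ, hρ, rfl⟩
  have hA : ‖Φ ρ‖ ≤ C := hC ρ hρ
  simp only [schattenNorm_eq_sum]
  have hH := Matrix.isHermitian_conjTranspose_mul_self (Φ ρ)
  have h0 : ∀ i, 0 ≤ hH.eigenvalues i :=
    (Matrix.posSemidef_conjTranspose_mul_self (Φ ρ)).eigenvalues_nonneg
  have htr : ∑ i, hH.eigenvalues i = ∑ i, ∑ k, ‖Φ ρ k i‖ ^ 2 := by
    have h2 := hH.trace_eq_sum_eigenvalues
    have h3 : (∑ i, (hH.eigenvalues i : ℂ)) = ∑ i, ∑ k, (‖Φ ρ k i‖ : ℂ) ^ 2 := by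
      refine Eq.trans h2.symm ?_
      simp [Matrix.trace, Matrix.mul_apply, Complex.conj_mul']
    exact_mod_cast h3
  have hle : ∀ i, hH.eigenvalues i ≤ ∑ _i : e, ∑ _k : e, C ^ 2 := fun i =>
    (Finset.single_le_sum (fun j _ => h0 j) (Finset.mem_univ i)).trans <| htr.trans_le <|
      Finset.sum_le_sum fun i _ => Finset.sum_le_sum fun k _ =>
        pow_le_pow_left₀ (norm_nonneg _) ((Matrix.norm_entry_le_entrywise_sup_norm _).trans hA) 2
  refine Real.rpow_le_rpow (Finset.sum_nonneg fun i _ => Real.rpow_nonneg (h0 i) _)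
    (Finset.sum_le_sum fun i _ => Real.rpow_le_rpow (h0 i) (hle i) (by positivity)) (by positivity)

end QuantumMap

end

/-! The inequality `≥` comes from product states, so the content is `≤`. On states `½(1 + x·σ)` the
qubit map acts as `x ↦ t + T x`, and its output norm increases with the Bloch radius `r = max |t + T
x|` over the unit sphere. The maximum has a Lagrange multiplier `μ` with `|a t + T x|² ≤ (r² - μ) a²
+ μ |x|²` for all `a` and `x` (`exists_multiplier`). Hence `(t, T) : ℝ × ℝ³ → ℝ³` is a contraction
`G` of `ℝ³` composed with an explicit model: diagonal in an orthonormal basis, equal on the first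
two axes, translation along the third (`exists_contraction_factorization`). A contraction is a
convex combination of orthogonal matrices and the output norm is convex, so `G` may be taken
orthogonal. Orthogonal factors are unitary conjugations up to a reflection, which leaves the model
itself.

For the model, write the joint state as a 2×2 block matrix over the qubit index. Complete positivity
of `Ω` keeps the block matrix positive after applying `Ω`. The diagonal blocks are then bounded by
`ν_p(Ω)` times their input traces, and the off-diagonal block by Cauchy–Schwarz. The output of the
model is a Hermitian block matrix, not necessarily positive, and `schattenNorm_fromBlocks_le` bounds
it by the 2×2 matrix of block-norm bounds. That matrix is `ν_p(Ω)` times a trace-one matrix of Bloch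
radius at most `r`, which gives `ν_p(Φ) ν_p(Ω)`.

The analytic core is the comparison of a block matrix with the matrix of its block norms. For
positive matrices and `1 < p < 2` the block matrix is the larger one. Its `p`-th power norm is an
integral of `κ Tr H - log det(1 + κ H)` over `κ = l^(-1/p)`. A Schur complement and Hadamard's
inequality reduce the determinant to scalar 2×2 defects, and a layer-cake argument with Minkowski's
inequality combines the defects. Duality turns this into the upper bound for exponents `q ≥ 2`.
Squaring a Hermitian matrix turns exponent `q` into `p = 2q ≥ 4`, while `p = 2` is a direct
computation. -/

noncomputable section

open Matrix

namespace QuantumMap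

/-! ### Spectral and singular value decompositions. -/

section SVD

variable {𝕜 : Type*} [RCLike 𝕜] {n : Type*} [Fintype n] [DecidableEq n]

theorem star_mul_self_of_mem_unitaryGroup {U : Matrix n n 𝕜} (hU : U ∈ unitaryGroup n 𝕜) :
    Uᴴ * U = 1 := mem_unitaryGroup_iff'.1 hU

theorem mul_star_self_of_mem_unitaryGroup {U : Matrix n n 𝕜} (hU : U ∈ unitaryGroup n 𝕜) :
    U * Uᴴ = 1 := mem_unitaryGroup_iff.1 hU

theorem conjTranspose_mem_unitaryGroup {U : Matrix n n 𝕜} (hU : U ∈ unitaryGroup n 𝕜) :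
    Uᴴ ∈ unitaryGroup n 𝕜 := Unitary.star_mem hU

theorem sum_normSq_row_of_mem_unitaryGroup {U : Matrix n n 𝕜} (hU : U ∈ unitaryGroup n 𝕜) (i : n) :
    ∑ j, ‖U i j‖ ^ 2 = 1 := by
  have h := congrFun (congrFun (mul_star_self_of_mem_unitaryGroup hU) i) i
  simp only [mul_apply, conjTranspose_apply, one_apply_eq, RCLike.star_def, RCLike.mul_conj] at h
  exact_mod_cast h

theorem sum_normSq_col_of_mem_unitaryGroup {U : Matrix n n 𝕜} (hU : U ∈ unitaryGroup n 𝕜) (j : n) :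
    ∑ i, ‖U i j‖ ^ 2 = 1 := by
  have h := congrFun (congrFun (star_mul_self_of_mem_unitaryGroup hU) j) j
  simp only [mul_apply, conjTranspose_apply, one_apply_eq, RCLike.star_def, RCLike.conj_mul] at h
  exact_mod_cast h

/-- The spectral theorem with an explicit unitary matrix. -/
theorem IsHermitian.exists_unitary_diagonal {A : Matrix n n 𝕜} (hA : A.IsHermitian) :
    ∃ U ∈ unitaryGroup n 𝕜,
      A = U * diagonal (fun i => (hA.eigenvalues i : 𝕜)) * Uᴴ :=
  ⟨hA.eigenvectorUnitary, hA.eigenvectorUnitary.2, hA.spectral_theorem⟩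

/-- The singular value decomposition of a square matrix. -/
theorem exists_svd (A : Matrix n n 𝕜) :
    ∃ U ∈ unitaryGroup n 𝕜, ∃ V ∈ unitaryGroup n 𝕜, ∃ s : n → ℝ, (∀ i, 0 ≤ s i) ∧
      A = U * diagonal (fun i => (s i : 𝕜)) * Vᴴ := by
  have hH := isHermitian_conjTranspose_mul_self A
  obtain ⟨V, hV, hAV⟩ := IsHermitian.exists_unitary_diagonal hH
  have h0 : ∀ i, 0 ≤ hH.eigenvalues i := (posSemidef_conjTranspose_mul_self A).eigenvalues_nonneg
  set l := hH.eigenvalues with hl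
  set s : n → ℝ := fun i => √(l i) with hs
  set B := A * V with hB
  have hBB : Bᴴ * B = diagonal (fun i => (l i : 𝕜)) := by
    rw [hB, conjTranspose_mul, Matrix.mul_assoc, ← Matrix.mul_assoc Aᴴ, hAV]
    simp only [Matrix.mul_assoc, star_mul_self_of_mem_unitaryGroup hV, Matrix.mul_one]
    rw [← Matrix.mul_assoc, star_mul_self_of_mem_unitaryGroup hV, Matrix.one_mul]
  have hin : ∀ i j, inner 𝕜 (WithLp.toLp 2 (B.col i) : EuclideanSpace 𝕜 n)
      (WithLp.toLp 2 (B.col j)) = if i = j then (l i : 𝕜) else 0 := by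
    intro i j
    have h := congrFun (congrFun hBB i) j
    rw [diagonal_apply] at h
    rw [← h, EuclideanSpace.inner_eq_star_dotProduct, mul_apply, dotProduct]
    exact Finset.sum_congr rfl fun k _ => by simp [mul_comm]
  -- The columns of `A V` are orthogonal with squared norms `l i`. The nonzero ones, normalised,
  -- extend to an orthonormal basis, which is `U`; the columns with `s i = 0` vanish.
  let w : n → EuclideanSpace 𝕜 n := fun i => ((s i)⁻¹ : 𝕜) • WithLp.toLp 2 (B.col i)
  have hw : Orthonormal 𝕜 (({i | s i ≠ 0} : Set n).domRestrict w) := by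
    rw [orthonormal_iff_ite]
    rintro ⟨i, hi⟩ ⟨j, hj⟩
    simp only [Set.domRestrict_apply, w, inner_smul_left, inner_smul_right, hin, Subtype.mk.injEq]
    by_cases hij : i = j
    · subst hij
      have h2 : (s i : 𝕜) ≠ 0 := by exact_mod_cast hi
      have h3 : (l i : 𝕜) = s i * s i := by
        rw [← RCLike.ofReal_mul, Real.mul_self_sqrt (h0 i)]
      simp only [if_true, h3, map_inv₀, RCLike.conj_ofReal]
      field_simp
    · simp [hij]
  obtain ⟨b, hb⟩ := hw.exists_orthonormalBasis_extension_of_card_eq (by simp)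
  refine ⟨_, (EuclideanSpace.basisFun n 𝕜).toMatrix_orthonormalBasis_mem_unitary b, V, hV, s,
    fun i => Real.sqrt_nonneg _, ?_⟩
  have key : B = (EuclideanSpace.basisFun n 𝕜).toBasis.toMatrix b *
      diagonal (fun i => (s i : 𝕜)) := by
    ext k i
    rw [mul_diagonal, Module.Basis.toMatrix_apply]
    simp only [EuclideanSpace.basisFun_toBasis, PiLp.basisFun_repr]
    by_cases hi : s i = 0
    · have h1 := hin i i
      have h2 : l i = 0 := by
        have := Real.mul_self_sqrt (h0 i)
        rw [← this]; simp only [hs] at hi; rw [hi]; simp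
      rw [if_pos rfl, h2, RCLike.ofReal_zero, inner_self_eq_zero] at h1
      have := congrFun (congrArg WithLp.ofLp h1) k
      simp only [col_apply] at this
      simp [hi, this]
    · have h2 : (s i : 𝕜) ≠ 0 := by exact_mod_cast hi
      rw [hb i hi]
      simp [w]
      field_simp
  rw [← key, hB, Matrix.mul_assoc, mul_star_self_of_mem_unitaryGroup hV, Matrix.mul_one]

/-- Both families are the root multiset of the same characteristic polynomial, so any
diagonalisation may be used in place of the chosen eigenvalues. -/
theorem sum_eigenvalues_of_eq_unitary_conj {H : Matrix n n 𝕜} (hH : H.IsHermitian)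
    {U : Matrix n n 𝕜} (hU : U ∈ unitaryGroup n 𝕜) {d : n → ℝ}
    (h : H = U * diagonal (fun i => (d i : 𝕜)) * Uᴴ) (f : ℝ → ℝ) :
    ∑ i, f (hH.eigenvalues i) = ∑ i, f (d i) := by
  have h1 := hH.roots_charpoly_eq_eigenvalues
  have h2 : H.charpoly = (diagonal (fun i => (d i : 𝕜))).charpoly := by
    rw [h, charpoly_mul_comm, ← Matrix.mul_assoc, star_mul_self_of_mem_unitaryGroup hU,
      Matrix.one_mul]
  have h4 : (∏ i, (Polynomial.X - Polynomial.C (d i : 𝕜))).roots =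
      Finset.univ.val.map fun i => (d i : 𝕜) := by
    simpa using Polynomial.roots_multiset_prod_X_sub_C (Finset.univ.val.map fun i => (d i : 𝕜))
  rw [h2, charpoly_diagonal, h4] at h1
  have h3 := congrArg (fun m => ((m.map RCLike.re).map f).sum) h1
  simpa using h3.symm

end SVD

/-! ### Schatten norms: Hölder, duality, and Cauchy–Schwarz for blocks. -/

section Schatten

set_option linter.unusedSectionVars false

variable {m n : Type*} [Fintype m] [DecidableEq m] [Fintype n] [DecidableEq n]
  {p q : ℝ} {A B : Matrix n n ℂ}

theorem exists_svd_complex (A : Matrix n n ℂ) :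
    ∃ U ∈ unitaryGroup n ℂ, ∃ V ∈ unitaryGroup n ℂ, ∃ s : n → ℝ, (∀ i, 0 ≤ s i) ∧
      A = U * diagonal (fun i => (s i : ℂ)) * Vᴴ :=
  exists_svd A

theorem IsHermitian.exists_unitary_diagonal_complex (hA : A.IsHermitian) :
    ∃ U ∈ unitaryGroup n ℂ, A = U * diagonal (fun i => (hA.eigenvalues i : ℂ)) * Uᴴ :=
  IsHermitian.exists_unitary_diagonal hA

theorem schattenNorm_nonneg (p : ℝ) (A : Matrix n n ℂ) : 0 ≤ schattenNorm p A := by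
  rw [schattenNorm_eq_sum]
  exact Real.rpow_nonneg (Finset.sum_nonneg fun i _ => Real.rpow_nonneg
    ((posSemidef_conjTranspose_mul_self A).eigenvalues_nonneg i) _) _

theorem schattenNorm_of_svd {U V : Matrix n n ℂ} (hU : U ∈ unitaryGroup n ℂ)
    (hV : V ∈ unitaryGroup n ℂ) {s : n → ℝ} (hs : ∀ i, 0 ≤ s i)
    (h : A = U * diagonal (fun i => (s i : ℂ)) * Vᴴ) (p : ℝ) :
    schattenNorm p A = (∑ i, s i ^ p) ^ (1 / p) := by
  have h1 : Aᴴ * A = V * diagonal (fun i => ((s i ^ 2 : ℝ) : ℂ)) * Vᴴ := by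
    have h2 : (diagonal (fun i => ((s i ^ 2 : ℝ) : ℂ)) : Matrix n n ℂ) =
        diagonal (fun i => (s i : ℂ)) * diagonal (fun i => (s i : ℂ)) := by
      rw [diagonal_mul_diagonal]
      congr 1
      ext i
      push_cast
      ring
    have h3 : (diagonal (fun i => (s i : ℂ)) : Matrix n n ℂ)ᴴ = diagonal (fun i => (s i : ℂ)) := by
      rw [diagonal_conjTranspose]
      congr 1
      ext i
      simp
    rw [h, conjTranspose_mul, conjTranspose_mul, conjTranspose_conjTranspose, h3, h2]
    calc _ = V * diagonal (fun i => (s i : ℂ)) * (Uᴴ * U) * diagonal (fun i => (s i : ℂ)) * Vᴴ := by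
          simp only [Matrix.mul_assoc]
      _ = _ := by
          rw [star_mul_self_of_mem_unitaryGroup hU]
          simp only [Matrix.mul_assoc, Matrix.one_mul]
  rw [schattenNorm_eq_sum,
    sum_eigenvalues_of_eq_unitary_conj (isHermitian_conjTranspose_mul_self A) hV h1
      (fun x => x ^ (p / 2))]
  congr 1
  refine Finset.sum_congr rfl fun i _ => ?_
  change (s i ^ 2) ^ (p / 2) = s i ^ p
  rw [← Real.rpow_natCast, ← Real.rpow_mul (hs i)]
  congr 1
  push_cast
  ring

theorem schattenNorm_rpow_of_svd {U V : Matrix n n ℂ} (hU : U ∈ unitaryGroup n ℂ)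
    (hV : V ∈ unitaryGroup n ℂ) {s : n → ℝ} (hs : ∀ i, 0 ≤ s i)
    (h : A = U * diagonal (fun i => (s i : ℂ)) * Vᴴ) (hp : p ≠ 0) :
    schattenNorm p A ^ p = ∑ i, s i ^ p := by
  rw [schattenNorm_of_svd hU hV hs h, one_div, Real.rpow_inv_rpow _ hp]
  exact Finset.sum_nonneg fun i _ => Real.rpow_nonneg (hs i) _

theorem schattenNorm_unitary_mul_mul {U V : Matrix n n ℂ} (hU : U ∈ unitaryGroup n ℂ)
    (hV : V ∈ unitaryGroup n ℂ) (p : ℝ) (A : Matrix n n ℂ) :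
    schattenNorm p (U * A * V) = schattenNorm p A := by
  obtain ⟨W, hW, X, hX, s, hs, h⟩ := exists_svd_complex A
  rw [schattenNorm_of_svd hW hX hs h,
    schattenNorm_of_svd (A := U * A * V) (mul_mem hU hW)
      (mul_mem (conjTranspose_mem_unitaryGroup hV) hX) hs]
  rw [h, conjTranspose_mul, conjTranspose_conjTranspose]
  simp only [Matrix.mul_assoc]

theorem schattenNorm_conjTranspose (p : ℝ) (A : Matrix n n ℂ) :
    schattenNorm p Aᴴ = schattenNorm p A := by
  obtain ⟨W, hW, X, hX, s, hs, h⟩ := exists_svd_complex A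
  rw [schattenNorm_of_svd hW hX hs h, schattenNorm_of_svd (A := Aᴴ) hX hW hs]
  rw [h, conjTranspose_mul, conjTranspose_mul, conjTranspose_conjTranspose, Matrix.mul_assoc,
    diagonal_conjTranspose]
  congr 3
  ext i
  simp

theorem submatrix_mem_unitaryGroup {U : Matrix n n ℂ} (hU : U ∈ unitaryGroup n ℂ) (e : m ≃ n) :
    U.submatrix e e ∈ unitaryGroup m ℂ := by
  rw [mem_unitaryGroup_iff, star_eq_conjTranspose, conjTranspose_submatrix, submatrix_mul_equiv,
    mul_star_self_of_mem_unitaryGroup hU, submatrix_one_equiv]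

theorem schattenNorm_submatrix_equiv (p : ℝ) (A : Matrix n n ℂ) (e : m ≃ n) :
    schattenNorm p (A.submatrix e e) = schattenNorm p A := by
  obtain ⟨W, hW, X, hX, s, hs, h⟩ := exists_svd_complex A
  rw [schattenNorm_of_svd hW hX hs h, schattenNorm_of_svd (A := A.submatrix e e)
    (submatrix_mem_unitaryGroup hW e) (submatrix_mem_unitaryGroup hX e) (fun i => hs (e i))]
  · rw [← Equiv.sum_comp e]
  · rw [h, ← submatrix_mul_equiv _ _ e e e, ← submatrix_mul_equiv _ _ e e e,
      conjTranspose_submatrix, submatrix_diagonal_equiv]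
    rfl

theorem kronecker_mem_unitaryGroup {U : Matrix m m ℂ} {V : Matrix n n ℂ}
    (hU : U ∈ unitaryGroup m ℂ) (hV : V ∈ unitaryGroup n ℂ) :
    U ⊗ₖ V ∈ unitaryGroup (m × n) ℂ := by
  rw [mem_unitaryGroup_iff, star_eq_conjTranspose, conjTranspose_kronecker, ← mul_kronecker_mul,
    mul_star_self_of_mem_unitaryGroup hU, mul_star_self_of_mem_unitaryGroup hV, one_kronecker_one]

theorem schattenNorm_kronecker (p : ℝ) (A : Matrix m m ℂ) (B : Matrix n n ℂ) :
    schattenNorm p (A ⊗ₖ B) = schattenNorm p A * schattenNorm p B := by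
  obtain ⟨W, hW, X, hX, s, hs, h⟩ := exists_svd_complex A
  obtain ⟨W', hW', X', hX', s', hs', h'⟩ := exists_svd_complex B
  rw [schattenNorm_of_svd hW hX hs h, schattenNorm_of_svd hW' hX' hs' h',
    schattenNorm_of_svd (A := A ⊗ₖ B) (kronecker_mem_unitaryGroup hW hW')
      (kronecker_mem_unitaryGroup hX hX') (s := fun i => s i.1 * s' i.2)
      (fun i => mul_nonneg (hs _) (hs' _)),
    ← Real.mul_rpow (Finset.sum_nonneg fun i _ => Real.rpow_nonneg (hs i) _)
      (Finset.sum_nonneg fun i _ => Real.rpow_nonneg (hs' i) _), Finset.sum_mul_sum,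
    ← Finset.univ_product_univ, Finset.sum_product]
  · congr 1
    exact Finset.sum_congr rfl fun i _ => Finset.sum_congr rfl fun j _ =>
      Real.mul_rpow (hs _) (hs' _)
  · rw [h, h', mul_kronecker_mul, mul_kronecker_mul, conjTranspose_kronecker,
      diagonal_kronecker_diagonal]
    simp

/-- Hölder's inequality for the weight `D` on `n × n`, both of whose marginals are counting measure.
-/
theorem sum_doublyStochastic_mul_le (hpq : p.HolderConjugate q) {D : n → n → ℝ}
    (hD : ∀ i j, 0 ≤ D i j) (hr : ∀ i, ∑ j, D i j = 1) (hc : ∀ j, ∑ i, D i j = 1)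
    {s t : n → ℝ} (hs : ∀ i, 0 ≤ s i) (ht : ∀ i, 0 ≤ t i) :
    ∑ i, ∑ j, D i j * (s i * t j) ≤ (∑ i, s i ^ p) ^ (1 / p) * (∑ j, t j ^ q) ^ (1 / q) := by
  have h := Real.inner_le_Lp_mul_Lq_of_nonneg (Finset.univ : Finset (n × n)) hpq
    (f := fun x => D x.1 x.2 ^ (1 / p) * s x.1) (g := fun x => D x.1 x.2 ^ (1 / q) * t x.2)
    (fun x _ => mul_nonneg (Real.rpow_nonneg (hD _ _) _) (hs _))
    (fun x _ => mul_nonneg (Real.rpow_nonneg (hD _ _) _) (ht _))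
  have h1 : ∑ x : n × n, (D x.1 x.2 ^ (1 / p) * s x.1) ^ p = ∑ i, s i ^ p := by
    rw [← Finset.univ_product_univ, Finset.sum_product]
    refine Finset.sum_congr rfl fun i _ => ?_
    conv_rhs => rw [← one_mul (s i ^ p), ← hr i, Finset.sum_mul]
    refine Finset.sum_congr rfl fun j _ => ?_
    rw [Real.mul_rpow (Real.rpow_nonneg (hD _ _) _) (hs _), one_div,
      Real.rpow_inv_rpow (hD _ _) hpq.ne_zero]
  have h2 : ∑ x : n × n, (D x.1 x.2 ^ (1 / q) * t x.2) ^ q = ∑ i, t i ^ q := by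
    rw [← Finset.univ_product_univ, Finset.sum_product_right]
    refine Finset.sum_congr rfl fun i _ => ?_
    conv_rhs => rw [← one_mul (t i ^ q), ← hc i, Finset.sum_mul]
    refine Finset.sum_congr rfl fun j _ => ?_
    rw [Real.mul_rpow (Real.rpow_nonneg (hD _ _) _) (ht _), one_div,
      Real.rpow_inv_rpow (hD _ _) hpq.symm.ne_zero]
  rw [h1, h2] at h
  refine le_trans (le_of_eq ?_) h
  rw [← Finset.univ_product_univ, Finset.sum_product]
  refine Finset.sum_congr rfl fun i _ => Finset.sum_congr rfl fun j _ => ?_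
  have h3 : D i j ^ (1 / p) * D i j ^ (1 / q) = D i j := by
    rcases (hD i j).eq_or_lt with h0 | h0
    · rw [← h0, Real.zero_rpow (one_div_ne_zero hpq.ne_zero), zero_mul]
    · rw [← Real.rpow_add h0, one_div, one_div, hpq.inv_add_inv_eq_one, Real.rpow_one]
  linear_combination (-(s i * t j)) * h3

/-- Hölder's inequality for Schatten norms. -/
theorem norm_trace_mul_le (hpq : p.HolderConjugate q) (A B : Matrix n n ℂ) :
    ‖(A * B).trace‖ ≤ schattenNorm p A * schattenNorm q B := by
  obtain ⟨W, hW, X, hX, s, hs, h⟩ := exists_svd_complex A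
  obtain ⟨W', hW', X', hX', t, ht, h'⟩ := exists_svd_complex B
  rw [schattenNorm_of_svd hW hX hs h, schattenNorm_of_svd hW' hX' ht h']
  obtain ⟨Y, hYdef⟩ : ∃ Y, Y = Xᴴ * W' := ⟨_, rfl⟩
  obtain ⟨Z, hZdef⟩ : ∃ Z, Z = X'ᴴ * W := ⟨_, rfl⟩
  have hY : Y ∈ unitaryGroup n ℂ := hYdef ▸ mul_mem (conjTranspose_mem_unitaryGroup hX) hW'
  have hZ : Z ∈ unitaryGroup n ℂ := hZdef ▸ mul_mem (conjTranspose_mem_unitaryGroup hX') hW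
  have h1 : (A * B).trace = ∑ i, ∑ j, (s i : ℂ) * Y i j * ((t j : ℂ) * Z j i) := by
    have h2 : A * B = W * (diagonal (fun i => (s i : ℂ)) * Y *
        (diagonal (fun i => (t i : ℂ)) * X'ᴴ)) := by
      rw [h, h', hYdef]
      simp only [Matrix.mul_assoc]
    rw [h2, trace_mul_comm, Matrix.mul_assoc, Matrix.mul_assoc, Matrix.mul_assoc, ← hZdef,
      ← Matrix.mul_assoc, trace]
    refine Finset.sum_congr rfl fun i _ => ?_
    rw [diag_apply, mul_apply]
    exact Finset.sum_congr rfl fun j _ => by rw [diagonal_mul, diagonal_mul]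
  rw [h1]
  -- The coefficient of `s i * t j` has modulus `‖Y i j‖ ‖Z j i‖`, at most the average of the
  -- squares. This average is doubly stochastic because `Y` and `Z` are unitary.
  refine le_trans ?_ (sum_doublyStochastic_mul_le hpq
    (D := fun i j => (‖Y i j‖ ^ 2 + ‖Z j i‖ ^ 2) / 2) (fun i j => by positivity)
    (fun i => ?_) (fun j => ?_) hs ht)
  · refine (norm_sum_le _ _).trans (Finset.sum_le_sum fun i _ => ?_)
    refine (norm_sum_le _ _).trans (Finset.sum_le_sum fun j _ => ?_)
    simp only [norm_mul, Complex.norm_real, Real.norm_of_nonneg (hs i), Real.norm_of_nonneg (ht j)]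
    have := mul_nonneg (mul_nonneg (hs i) (ht j)) (sq_nonneg (‖Y i j‖ - ‖Z j i‖))
    linarith
  · rw [← Finset.sum_div, Finset.sum_add_distrib, sum_normSq_row_of_mem_unitaryGroup hY,
      sum_normSq_col_of_mem_unitaryGroup hZ]
    norm_num
  · rw [← Finset.sum_div, Finset.sum_add_distrib, sum_normSq_col_of_mem_unitaryGroup hY,
      sum_normSq_row_of_mem_unitaryGroup hZ]
    norm_num

/-- A singular value decomposition of a norming functional. -/
theorem exists_trace_mul_eq_of_svd (hpq : p.HolderConjugate q) {U V : Matrix n n ℂ}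
    (hU : U ∈ unitaryGroup n ℂ) (hV : V ∈ unitaryGroup n ℂ) {s : n → ℝ} (hs : ∀ i, 0 ≤ s i)
    (h : A = U * diagonal (fun i => (s i : ℂ)) * Vᴴ) :
    ∃ t : n → ℝ, (∀ i, 0 ≤ t i) ∧ schattenNorm q (V * diagonal (fun i => (t i : ℂ)) * Uᴴ) ≤ 1 ∧
      (A * (V * diagonal (fun i => (t i : ℂ)) * Uᴴ)).trace = schattenNorm p A := by
  set N := schattenNorm p A with hN
  have hN0 : 0 ≤ N := schattenNorm_nonneg _ _
  have hNp : N ^ p = ∑ i, s i ^ p := schattenNorm_rpow_of_svd hU hV hs h hpq.ne_zero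
  have ht : ∀ i, 0 ≤ (s i / N) ^ (p - 1) := fun i => Real.rpow_nonneg (div_nonneg (hs i) hN0) _
  -- The equality case of Hölder. For `N = 0` division by zero makes all these values vanish, and
  -- both claims still hold.
  refine ⟨fun i => (s i / N) ^ (p - 1), ht, ?_, ?_⟩
  · rw [schattenNorm_of_svd hV hU ht rfl]
    refine Real.rpow_le_one (Finset.sum_nonneg fun i _ => Real.rpow_nonneg (ht i) _) ?_
      (one_div_nonneg.2 hpq.symm.nonneg)
    have h1 : ∀ i, ((s i / N) ^ (p - 1)) ^ q = s i ^ p / N ^ p := fun i => by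
      rw [← Real.rpow_mul (div_nonneg (hs i) hN0), hpq.sub_one_mul_conj, Real.div_rpow (hs i) hN0]
    simp only [h1]
    rw [← Finset.sum_div, ← hNp]
    exact div_self_le_one _
  · have h2 : A * (V * diagonal (fun i => (((s i / N) ^ (p - 1) : ℝ) : ℂ)) * Uᴴ) =
        U * diagonal (fun i => ((s i * (s i / N) ^ (p - 1) : ℝ) : ℂ)) * Uᴴ := by
      calc _ = U * (diagonal (fun i => (s i : ℂ)) * (Vᴴ * V) *
            diagonal (fun i => (((s i / N) ^ (p - 1) : ℝ) : ℂ))) * Uᴴ := by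
            rw [h]; simp only [Matrix.mul_assoc]
        _ = _ := by
            rw [star_mul_self_of_mem_unitaryGroup hV, Matrix.mul_one, diagonal_mul_diagonal]
            simp
    rw [h2, trace_mul_comm, ← Matrix.mul_assoc, star_mul_self_of_mem_unitaryGroup hU,
      Matrix.one_mul, trace_diagonal, ← Complex.ofReal_sum]
    congr 1
    have h3 : ∀ i, s i * (s i / N) ^ (p - 1) = s i ^ p * (N ^ (p - 1))⁻¹ := fun i => by
      rw [Real.div_rpow (hs i) hN0, div_eq_mul_inv, ← mul_assoc]
      congr 1
      rcases (hs i).eq_or_lt with h0 | h0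
      · rw [← h0, zero_mul, Real.zero_rpow hpq.ne_zero]
      · nth_rewrite 1 [← Real.rpow_one (s i)]
        rw [← Real.rpow_add h0]
        congr 1
        ring
    simp only [h3]
    rw [← Finset.sum_mul, ← hNp]
    rcases hN0.eq_or_lt with h0 | h0
    · rw [← h0, Real.zero_rpow hpq.ne_zero, zero_mul]
    · rw [← div_eq_mul_inv, ← Real.rpow_sub h0]
      convert Real.rpow_one N using 2
      ring

/-- The Schatten norm is attained in the dual pairing. -/
theorem exists_trace_mul_eq_schattenNorm (hpq : p.HolderConjugate q) (A : Matrix n n ℂ) :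
    ∃ B : Matrix n n ℂ, schattenNorm q B ≤ 1 ∧ (A * B).trace = schattenNorm p A := by
  obtain ⟨U, hU, V, hV, s, hs, h⟩ := exists_svd_complex A
  obtain ⟨t, -, h1, h2⟩ := exists_trace_mul_eq_of_svd hpq hU hV hs h
  exact ⟨_, h1, h2⟩

theorem PosSemidef.exists_trace_mul_eq_schattenNorm (hpq : p.HolderConjugate q)
    (hA : A.PosSemidef) :
    ∃ B : Matrix n n ℂ, B.PosSemidef ∧ schattenNorm q B ≤ 1 ∧
      (A * B).trace = schattenNorm p A := by
  obtain ⟨U, hU, h⟩ := IsHermitian.exists_unitary_diagonal_complex hA.1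
  obtain ⟨t, ht, h1, h2⟩ := exists_trace_mul_eq_of_svd hpq hU hU hA.eigenvalues_nonneg h
  refine ⟨_, ?_, h1, h2⟩
  exact (PosSemidef.diagonal fun i => by simpa using ht i).mul_mul_conjTranspose_same U

/-- Presents the norm as a supremum of linear functionals, from which subadditivity and homogeneity
follow. -/
theorem schattenNorm_le_of_forall_trace (hpq : p.HolderConjugate q) {C : ℝ}
    (h : ∀ B : Matrix n n ℂ, schattenNorm q B ≤ 1 → ‖(A * B).trace‖ ≤ C) :
    schattenNorm p A ≤ C := by
  obtain ⟨B, hB, hAB⟩ := exists_trace_mul_eq_schattenNorm hpq A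
  have := h B hB
  rwa [hAB, Complex.norm_real, Real.norm_of_nonneg (schattenNorm_nonneg _ _)] at this

theorem norm_trace_mul_le_of_le_one (hpq : p.HolderConjugate q) (A : Matrix n n ℂ)
    {B : Matrix n n ℂ} (hB : schattenNorm q B ≤ 1) : ‖(A * B).trace‖ ≤ schattenNorm p A :=
  (norm_trace_mul_le hpq A B).trans
    (mul_le_of_le_one_right (schattenNorm_nonneg _ _) hB)

theorem schattenNorm_add_le (hp : 1 < p) (A B : Matrix n n ℂ) :
    schattenNorm p (A + B) ≤ schattenNorm p A + schattenNorm p B := by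
  have hpq := Real.HolderConjugate.conjExponent hp
  refine schattenNorm_le_of_forall_trace hpq fun C hC => ?_
  rw [Matrix.add_mul, trace_add]
  exact (norm_add_le _ _).trans (add_le_add (norm_trace_mul_le_of_le_one hpq A hC)
    (norm_trace_mul_le_of_le_one hpq B hC))

theorem schattenNorm_smul_le (hp : 1 < p) (c : ℂ) (A : Matrix n n ℂ) :
    schattenNorm p (c • A) ≤ ‖c‖ * schattenNorm p A := by
  have hpq := Real.HolderConjugate.conjExponent hp
  refine schattenNorm_le_of_forall_trace hpq fun C hC => ?_
  rw [Matrix.smul_mul, trace_smul, smul_eq_mul, norm_mul]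
  exact mul_le_mul_of_nonneg_left (norm_trace_mul_le_of_le_one hpq A hC) (norm_nonneg _)

/-- The signs of the `d i` are absorbed into the right unitary factor, which makes the
diagonalisation a singular value decomposition. -/
theorem schattenNorm_of_unitary_conj {U : Matrix n n ℂ} (hU : U ∈ unitaryGroup n ℂ) {d : n → ℝ}
    (h : A = U * diagonal (fun i => (d i : ℂ)) * Uᴴ) (p : ℝ) :
    schattenNorm p A = (∑ i, |d i| ^ p) ^ (1 / p) := by
  have hV : (diagonal (fun i => if 0 ≤ d i then (1 : ℂ) else -1) : Matrix n n ℂ) ∈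
      unitaryGroup n ℂ := by
    rw [mem_unitaryGroup_iff, star_eq_conjTranspose, diagonal_conjTranspose, diagonal_mul_diagonal,
      ← diagonal_one]
    congr 1
    ext i
    by_cases hi : 0 ≤ d i <;> simp [hi]
  refine schattenNorm_of_svd hU (mul_mem hU hV) (fun i => abs_nonneg _) ?_ p
  rw [h, conjTranspose_mul, diagonal_conjTranspose]
  simp only [Matrix.mul_assoc]
  congr 1
  rw [← Matrix.mul_assoc, diagonal_mul_diagonal]
  congr 2
  ext i
  by_cases hi : 0 ≤ d i
  · simp [hi, abs_of_nonneg hi]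
  · simp [hi, abs_of_neg (not_le.1 hi)]

theorem schattenNorm_of_isHermitian (hA : A.IsHermitian) (p : ℝ) :
    schattenNorm p A = (∑ i, |hA.eigenvalues i| ^ p) ^ (1 / p) := by
  obtain ⟨U, hU, h⟩ := IsHermitian.exists_unitary_diagonal_complex hA
  exact schattenNorm_of_unitary_conj hU h p

theorem schattenNorm_rpow_of_isHermitian (hA : A.IsHermitian) (hp : p ≠ 0) :
    schattenNorm p A ^ p = ∑ i, |hA.eigenvalues i| ^ p := by
  rw [schattenNorm_of_isHermitian hA, one_div, Real.rpow_inv_rpow _ hp]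
  exact Finset.sum_nonneg fun i _ => Real.rpow_nonneg (abs_nonneg _) _

theorem schattenNorm_mul_conjTranspose_self (hq : q ≠ 0) (A : Matrix n n ℂ) :
    schattenNorm q (A * Aᴴ) = schattenNorm (2 * q) A ^ 2 := by
  obtain ⟨U, hU, V, hV, s, hs, h⟩ := exists_svd_complex A
  have h1 : A * Aᴴ = U * diagonal (fun i => ((s i ^ 2 : ℝ) : ℂ)) * Uᴴ := by
    calc A * Aᴴ = U * (diagonal (fun i => (s i : ℂ)) * (Vᴴ * V) *
          (diagonal (fun i => (s i : ℂ)))ᴴ) * Uᴴ := by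
          rw [h]; simp only [conjTranspose_mul, conjTranspose_conjTranspose, Matrix.mul_assoc]
      _ = _ := by
          rw [star_mul_self_of_mem_unitaryGroup hV, Matrix.mul_one, diagonal_conjTranspose,
            diagonal_mul_diagonal]
          congr 3
          ext i
          simp [pow_two]
  have h2 : 0 ≤ ∑ i, s i ^ (2 * q) := Finset.sum_nonneg fun i _ => Real.rpow_nonneg (hs i) _
  rw [schattenNorm_of_svd hU hU (fun i => sq_nonneg (s i)) h1, schattenNorm_of_svd hU hV hs h,
    ← Real.rpow_natCast _ 2, ← Real.rpow_mul h2]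
  congr 1
  · refine Finset.sum_congr rfl fun i _ => ?_
    rw [← Real.rpow_natCast, ← Real.rpow_mul (hs i)]
    norm_num
  · field_simp
    norm_num

theorem schattenNorm_conjTranspose_mul_self (hq : q ≠ 0) (A : Matrix n n ℂ) :
    schattenNorm q (Aᴴ * A) = schattenNorm (2 * q) A ^ 2 := by
  have := schattenNorm_mul_conjTranspose_self hq Aᴴ
  rwa [conjTranspose_conjTranspose, schattenNorm_conjTranspose] at this

/-- The diagonal of a matrix is dominated by its singular values in `ℓ^q`. -/
theorem sum_norm_diag_rpow_le (hq : 1 ≤ q) (A : Matrix n n ℂ) :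
    ∑ i, ‖A i i‖ ^ q ≤ schattenNorm q A ^ q := by
  obtain ⟨U, hU, V, hV, s, hs, h⟩ := exists_svd_complex A
  rw [schattenNorm_rpow_of_svd hU hV hs h (by linarith)]
  -- `‖A i i‖` is at most the `D i`-average of the singular values. Jensen for `x ^ q` and the unit
  -- column sums of `D` do the rest.
  set D : n → n → ℝ := fun i k => (‖U i k‖ ^ 2 + ‖V i k‖ ^ 2) / 2 with hDdef
  have hD : ∀ i k, 0 ≤ D i k := fun i k => by positivity
  have hr : ∀ i, ∑ k, D i k = 1 := fun i => by
    rw [← Finset.sum_div, Finset.sum_add_distrib, sum_normSq_row_of_mem_unitaryGroup hU,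
      sum_normSq_row_of_mem_unitaryGroup hV]
    norm_num
  have hc : ∀ k, ∑ i, D i k = 1 := fun k => by
    rw [← Finset.sum_div, Finset.sum_add_distrib, sum_normSq_col_of_mem_unitaryGroup hU,
      sum_normSq_col_of_mem_unitaryGroup hV]
    norm_num
  have h1 : ∀ i, ‖A i i‖ ^ q ≤ ∑ k, D i k * s k ^ q := by
    intro i
    refine le_trans (Real.rpow_le_rpow (norm_nonneg _) (?_ : ‖A i i‖ ≤ ∑ k, D i k * s k)
      (by linarith)) (Real.rpow_arith_mean_le_arith_mean_rpow _ _ _ (fun k _ => hD i k) (hr i)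
        (fun k _ => hs k) hq)
    rw [h, mul_apply]
    refine (norm_sum_le _ _).trans (Finset.sum_le_sum fun k _ => ?_)
    rw [mul_diagonal, conjTranspose_apply, norm_mul, norm_mul, norm_star, Complex.norm_real,
      Real.norm_of_nonneg (hs k)]
    have := mul_nonneg (hs k) (sq_nonneg (‖U i k‖ - ‖V i k‖))
    simp only [hDdef]
    linarith
  refine (Finset.sum_le_sum fun i _ => h1 i).trans ?_
  rw [Finset.sum_comm]
  refine Finset.sum_le_sum fun k _ => ?_
  rw [← Finset.sum_mul, hc, one_mul]

/-- The determinant of the principal submatrix on `i, j` is nonnegative. -/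
theorem PosSemidef.normSq_apply_le {M : Matrix n n ℂ} (hM : M.PosSemidef) (i j : n) :
    ‖M i j‖ ^ 2 ≤ ‖M i i‖ * ‖M j j‖ := by
  have h := (hM.submatrix ![i, j]).det_nonneg
  rw [det_fin_two] at h
  simp only [submatrix_apply, cons_val_zero, cons_val_one] at h
  rw [← hM.1.apply j i, RCLike.star_def, RCLike.mul_conj] at h
  have h1 : M i i = (‖M i i‖ : ℂ) := Complex.eq_coe_norm_of_nonneg hM.diag_nonneg
  have h2 : M j j = (‖M j j‖ : ℂ) := Complex.eq_coe_norm_of_nonneg hM.diag_nonneg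
  rw [h1, h2] at h
  have h3 : (0 : ℂ) ≤ ((‖M i i‖ * ‖M j j‖ - ‖M i j‖ ^ 2 : ℝ) : ℂ) := by
    push_cast
    exact h
  have h4 := Complex.zero_le_real.1 h3
  linarith

theorem fromBlocks_mem_unitaryGroup {U : Matrix m m ℂ} {V : Matrix n n ℂ}
    (hU : U ∈ unitaryGroup m ℂ) (hV : V ∈ unitaryGroup n ℂ) :
    fromBlocks U 0 0 V ∈ unitaryGroup (m ⊕ n) ℂ := by
  rw [mem_unitaryGroup_iff, star_eq_conjTranspose, fromBlocks_conjTranspose, fromBlocks_multiply]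
  simp [mul_star_self_of_mem_unitaryGroup hU, mul_star_self_of_mem_unitaryGroup hV]

/-- Cauchy–Schwarz for the off-diagonal block of a positive semidefinite block matrix. -/
theorem PosSemidef.schattenNorm_offDiag_sq_le {X Y Z : Matrix n n ℂ} (hq : 1 < q)
    (hM : (fromBlocks X Y Yᴴ Z).PosSemidef) :
    schattenNorm q Y ^ 2 ≤ schattenNorm q X * schattenNorm q Z := by
  obtain ⟨U, hU, V, hV, s, hs, h⟩ := exists_svd_complex Y
  -- After this conjugation the off-diagonal block is `diagonal s`, and 2×2 minors give `s i ^ 2 ≤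
  -- ‖X' i i‖ ‖Z' i i‖`. Cauchy–Schwarz over `i` leaves the diagonals, which the Schatten norms
  -- dominate.
  have hM' := hM.conjTranspose_mul_mul_same (fromBlocks U 0 0 V)
  have hb : (fromBlocks U 0 0 V)ᴴ * fromBlocks X Y Yᴴ Z * fromBlocks U 0 0 V =
      fromBlocks (Uᴴ * X * U) (Uᴴ * Y * V) (Vᴴ * Yᴴ * U) (Vᴴ * Z * V) := by
    rw [fromBlocks_conjTranspose, fromBlocks_multiply, fromBlocks_multiply]
    simp
  have hY : Uᴴ * Y * V = diagonal (fun i => (s i : ℂ)) := by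
    calc _ = (Uᴴ * U) * diagonal (fun i => (s i : ℂ)) * (Vᴴ * V) := by
          rw [h]; simp only [Matrix.mul_assoc]
      _ = _ := by
          rw [star_mul_self_of_mem_unitaryGroup hU, star_mul_self_of_mem_unitaryGroup hV,
            Matrix.one_mul, Matrix.mul_one]
  rw [hb, hY] at hM'
  set X' := Uᴴ * X * U with hX'
  set Z' := Vᴴ * Z * V with hZ'
  have hXn : schattenNorm q X' = schattenNorm q X :=
    schattenNorm_unitary_mul_mul (conjTranspose_mem_unitaryGroup hU) hU q X
  have hZn : schattenNorm q Z' = schattenNorm q Z :=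
    schattenNorm_unitary_mul_mul (conjTranspose_mem_unitaryGroup hV) hV q Z
  have h1 : ∀ i, s i ^ 2 ≤ ‖X' i i‖ * ‖Z' i i‖ := fun i => by
    have := PosSemidef.normSq_apply_le hM' (Sum.inl i) (Sum.inr i)
    simpa [abs_of_nonneg (hs i)] using this
  have h2 : ∀ i, s i ^ q ≤ ‖X' i i‖ ^ (q / 2) * ‖Z' i i‖ ^ (q / 2) := fun i => by
    rw [← Real.mul_rpow (norm_nonneg _) (norm_nonneg _)]
    refine le_trans (le_of_eq ?_) (Real.rpow_le_rpow (sq_nonneg _) (h1 i) (by linarith))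
    rw [← Real.rpow_natCast, ← Real.rpow_mul (hs i)]
    congr 1
    push_cast
    ring
  have h3 : (schattenNorm q Y ^ q) ^ 2 ≤ schattenNorm q X ^ q * schattenNorm q Z ^ q := by
    rw [schattenNorm_rpow_of_svd hU hV hs h (by linarith), ← hXn, ← hZn]
    refine le_trans (pow_le_pow_left₀ (Finset.sum_nonneg fun i _ => Real.rpow_nonneg (hs i) _)
      (Finset.sum_le_sum fun i _ => h2 i) 2) ?_
    refine (Finset.sum_mul_sq_le_sq_mul_sq _ _ _).trans ?_
    have h4 : ∀ x : ℝ, 0 ≤ x → (x ^ (q / 2)) ^ 2 = x ^ q := fun x hx => by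
      rw [← Real.rpow_natCast, ← Real.rpow_mul hx]
      congr 1
      push_cast
      ring
    simp only [h4 _ (norm_nonneg _)]
    exact mul_le_mul (sum_norm_diag_rpow_le hq.le _) (sum_norm_diag_rpow_le hq.le _)
      (Finset.sum_nonneg fun i _ => Real.rpow_nonneg (norm_nonneg _) _)
      (Real.rpow_nonneg (schattenNorm_nonneg _ _) _)
  have hx := schattenNorm_nonneg q X
  have hy := schattenNorm_nonneg q Y
  have hz := schattenNorm_nonneg q Z
  rw [← Real.mul_rpow hx hz, ← Real.rpow_natCast, ← Real.rpow_mul hy, mul_comm q, Real.rpow_mul hy,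
    Real.rpow_natCast] at h3
  exact (Real.rpow_le_rpow_iff (sq_nonneg _) (mul_nonneg hx hz) (by linarith)).1 h3

/-- `A * B` is the off-diagonal block of the Gram matrix of the block row `(Aᴴ, B)`, so
Cauchy–Schwarz for blocks applies. -/
theorem schattenNorm_mul_le (hq : 1 < q) (A B : Matrix n n ℂ) :
    schattenNorm q (A * B) ≤ schattenNorm (2 * q) A * schattenNorm (2 * q) B := by
  have h1 : fromBlocks (A * Aᴴ) (A * B) (A * B)ᴴ (Bᴴ * B) =
      (fromBlocks Aᴴ B 0 0)ᴴ * fromBlocks Aᴴ B 0 (0 : Matrix n n ℂ) := by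
    rw [fromBlocks_conjTranspose, fromBlocks_multiply]
    simp
  have h2 := PosSemidef.schattenNorm_offDiag_sq_le hq
    (h1 ▸ posSemidef_conjTranspose_mul_self (fromBlocks Aᴴ B 0 (0 : Matrix n n ℂ)))
  rw [schattenNorm_mul_conjTranspose_self (by linarith),
    schattenNorm_conjTranspose_mul_self (by linarith), ← mul_pow] at h2
  exact le_of_sq_le_sq h2 (mul_nonneg (schattenNorm_nonneg _ _) (schattenNorm_nonneg _ _))

end Schatten

/-! ### Hadamard's inequality and a determinant bound for block matrices. -/

section Determinant

variable {n : Type*} [Fintype n] [DecidableEq n]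

theorem diag_of_unitary_conj {A U : Matrix n n ℂ} {d : n → ℝ}
    (h : A = U * diagonal (fun i => (d i : ℂ)) * Uᴴ) (i : n) :
    A i i = ((∑ k, ‖U i k‖ ^ 2 * d k : ℝ) : ℂ) := by
  rw [h, mul_apply, Complex.ofReal_sum]
  refine Finset.sum_congr rfl fun k _ => ?_
  rw [mul_diagonal, conjTranspose_apply, RCLike.star_def, mul_right_comm, RCLike.mul_conj]
  push_cast
  rfl

theorem det_of_unitary_conj {A U : Matrix n n ℂ} (hU : U ∈ unitaryGroup n ℂ) {d : n → ℝ}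
    (h : A = U * diagonal (fun i => (d i : ℂ)) * Uᴴ) : A.det = ((∏ i, d i : ℝ) : ℂ) := by
  rw [h, det_mul_comm, ← Matrix.mul_assoc, star_mul_self_of_mem_unitaryGroup hU, Matrix.one_mul,
    det_diagonal]
  push_cast
  rfl

/-- Hadamard's determinant inequality. -/
theorem PosSemidef.det_re_le_prod_diag {A : Matrix n n ℂ} (hA : A.PosSemidef) :
    A.det.re ≤ ∏ i, (A i i).re := by
  obtain ⟨U, hU, h⟩ := IsHermitian.exists_unitary_diagonal_complex hA.1
  have h0 := hA.eigenvalues_nonneg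
  rw [det_of_unitary_conj hU h, Complex.ofReal_re]
  -- `A i i` is the mean of the eigenvalues with weights `‖U i k‖ ^ 2`, so AM–GM applies. In the
  -- product over `i` each eigenvalue collects total exponent one.
  have h1 : ∀ i, ∏ k, hA.1.eigenvalues k ^ ‖U i k‖ ^ 2 ≤ (A i i).re := fun i => by
    rw [diag_of_unitary_conj h, Complex.ofReal_re]
    exact Real.geom_mean_le_arith_mean_weighted _ _ _ (fun k _ => sq_nonneg _)
      (sum_normSq_row_of_mem_unitaryGroup hU i) (fun k _ => h0 k)
  refine le_trans (le_of_eq ?_) (Finset.prod_le_prod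
    (fun i _ => Finset.prod_nonneg fun k _ => Real.rpow_nonneg (h0 k) _) fun i _ => h1 i)
  rw [Finset.prod_comm]
  refine Finset.prod_congr rfl fun k _ => ?_
  rw [← Real.rpow_sum_of_nonneg (h0 k) (fun i _ => sq_nonneg _),
    sum_normSq_col_of_mem_unitaryGroup hU, Real.rpow_one]

/-- The graph of the convex function `u ↦ u ^ (-1/2)` lies above its tangent at `v`. Averaged with
`v` the mean, this is Jensen's inequality for the diagonal of an inverse square root. -/
theorem inv_sqrt_tangent_le {u v : ℝ} (hu : 0 < u) (hv : 0 < v) :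
    (3 / 2 - u / (2 * v)) / √v ≤ 1 / √u := by
  obtain ⟨a, ha, rfl⟩ : ∃ a, 0 < a ∧ u = a ^ 2 := ⟨√u, Real.sqrt_pos.2 hu, (Real.sq_sqrt hu.le).symm⟩
  obtain ⟨b, hb, rfl⟩ : ∃ b, 0 < b ∧ v = b ^ 2 := ⟨√v, Real.sqrt_pos.2 hv, (Real.sq_sqrt hv.le).symm⟩
  rw [Real.sqrt_sq ha.le, Real.sqrt_sq hb.le, div_le_div_iff₀ hb ha]
  have h1 : (3 / 2 - a ^ 2 / (2 * b ^ 2)) * a = (3 * a * b ^ 2 - a ^ 3) / (2 * b ^ 2) := by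
    field_simp
  rw [h1, div_le_iff₀ (by positivity)]
  nlinarith [mul_nonneg (sq_nonneg (a - b)) (by positivity : 0 ≤ a + 2 * b)]

/-- An inverse square root of a positive definite matrix, with a lower bound on its diagonal. -/
theorem PosDef.exists_inv_sqrt {D : Matrix n n ℂ} (hD : D.PosDef) :
    ∃ S : Matrix n n ℂ, Sᴴ = S ∧ S * D * S = 1 ∧ ∀ i, 1 ≤ ‖S i i‖ ^ 2 * (D i i).re := by
  obtain ⟨U, hU, h⟩ := IsHermitian.exists_unitary_diagonal_complex hD.1
  have h0 : ∀ i, 0 < hD.1.eigenvalues i := hD.eigenvalues_pos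
  set l := hD.1.eigenvalues
  refine ⟨U * diagonal (fun i => ((1 / √(l i) : ℝ) : ℂ)) * Uᴴ, ?_, ?_, fun i => ?_⟩
  · rw [conjTranspose_mul, conjTranspose_mul, conjTranspose_conjTranspose,
      diagonal_conjTranspose, Matrix.mul_assoc]
    congr 3
    ext i
    simp
  · have h1 : (diagonal (fun i => ((1 / √(l i) : ℝ) : ℂ)) : Matrix n n ℂ) *
        diagonal (fun i => (l i : ℂ)) * diagonal (fun i => ((1 / √(l i) : ℝ) : ℂ)) = 1 := by
      rw [diagonal_mul_diagonal, diagonal_mul_diagonal, ← diagonal_one]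
      congr 1
      ext i
      rw [← Complex.ofReal_mul, ← Complex.ofReal_mul, ← Complex.ofReal_one]
      congr 1
      have h2 := Real.sqrt_pos.2 (h0 i)
      field_simp
      rw [Real.sq_sqrt (h0 i).le]
    calc _ = U * (diagonal (fun i => ((1 / √(l i) : ℝ) : ℂ)) * (Uᴴ * U) *
          diagonal (fun i => (l i : ℂ)) * (Uᴴ * U) *
            diagonal (fun i => ((1 / √(l i) : ℝ) : ℂ))) * Uᴴ := by
          conv_lhs => rw [h]
          simp only [Matrix.mul_assoc]
      _ = 1 := by
          rw [star_mul_self_of_mem_unitaryGroup hU, Matrix.mul_one, Matrix.mul_one, h1,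
            Matrix.mul_one, mul_star_self_of_mem_unitaryGroup hU]
  · rw [diag_of_unitary_conj rfl, diag_of_unitary_conj h, Complex.ofReal_re, Complex.norm_real,
      Real.norm_eq_abs, sq_abs]
    set c := ∑ k, ‖U i k‖ ^ 2 * l k
    have hw := sum_normSq_row_of_mem_unitaryGroup hU i
    have hc : 0 < c := by
      have h3 := hD.diag_pos (i := i)
      rw [diag_of_unitary_conj h] at h3
      exact Complex.zero_lt_real.1 h3
    have h4 : 1 / √c ≤ ∑ k, ‖U i k‖ ^ 2 * (1 / √(l k)) := by
      refine le_trans (le_of_eq ?_) (Finset.sum_le_sum fun k _ =>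
        mul_le_mul_of_nonneg_left (inv_sqrt_tangent_le (h0 k) hc) (sq_nonneg _))
      have h5 : ∀ k, ‖U i k‖ ^ 2 * ((3 / 2 - l k / (2 * c)) / √c) =
          (‖U i k‖ ^ 2 * (3 / 2) - ‖U i k‖ ^ 2 * l k * (1 / (2 * c))) / √c := fun k => by ring
      simp only [h5]
      rw [← Finset.sum_div, Finset.sum_sub_distrib, ← Finset.sum_mul, ← Finset.sum_mul, hw]
      change 1 / √c = (1 * (3 / 2) - c * (1 / (2 * c))) / √c
      congr 1
      field_simp
      norm_num
    calc (1 : ℝ) = (1 / √c) ^ 2 * c := by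
          rw [div_pow, Real.sq_sqrt hc.le]
          field_simp
      _ ≤ _ := by gcongr

/-- For a positive definite block matrix with diagonal off-diagonal block, replacing the diagonal
blocks by their diagonals increases `det T / (det D₁ det D₂)`. -/
theorem PosDef.det_fromBlocks_diagonal_le {D₁ D₂ : Matrix n n ℂ} {q : n → ℝ}
    (hD₁ : D₁.PosDef) (hD₂ : D₂.PosDef)
    (hT : (fromBlocks D₁ (diagonal fun i => (q i : ℂ)) (diagonal fun i => (q i : ℂ)) D₂).PosSemidef) :
    (fromBlocks D₁ (diagonal fun i => (q i : ℂ)) (diagonal fun i => (q i : ℂ)) D₂).det.re ≤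
      D₁.det.re * D₂.det.re * ∏ i, (1 - q i ^ 2 / ((D₁ i i).re * (D₂ i i).re)) := by
  obtain ⟨S, hS, hSD, hSi⟩ := PosDef.exists_inv_sqrt hD₂
  set Q : Matrix n n ℂ := diagonal fun i => (q i : ℂ) with hQ
  have hQh : Qᴴ = Q := by
    rw [hQ, diagonal_conjTranspose]
    congr 1
    ext i
    simp
  let : Invertible D₁ := hD₁.isUnit.invertible
  have hsch : (D₂ - Qᴴ * D₁⁻¹ * Q).PosSemidef := by
    rw [← PosDef.fromBlocks₁₁ _ _ hD₁, hQh]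
    exact hT
  -- The Schur complement normalised by `S = D₂ ^ (-1/2)`: the determinant is `det D₁ det D₂ det G`,
  -- and Hadamard bounds `det G` by the diagonal of `G = 1 - K`.
  set G := S * (D₂ - Qᴴ * D₁⁻¹ * Q) * S with hG
  have hGp : G.PosSemidef := by
    have := hsch.conjTranspose_mul_mul_same S
    rwa [hS] at this
  have hdet : (fromBlocks D₁ Q Q D₂).det = D₁.det * D₂.det * G.det := by
    rw [det_fromBlocks₁₁, invOf_eq_nonsing_inv, hG, det_mul, det_mul, hQh]
    have := congrArg det hSD
    rw [det_mul, det_mul, det_one] at this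
    linear_combination (-(D₁.det * (D₂ - Q * D₁⁻¹ * Q).det)) * this
  set K := (Q * S)ᴴ * D₁⁻¹ * (Q * S) with hK
  have hGK : G = 1 - K := by
    rw [hG, hK, Matrix.mul_sub, Matrix.sub_mul, hSD, conjTranspose_mul, hS]
    simp only [Matrix.mul_assoc]
  -- This block matrix has zero Schur complement, hence is positive. Its 2×2 minors bound `K i i`
  -- from below without computing `D₁⁻¹`.
  have hPK : (fromBlocks D₁ (Q * S) (Q * S)ᴴ K).PosSemidef := by
    rw [PosDef.fromBlocks₁₁ _ _ hD₁, hK, sub_self]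
    exact PosSemidef.zero
  have hd1 : ∀ i, 0 < (D₁ i i).re := fun i => (Complex.pos_iff.1 (hD₁.diag_pos (i := i))).1
  have hd2 : ∀ i, 0 < (D₂ i i).re := fun i => (Complex.pos_iff.1 (hD₂.diag_pos (i := i))).1
  have hKi : ∀ i, q i ^ 2 / ((D₁ i i).re * (D₂ i i).re) ≤ (K i i).re := fun i => by
    have h1 := PosSemidef.normSq_apply_le hPK (Sum.inl i) (Sum.inr i)
    simp only [fromBlocks_apply₁₁, fromBlocks_apply₁₂, fromBlocks_apply₂₂] at h1
    have h2 : ‖D₁ i i‖ = (D₁ i i).re :=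
      (Complex.re_eq_norm.2 (hD₁.diag_pos (i := i)).le).symm
    have h3 : ‖K i i‖ = (K i i).re := by
      have := (hPK.submatrix Sum.inr).diag_nonneg (i := i)
      exact (Complex.re_eq_norm.2 this).symm
    have h4 : (Q * S) i i = q i * S i i := by rw [hQ, diagonal_mul]
    rw [h2, h3, h4, norm_mul, Complex.norm_real, Real.norm_eq_abs, mul_pow, sq_abs] at h1
    rw [div_le_iff₀ (mul_pos (hd1 i) (hd2 i))]
    calc q i ^ 2 ≤ q i ^ 2 * (‖S i i‖ ^ 2 * (D₂ i i).re) :=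
          le_mul_of_one_le_right (sq_nonneg _) (hSi i)
      _ = q i ^ 2 * ‖S i i‖ ^ 2 * (D₂ i i).re := by ring
      _ ≤ (D₁ i i).re * (K i i).re * (D₂ i i).re := by
          gcongr
          exact (hd2 i).le
      _ = _ := by ring
  have hGi : ∀ i, (G i i).re ≤ 1 - q i ^ 2 / ((D₁ i i).re * (D₂ i i).re) := fun i => by
    rw [hGK, Matrix.sub_apply, one_apply_eq, Complex.sub_re, Complex.one_re]
    linarith [hKi i]
  have hG0 : ∀ i, 0 ≤ (G i i).re := fun i =>
    (Complex.nonneg_iff.1 (hGp.diag_nonneg (i := i))).1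
  obtain ⟨hp1, hi1⟩ := Complex.pos_iff.1 hD₁.det_pos
  obtain ⟨hp2, hi2⟩ := Complex.pos_iff.1 hD₂.det_pos
  rw [hdet]
  simp only [Complex.mul_re, Complex.mul_im, ← hi1, ← hi2, zero_mul, mul_zero, sub_zero, add_zero]
  refine mul_le_mul_of_nonneg_left ?_ (mul_pos hp1 hp2).le
  exact (PosSemidef.det_re_le_prod_diag hGp).trans
    (Finset.prod_le_prod (fun i _ => hG0 i) fun i _ => hGi i)

end Determinant

/-! ### Integral representation of `t ^ p` for `1 < p < 2`. -/

section PowerKernel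

open MeasureTheory Set

/-- The kernel of the integral representation of `t ^ p`, for `1 < p < 2`. -/
def powKernel (t κ : ℝ) : ℝ := κ * t - Real.log (1 + κ * t)

theorem powKernel_nonneg {t κ : ℝ} (h : 0 ≤ κ * t) : 0 ≤ powKernel t κ := by
  have := Real.log_le_sub_one_of_pos (by linarith : 0 < 1 + κ * t)
  rw [powKernel]
  linarith

/-- The bound is quadratic in `κ * t` near zero and linear at infinity, so one estimate serves both
ends of the integral. -/
theorem powKernel_le {t κ : ℝ} (h : 0 ≤ κ * t) :
    powKernel t κ ≤ (κ * t) ^ 2 / (κ * t + 2) := by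
  have := Real.le_log_one_add_of_nonneg h
  rw [powKernel]
  have h2 : κ * t - 2 * (κ * t) / (κ * t + 2) = (κ * t) ^ 2 / (κ * t + 2) := by
    field_simp
    ring
  linarith

theorem measurable_powKernel_comp (t r : ℝ) :
    Measurable fun l : ℝ => powKernel t (l ^ r) := by
  unfold powKernel
  fun_prop

variable {p : ℝ}

theorem integrableOn_powKernel_one (h1 : 1 < p) (h2 : p < 2) :
    IntegrableOn (fun l : ℝ => powKernel 1 (l ^ (-(1 / p)))) (Ioi 0) := by
  have hp0 : 0 < p := by linarith
  have hnn : ∀ l : ℝ, 0 < l → 0 ≤ l ^ (-(1 / p)) * 1 := fun l hl => by positivity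
  rw [← Ioc_union_Ioi_eq_Ioi zero_le_one]
  -- On `(0, 1]` the kernel is at most `l ^ (-1/p)`, integrable because `p > 1`; on `(1, ∞)` it is
  -- at most `l ^ (-2/p)`, integrable because `p < 2`.
  refine IntegrableOn.union ?_ ?_
  · have h3 : IntegrableOn (fun l : ℝ => l ^ (-(1 / p))) (Ioc 0 1) := by
      rw [← intervalIntegrable_iff_integrableOn_Ioc_of_le zero_le_one]
      refine intervalIntegral.intervalIntegrable_rpow' ?_
      rw [neg_lt_neg_iff, div_lt_one hp0]
      exact h1
    refine Integrable.mono' h3 (measurable_powKernel_comp _ _).aestronglyMeasurable ?_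
    refine (ae_restrict_iff' measurableSet_Ioc).2 (Filter.Eventually.of_forall fun l hl => ?_)
    have h4 := hnn l hl.1
    rw [Real.norm_of_nonneg (powKernel_nonneg h4)]
    refine (powKernel_le h4).trans ?_
    rw [mul_one] at h4 ⊢
    rw [div_le_iff₀ (by linarith)]
    nlinarith
  · have h3 : IntegrableOn (fun l : ℝ => l ^ (-(2 / p))) (Ioi 1) := by
      refine integrableOn_Ioi_rpow_of_lt ?_ one_pos
      rw [neg_lt_neg_iff, lt_div_iff₀ hp0]
      linarith
    refine Integrable.mono' h3 (measurable_powKernel_comp _ _).aestronglyMeasurable ?_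
    refine (ae_restrict_iff' measurableSet_Ioi).2 (Filter.Eventually.of_forall fun l hl => ?_)
    have hl0 : (0 : ℝ) < l := one_pos.trans hl
    have h4 := hnn l hl0
    rw [Real.norm_of_nonneg (powKernel_nonneg h4)]
    refine (powKernel_le h4).trans ?_
    have h5 : l ^ (-(2 / p)) = (l ^ (-(1 / p))) ^ 2 := by
      rw [← Real.rpow_natCast, ← Real.rpow_mul hl0.le]
      congr 1
      push_cast
      ring
    rw [h5, mul_one, div_le_iff₀ (by rw [mul_one] at h4; linarith)]
    rw [mul_one] at h4
    nlinarith [sq_nonneg (l ^ (-(1 / p))), mul_nonneg h4 (sq_nonneg (l ^ (-(1 / p))))]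

/-- The normalization constant in the integral representation of `t ^ p`. -/
def powConst (p : ℝ) : ℝ := ∫ l in Ioi (0 : ℝ), powKernel 1 (l ^ (-(1 / p)))

theorem powConst_pos (h1 : 1 < p) (h2 : p < 2) : 0 < powConst p := by
  rw [powConst, setIntegral_pos_iff_support_of_nonneg_ae _ (integrableOn_powKernel_one h1 h2)]
  · have : Ioi (0 : ℝ) ⊆ Function.support (fun l : ℝ => powKernel 1 (l ^ (-(1 / p)))) := by
      intro l hl
      have h3 : (0 : ℝ) < l ^ (-(1 / p)) := Real.rpow_pos_of_pos hl _
      have := Real.log_lt_sub_one_of_pos (by linarith : 0 < 1 + l ^ (-(1 / p))) (by linarith)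
      simp only [Function.mem_support, powKernel, mul_one]
      intro h
      linarith
    rw [inter_eq_right.2 this, Real.volume_Ioi]
    exact ENNReal.zero_lt_top
  · refine (ae_restrict_iff' measurableSet_Ioi).2 (Filter.Eventually.of_forall fun l hl => ?_)
    refine powKernel_nonneg ?_
    rw [mul_one]
    exact Real.rpow_nonneg (le_of_lt hl) _

/-- The kernel depends only on `κ * t`, so `t` can be moved into a dilation of `l`. The Jacobian of
that dilation produces `t ^ p`. -/
theorem powKernel_comp_eq (hp : 0 < p) {t l : ℝ} (ht : 0 < t) (hl : 0 < l) :
    powKernel t (l ^ (-(1 / p))) = powKernel 1 ((t ^ (-p) * l) ^ (-(1 / p))) := by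
  have : (t ^ (-p) * l) ^ (-(1 / p)) = l ^ (-(1 / p)) * t := by
    rw [Real.mul_rpow (Real.rpow_nonneg ht.le _) hl.le, ← Real.rpow_mul ht.le]
    have h : -p * -(1 / p) = 1 := by field_simp
    rw [h, Real.rpow_one, mul_comm]
  rw [this, powKernel, powKernel, mul_one]

theorem integrableOn_powKernel (h1 : 1 < p) (h2 : p < 2) {t : ℝ} (ht : 0 ≤ t) :
    IntegrableOn (fun l : ℝ => powKernel t (l ^ (-(1 / p)))) (Ioi 0) := by
  rcases ht.eq_or_lt with rfl | ht
  · simp [powKernel]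
  · have h3 := (integrableOn_Ioi_comp_mul_left_iff
      (fun l : ℝ => powKernel 1 (l ^ (-(1 / p)))) 0 (Real.rpow_pos_of_pos ht (-p))).2
        (by rw [mul_zero]; exact integrableOn_powKernel_one h1 h2)
    refine h3.congr_fun (fun l hl => ?_) measurableSet_Ioi
    exact (powKernel_comp_eq (by linarith) ht hl).symm

theorem integral_powKernel (h1 : 1 < p) {t : ℝ} (ht : 0 ≤ t) :
    ∫ l in Ioi (0 : ℝ), powKernel t (l ^ (-(1 / p))) = t ^ p * powConst p := by
  rcases ht.eq_or_lt with rfl | ht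
  · simp [powKernel, Real.zero_rpow (by linarith : p ≠ 0)]
  · rw [setIntegral_congr_fun measurableSet_Ioi
      (fun l hl => powKernel_comp_eq (by linarith : 0 < p) ht hl)]
    rw [integral_comp_mul_left_Ioi (fun l : ℝ => powKernel 1 (l ^ (-(1 / p)))) 0
      (Real.rpow_pos_of_pos ht (-p)), mul_zero, Real.rpow_neg ht.le, inv_inv, smul_eq_mul]
    rfl

end PowerKernel

/-! ### Trace kernels, and subadditivity of the 2×2 defect by layer cake. -/

section TraceKernel

open MeasureTheory Set

variable {n : Type*} [Fintype n] [DecidableEq n] {p : ℝ}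

/-- The sum of `powKernel` over the eigenvalues of a positive semidefinite matrix. -/
def traceKernel (H : Matrix n n ℂ) (κ : ℝ) : ℝ :=
  κ * H.trace.re - Real.log (1 + (κ : ℂ) • H).det.re

theorem sum_powKernel_eigenvalues {H : Matrix n n ℂ} (hH : H.PosSemidef) {κ : ℝ} (hκ : 0 ≤ κ) :
    ∑ i, powKernel (hH.1.eigenvalues i) κ = traceKernel H κ := by
  obtain ⟨U, hU, h⟩ := IsHermitian.exists_unitary_diagonal_complex hH.1
  have h0 := hH.eigenvalues_nonneg
  have h1 : 1 + (κ : ℂ) • H =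
      U * diagonal (fun i => ((1 + κ * hH.1.eigenvalues i : ℝ) : ℂ)) * Uᴴ := by
    have h2 : (diagonal (fun i => ((1 + κ * hH.1.eigenvalues i : ℝ) : ℂ)) : Matrix n n ℂ) =
        1 + (κ : ℂ) • diagonal (fun i => (hH.1.eigenvalues i : ℂ)) := by
      rw [← diagonal_one, ← diagonal_smul, diagonal_add]
      congr 1
      ext i
      simp
    rw [h2, Matrix.mul_add, Matrix.add_mul, Matrix.mul_one, mul_star_self_of_mem_unitaryGroup hU,
      Matrix.mul_smul, Matrix.smul_mul, ← h]
  have h3 : H.trace.re = ∑ i, hH.1.eigenvalues i := by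
    have := hH.1.trace_eq_sum_eigenvalues
    rw [this]
    simp
  rw [traceKernel, det_of_unitary_conj hU h1, Complex.ofReal_re, h3, Real.log_prod, Finset.mul_sum,
    ← Finset.sum_sub_distrib]
  · rfl
  · intro i _
    have := mul_nonneg hκ (h0 i)
    linarith

theorem integrableOn_traceKernel (h1 : 1 < p) (h2 : p < 2) {H : Matrix n n ℂ}
    (hH : H.PosSemidef) :
    IntegrableOn (fun l : ℝ => traceKernel H (l ^ (-(1 / p)))) (Ioi 0) := by
  have h3 : IntegrableOn (fun l : ℝ => ∑ i, powKernel (hH.1.eigenvalues i) (l ^ (-(1 / p))))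
      (Ioi 0) :=
    integrable_finsetSum _ fun i _ => integrableOn_powKernel h1 h2 (hH.eigenvalues_nonneg i)
  refine h3.congr_fun (fun l hl => ?_) measurableSet_Ioi
  exact sum_powKernel_eigenvalues hH (Real.rpow_nonneg (le_of_lt hl) _)

theorem integral_traceKernel (h1 : 1 < p) (h2 : p < 2) {H : Matrix n n ℂ} (hH : H.PosSemidef) :
    ∫ l in Ioi (0 : ℝ), traceKernel H (l ^ (-(1 / p))) = schattenNorm p H ^ p * powConst p := by
  rw [setIntegral_congr_fun measurableSet_Ioi (fun l hl =>
    (sum_powKernel_eigenvalues hH (Real.rpow_nonneg (le_of_lt hl) (-(1 / p)))).symm),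
    integral_finsetSum _ fun i _ => integrableOn_powKernel h1 h2 (hH.eigenvalues_nonneg i),
    schattenNorm_rpow_of_isHermitian hH.1 (by linarith), Finset.sum_mul]
  refine Finset.sum_congr rfl fun i _ => ?_
  rw [integral_powKernel h1 (hH.eigenvalues_nonneg i), abs_of_nonneg (hH.eigenvalues_nonneg i)]

/-- The symmetric real `2 × 2` matrix with entries `x, y, y, z`, as a complex matrix. -/
def symmMatrix (x y z : ℝ) : Matrix (Fin 2) (Fin 2) ℂ := !![(x : ℂ), y; y, z]

theorem isHermitian_symmMatrix (x y z : ℝ) : (symmMatrix x y z).IsHermitian := by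
  ext i j
  fin_cases i <;> fin_cases j <;> simp [symmMatrix]

theorem posSemidef_symmMatrix {x y z : ℝ} (hx : 0 ≤ x) (hz : 0 ≤ z) (h : y ^ 2 ≤ x * z) :
    (symmMatrix x y z).PosSemidef := by
  refine PosSemidef.of_dotProduct_mulVec_nonneg (isHermitian_symmMatrix x y z) fun v => ?_
  have h1 : star v ⬝ᵥ symmMatrix x y z *ᵥ v =
      ((x * Complex.normSq (v 0) + 2 * y * (star (v 0) * v 1).re + z * Complex.normSq (v 1) : ℝ) : ℂ) := by
    apply Complex.ext
    · simp [symmMatrix, dotProduct, mulVec, Fin.sum_univ_two, Complex.normSq_apply]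
      ring
    · simp [symmMatrix, dotProduct, mulVec, Fin.sum_univ_two, Complex.normSq_apply]
      ring
  rw [h1, Complex.zero_le_real]
  set a := ‖v 0‖
  set b := ‖v 1‖
  have h2 : Complex.normSq (v 0) = a ^ 2 := Complex.normSq_eq_norm_sq _
  have h3 : Complex.normSq (v 1) = b ^ 2 := Complex.normSq_eq_norm_sq _
  have h4 : |(star (v 0) * v 1).re| ≤ a * b := by
    refine (Complex.abs_re_le_norm _).trans ?_
    rw [norm_mul, norm_star]
  have ha : 0 ≤ a := norm_nonneg _
  have hb : 0 ≤ b := norm_nonneg _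
  have h5 : |y * (star (v 0) * v 1).re| ≤ √x * a * (√z * b) := by
    rw [abs_mul]
    have : |y| ≤ √x * √z := by
      rw [← Real.sqrt_mul hx]
      exact Real.abs_le_sqrt h
    calc _ ≤ √x * √z * (a * b) := mul_le_mul this h4 (abs_nonneg _) (by positivity)
      _ = _ := by ring
  have h6 := (abs_le.1 h5).1
  have h7 : x * a ^ 2 + z * b ^ 2 = (√x * a) ^ 2 + (√z * b) ^ 2 := by
    rw [mul_pow, mul_pow, Real.sq_sqrt hx, Real.sq_sqrt hz]
  rw [h2, h3]
  nlinarith [sq_nonneg (√x * a - √z * b)]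

/-- The logarithm of `d₁ d₂ / (d₁ d₂ - (κ y) ^ 2)`, where `d₁ = 1 + κ x` and `d₂ = 1 + κ z`. -/
def logDefect (x y z κ : ℝ) : ℝ :=
  Real.log (1 + κ * x) + Real.log (1 + κ * z) -
    Real.log ((1 + κ * x) * (1 + κ * z) - (κ * y) ^ 2)

/-- `logDefect` is exactly what the off-diagonal entry adds to the kernel of the diagonal matrix. -/
theorem traceKernel_symmMatrix (x y z κ : ℝ) :
    traceKernel (symmMatrix x y z) κ = powKernel x κ + powKernel z κ + logDefect x y z κ := by
  have h : (1 + (κ : ℂ) • symmMatrix x y z).det.re =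
      (1 + κ * x) * (1 + κ * z) - (κ * y) ^ 2 := by
    rw [det_fin_two]
    simp [symmMatrix]
    ring
  have h2 : (symmMatrix x y z).trace.re = x + z := by
    simp [symmMatrix, trace, Fin.sum_univ_two]
  rw [traceKernel, h, h2, powKernel, powKernel, logDefect]
  ring

theorem defect_pos {x y z κ : ℝ} (hx : 0 ≤ x) (hz : 0 ≤ z) (h : y ^ 2 ≤ x * z) (hκ : 0 ≤ κ) :
    0 < (1 + κ * x) * (1 + κ * z) - (κ * y) ^ 2 := by
  have h1 := mul_nonneg hκ hx
  have h2 := mul_nonneg hκ hz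
  have h3 := mul_le_mul_of_nonneg_left h (sq_nonneg κ)
  nlinarith

theorem logDefect_nonneg {x y z κ : ℝ} (hx : 0 ≤ x) (hz : 0 ≤ z) (h : y ^ 2 ≤ x * z)
    (hκ : 0 ≤ κ) : 0 ≤ logDefect x y z κ := by
  have h1 := mul_nonneg hκ hx
  have h2 := mul_nonneg hκ hz
  rw [logDefect, ← Real.log_mul (by linarith) (by linarith), sub_nonneg]
  refine Real.log_le_log (defect_pos hx hz h hκ) ?_
  nlinarith [sq_nonneg (κ * y)]

/-- With `κ⁻¹ = l ^ (1/p)` and `t ≥ 0` the left side is nondecreasing in `l`, so the superlevel sets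
are initial intervals of `(0, ∞)`. -/
theorem lt_logDefect_iff {x y z κ : ℝ} (hx : 0 ≤ x) (hz : 0 ≤ z) (h : y ^ 2 ≤ x * z)
    (hκ : 0 < κ) (t : ℝ) :
    t < logDefect x y z κ ↔ (1 - Real.exp (-t)) * ((κ⁻¹ + x) * (κ⁻¹ + z)) < y ^ 2 := by
  have h1 := mul_nonneg hκ.le hx
  have h2 := mul_nonneg hκ.le hz
  have hd := defect_pos hx hz h hκ.le
  set c := (1 + κ * x) * (1 + κ * z) - (κ * y) ^ 2 with hc
  have hab : 0 < (1 + κ * x) * (1 + κ * z) := mul_pos (by linarith) (by linarith)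
  rw [logDefect, ← hc, ← Real.log_mul (by linarith) (by linarith), lt_sub_iff_add_lt,
    ← Real.log_exp t, ← Real.log_mul (Real.exp_pos t).ne' hd.ne',
    Real.log_lt_log_iff (mul_pos (Real.exp_pos _) hd) hab, Real.log_exp]
  have he : Real.exp (-t) * Real.exp t = 1 := by rw [← Real.exp_add]; simp
  have hk : κ * κ⁻¹ = 1 := mul_inv_cancel₀ hκ.ne'
  have h3 : (1 + κ * x) * (1 + κ * z) = κ ^ 2 * ((κ⁻¹ + x) * (κ⁻¹ + z)) := by
    linear_combination (-(1 + κ * κ⁻¹ + κ * x + κ * z)) * hk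
  have hk2 : 0 < κ ^ 2 := by positivity
  have hk3 : (κ * y) ^ 2 = κ ^ 2 * y ^ 2 := mul_pow _ _ _
  have hee : ∀ w, Real.exp (-t) * (Real.exp t * w) = w := fun w => by rw [← mul_assoc, he, one_mul]
  rw [hc, h3, hk3, ← mul_lt_mul_iff_right₀ (Real.exp_pos (-t)), hee,
    ← mul_lt_mul_iff_right₀ hk2 (b := (1 - Real.exp (-t)) * ((κ⁻¹ + x) * (κ⁻¹ + z)))]
  constructor <;> intro h4 <;> linarith

/-- Raise the bounds to the power `p/2`, sum, and apply Cauchy–Schwarz; Minkowski in `ℓ^p` then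
handles `l + x` and `l + z`. It serves to pass from levels outside the small defect sets to a level
outside the large one. -/
theorem sq_le_of_forall_sq_le (hp : 1 ≤ p) {ι : Type*} (s : Finset ι) {δ X Y Z L : ℝ}
    {x y z l : ι → ℝ} (hδ : 0 ≤ δ) (hX : 0 ≤ X) (hY : 0 ≤ Y) (hZ : 0 ≤ Z) (hL : 0 ≤ L)
    (hx : ∀ i, 0 ≤ x i) (hy : ∀ i, 0 ≤ y i) (hz : ∀ i, 0 ≤ z i) (hl : ∀ i, 0 ≤ l i)
    (hxX : ∑ i ∈ s, x i ^ p ≤ X ^ p) (hyY : Y ^ p ≤ ∑ i ∈ s, y i ^ p)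
    (hzZ : ∑ i ∈ s, z i ^ p ≤ Z ^ p) (hlL : ∑ i ∈ s, l i ^ p ≤ L ^ p)
    (h : ∀ i, y i ^ 2 ≤ δ * ((l i + x i) * (l i + z i))) :
    Y ^ 2 ≤ δ * ((L + X) * (L + Z)) := by
  have hp0 : 0 < p := by linarith
  have mink : ∀ {w : ι → ℝ} {W : ℝ}, (∀ i, 0 ≤ w i) → 0 ≤ W → ∑ i ∈ s, w i ^ p ≤ W ^ p →
      ∑ i ∈ s, (l i + w i) ^ p ≤ (L + W) ^ p := by
    intro w W hw hW hwW
    have root : ∀ {v : ι → ℝ} {V : ℝ}, (∀ i, 0 ≤ v i) → 0 ≤ V → ∑ i ∈ s, v i ^ p ≤ V ^ p →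
        (∑ i ∈ s, v i ^ p) ^ (1 / p) ≤ V := fun {v V} hv hV hvV => by
      refine (Real.rpow_le_rpow (Finset.sum_nonneg fun i _ => Real.rpow_nonneg (hv i) _) hvV
        (by positivity)).trans_eq ?_
      rw [one_div, Real.rpow_rpow_inv hV hp0.ne']
    have h1 := Real.Lp_add_le_of_nonneg s hp (f := l) (g := w) (fun i _ => hl i) (fun i _ => hw i)
    have h2 := h1.trans (add_le_add (root hl hL hlL) (root hw hW hwW))
    have h3 : 0 ≤ ∑ i ∈ s, (l i + w i) ^ p :=
      Finset.sum_nonneg fun i _ => Real.rpow_nonneg (add_nonneg (hl i) (hw i)) _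
    have h4 := Real.rpow_le_rpow (Real.rpow_nonneg h3 _) h2 hp0.le
    rwa [one_div, Real.rpow_inv_rpow h3 hp0.ne'] at h4
  have half : ∀ {v : ℝ}, 0 ≤ v → (v ^ (p / 2)) ^ 2 = v ^ p := fun {v} hv => by
    rw [← Real.rpow_natCast, ← Real.rpow_mul hv]
    congr 1
    push_cast
    ring
  have h1 : ∀ i, y i ^ p ≤ δ ^ (p / 2) * ((l i + x i) ^ (p / 2) * (l i + z i) ^ (p / 2)) := by
    intro i
    have hu := add_nonneg (hl i) (hx i)
    have hw := add_nonneg (hl i) (hz i)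
    rw [← Real.mul_rpow hu hw, ← Real.mul_rpow hδ (mul_nonneg hu hw)]
    refine le_trans (le_of_eq ?_) (Real.rpow_le_rpow (sq_nonneg _) (h i) (by positivity))
    rw [← Real.rpow_natCast, ← Real.rpow_mul (hy i)]
    congr 1
    push_cast
    ring
  have h2 : (Y ^ p) ^ 2 ≤ δ ^ p * ((L + X) ^ p * (L + Z) ^ p) := by
    calc (Y ^ p) ^ 2 ≤ (δ ^ (p / 2) *
          ∑ i ∈ s, (l i + x i) ^ (p / 2) * (l i + z i) ^ (p / 2)) ^ 2 := by
          refine pow_le_pow_left₀ (Real.rpow_nonneg hY _) ?_ 2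
          rw [Finset.mul_sum]
          exact hyY.trans (Finset.sum_le_sum fun i _ => h1 i)
      _ ≤ δ ^ p * ((∑ i ∈ s, (l i + x i) ^ p) * ∑ i ∈ s, (l i + z i) ^ p) := by
          rw [mul_pow, half hδ]
          refine mul_le_mul_of_nonneg_left ?_ (Real.rpow_nonneg hδ _)
          refine (Finset.sum_mul_sq_le_sq_mul_sq _ _ _).trans (le_of_eq ?_)
          congr 1
          · exact Finset.sum_congr rfl fun i _ => half (add_nonneg (hl i) (hx i))
          · exact Finset.sum_congr rfl fun i _ => half (add_nonneg (hl i) (hz i))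
      _ ≤ _ := by
          refine mul_le_mul_of_nonneg_left ?_ (Real.rpow_nonneg hδ _)
          exact mul_le_mul (mink hx hX hxX) (mink hz hZ hzZ)
            (Finset.sum_nonneg fun i _ => Real.rpow_nonneg (add_nonneg (hl i) (hz i)) _)
            (Real.rpow_nonneg (add_nonneg hL hX) _)
  rw [← Real.mul_rpow (by positivity) (by positivity), ← Real.mul_rpow hδ (by positivity),
    ← Real.rpow_natCast, ← Real.rpow_mul hY, mul_comm p, Real.rpow_mul hY, Real.rpow_natCast] at h2
  exact (Real.rpow_le_rpow_iff (sq_nonneg _) (by positivity) hp0).1 h2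

/-- A superlevel set of `l ↦ logDefect x y z (l ^ (-1 / p))`. -/
def defectSet (p δ x y z : ℝ) : Set ℝ :=
  {l | δ * ((l ^ (1 / p) + x) * (l ^ (1 / p) + z)) < y ^ 2} ∩ Ioi 0

theorem mem_defectSet {δ x y z l : ℝ} :
    l ∈ defectSet p δ x y z ↔ δ * ((l ^ (1 / p) + x) * (l ^ (1 / p) + z)) < y ^ 2 ∧ 0 < l :=
  Iff.rfl

theorem Ioc_subset_defectSet (hp : 0 < p) {δ x y z l : ℝ} (hδ : 0 ≤ δ) (hx : 0 ≤ x) (hz : 0 ≤ z)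
    (hl : l ∈ defectSet p δ x y z) : Ioc 0 l ⊆ defectSet p δ x y z := by
  rintro k ⟨hk0, hkl⟩
  refine mem_defectSet.2 ⟨lt_of_le_of_lt ?_ hl.1, hk0⟩
  have h1 : k ^ (1 / p) ≤ l ^ (1 / p) := Real.rpow_le_rpow hk0.le hkl (by positivity)
  have h2 : 0 ≤ k ^ (1 / p) := Real.rpow_nonneg hk0.le _
  have h3 : 0 ≤ l ^ (1 / p) := h2.trans h1
  gcongr

/-- The sets are initial intervals, so it suffices that no point of the large one exceeds the sum of
the small lengths `a i`. If `l` did, levels `a i + ε` summing to `l` would lie outside every small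
set, forcing `l` outside the large one. -/
theorem volume_defectSet_le (hp : 1 ≤ p) {ι : Type*} (s : Finset ι) {δ X Y Z : ℝ}
    {x y z : ι → ℝ} (hδ : 0 ≤ δ) (hX : 0 ≤ X) (hY : 0 ≤ Y) (hZ : 0 ≤ Z)
    (hx : ∀ i, 0 ≤ x i) (hy : ∀ i, 0 ≤ y i) (hz : ∀ i, 0 ≤ z i)
    (hxX : ∑ i ∈ s, x i ^ p ≤ X ^ p) (hyY : Y ^ p ≤ ∑ i ∈ s, y i ^ p)
    (hzZ : ∑ i ∈ s, z i ^ p ≤ Z ^ p) :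
    volume (defectSet p δ X Y Z) ≤ ∑ i ∈ s, volume (defectSet p δ (x i) (y i) (z i)) := by
  have hp0 : 0 < p := by linarith
  by_cases htop : ∑ i ∈ s, volume (defectSet p δ (x i) (y i) (z i)) = ⊤
  · rw [htop]
    exact le_top
  have hfin : ∀ i ∈ s, volume (defectSet p δ (x i) (y i) (z i)) ≠ ⊤ :=
    fun i hi h => htop (ENNReal.sum_eq_top.2 ⟨i, hi, h⟩)
  set a : ι → ℝ := fun i => (volume (defectSet p δ (x i) (y i) (z i))).toReal with ha
  have ha0 : ∀ i, 0 ≤ a i := fun i => ENNReal.toReal_nonneg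
  have hsum : ∑ i ∈ s, volume (defectSet p δ (x i) (y i) (z i)) =
      ENNReal.ofReal (∑ i ∈ s, a i) := by
    rw [ENNReal.ofReal_sum_of_nonneg fun i _ => ha0 i]
    exact Finset.sum_congr rfl fun i hi => (ENNReal.ofReal_toReal (hfin i hi)).symm
  have hsub : defectSet p δ X Y Z ⊆ Ioc 0 (∑ i ∈ s, a i) := by
    intro l hl
    refine ⟨hl.2, ?_⟩
    by_contra! hlt
    have hl0 : 0 < l := hl.2
    have hne : s.Nonempty := by
      by_contra hne
      rw [Finset.not_nonempty_iff_eq_empty] at hne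
      rw [hne, Finset.sum_empty] at hyY
      have hY0 : Y = 0 := by
        by_contra hY0
        exact absurd hyY (not_le.2 (Real.rpow_pos_of_pos (lt_of_le_of_ne hY (Ne.symm hY0)) p))
      have h1 : δ * ((l ^ (1 / p) + X) * (l ^ (1 / p) + Z)) < Y ^ 2 := hl.1
      rw [hY0] at h1
      have h2 : 0 ≤ l ^ (1 / p) := Real.rpow_nonneg hl0.le _
      have h3 : 0 ≤ δ * ((l ^ (1 / p) + X) * (l ^ (1 / p) + Z)) := by positivity
      linarith
    have hcard : (0 : ℝ) < s.card := by exact_mod_cast hne.card_pos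
    -- The excess of `l` is shared equally, so that the levels `a i + ε` sum to `l`.
    set ε := (l - ∑ i ∈ s, a i) / s.card with hε
    have hε0 : 0 < ε := div_pos (by linarith) hcard
    have hmem : ∀ i ∈ s, a i + ε ∉ defectSet p δ (x i) (y i) (z i) := by
      intro i hi hmem
      have h1 := measure_mono (μ := volume) (Ioc_subset_defectSet hp0 hδ (hx i) (hz i) hmem)
      rw [Real.volume_Ioc, sub_zero, ← ENNReal.ofReal_toReal (hfin i hi),
        ENNReal.ofReal_le_ofReal_iff ENNReal.toReal_nonneg] at h1
      have : a i + ε ≤ a i := h1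
      linarith
    have hsl : ∑ i ∈ s, (a i + ε) = l := by
      rw [Finset.sum_add_distrib, Finset.sum_const, nsmul_eq_mul, hε]
      field_simp
      ring
    have root : ∀ {v : ℝ}, 0 ≤ v → (v ^ (1 / p)) ^ p = v := fun {v} hv => by
      rw [one_div, Real.rpow_inv_rpow hv hp0.ne']
    have hae : ∀ i, 0 < a i + ε := fun i => add_pos_of_nonneg_of_pos (ha0 i) hε0
    classical
    -- The pointwise bound is required at every index, so `y` is replaced by zero off `s`.
    have key := sq_le_of_forall_sq_le hp s (δ := δ) (X := X) (Y := Y) (Z := Z) (L := l ^ (1 / p))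
      (x := x) (y := fun i => if i ∈ s then y i else 0) (z := z) (l := fun i => (a i + ε) ^ (1 / p))
      hδ hX hY hZ (Real.rpow_nonneg hl0.le _) hx
      (fun i => by split_ifs; exacts [hy i, le_rfl]) hz
      (fun i => Real.rpow_nonneg (hae i).le _) hxX
      (hyY.trans_eq (Finset.sum_congr rfl fun i hi => by simp [hi])) hzZ
      (by rw [root hl0.le, Finset.sum_congr rfl fun i _ => root (hae i).le, hsl])
      (fun i => by
        have h2 : 0 ≤ (a i + ε) ^ (1 / p) := Real.rpow_nonneg (hae i).le _
        split_ifs with hi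
        · by_contra! h3
          exact hmem i hi (mem_defectSet.2 ⟨h3, hae i⟩)
        · have := hx i
          have := hz i
          rw [zero_pow two_ne_zero]
          positivity)
    exact absurd hl.1 (not_lt.2 key)
  calc volume (defectSet p δ X Y Z) ≤ volume (Ioc 0 (∑ i ∈ s, a i)) := measure_mono hsub
    _ = _ := by rw [Real.volume_Ioc, sub_zero, hsum]

theorem measurable_logDefect_comp (x y z r : ℝ) :
    Measurable fun l : ℝ => logDefect x y z (l ^ r) := by
  unfold logDefect
  fun_prop

/-- The layer-cake formula, with the superlevel sets written as defect sets of parameter `1 - exp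
(-t)`. -/
theorem lintegral_logDefect {x y z : ℝ} (hx : 0 ≤ x) (hz : 0 ≤ z)
    (h : y ^ 2 ≤ x * z) :
    ∫⁻ l in Ioi (0 : ℝ), ENNReal.ofReal (logDefect x y z (l ^ (-(1 / p)))) =
      ∫⁻ t in Ioi (0 : ℝ), volume (defectSet p (1 - Real.exp (-t)) x y z) := by
  rw [lintegral_eq_lintegral_meas_lt]
  · refine lintegral_congr fun t => ?_
    rw [Measure.restrict_apply' measurableSet_Ioi]
    congr 1
    ext l
    rw [mem_defectSet, mem_inter_iff, mem_ofPred_eq, mem_Ioi]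
    refine and_congr_left fun hl => ?_
    have hl0 : (0 : ℝ) < l := hl
    rw [lt_logDefect_iff hx hz h (Real.rpow_pos_of_pos hl0 _), Real.rpow_neg hl0.le, inv_inv]
  · refine (ae_restrict_iff' measurableSet_Ioi).2 (Filter.Eventually.of_forall fun l hl => ?_)
    exact logDefect_nonneg hx hz h (Real.rpow_nonneg (le_of_lt hl) _)
  · exact (measurable_logDefect_comp _ _ _ _).aemeasurable

/-- Supplies measurability in `t`, needed to interchange the finite sum with the lower integral. -/
theorem antitone_volume_defectSet {x y z : ℝ} (hx : 0 ≤ x) (hz : 0 ≤ z) :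
    Antitone fun t : ℝ => volume (defectSet p (1 - Real.exp (-t)) x y z) := by
  intro t u htu
  refine measure_mono fun l hl => mem_defectSet.2 ⟨lt_of_le_of_lt ?_ hl.1, hl.2⟩
  have h2 : 0 ≤ l ^ (1 / p) := Real.rpow_nonneg (le_of_lt hl.2) _
  have h3 : Real.exp (-u) ≤ Real.exp (-t) := Real.exp_le_exp.2 (by linarith)
  refine mul_le_mul_of_nonneg_right (by linarith) (by positivity)

theorem integrableOn_logDefect (h1 : 1 < p) (h2 : p < 2) {x y z : ℝ} (hx : 0 ≤ x) (hz : 0 ≤ z)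
    (h : y ^ 2 ≤ x * z) :
    IntegrableOn (fun l : ℝ => logDefect x y z (l ^ (-(1 / p)))) (Ioi 0) := by
  refine (((integrableOn_traceKernel h1 h2 (posSemidef_symmMatrix hx hz h)).sub
    (integrableOn_powKernel h1 h2 hx)).sub (integrableOn_powKernel h1 h2 hz)).congr_fun
      (fun l _ => ?_) measurableSet_Ioi
  simp only [Pi.sub_apply, traceKernel_symmMatrix]
  ring

theorem integral_logDefect (h1 : 1 < p) (h2 : p < 2) {x y z : ℝ} (hx : 0 ≤ x) (hz : 0 ≤ z)
    (h : y ^ 2 ≤ x * z) :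
    ∫ l in Ioi (0 : ℝ), logDefect x y z (l ^ (-(1 / p))) =
      (schattenNorm p (symmMatrix x y z) ^ p - x ^ p - z ^ p) * powConst p := by
  have h3 := integral_traceKernel h1 h2 (posSemidef_symmMatrix hx hz h)
  simp only [traceKernel_symmMatrix] at h3
  rw [integral_add (f := fun l : ℝ => powKernel x (l ^ (-(1 / p))) + powKernel z (l ^ (-(1 / p))))
    ((integrableOn_powKernel h1 h2 hx).add (integrableOn_powKernel h1 h2 hz))
    (integrableOn_logDefect h1 h2 hx hz h), integral_add (integrableOn_powKernel h1 h2 hx)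
    (integrableOn_powKernel h1 h2 hz), integral_powKernel h1 hx, integral_powKernel h1 hz] at h3
  linarith

/-- Subadditivity of the integrated `logDefect` in the `p`-th powers of its arguments. -/
theorem integral_logDefect_le_sum (h1 : 1 < p) (h2 : p < 2) {ι : Type*} (s : Finset ι)
    {X Y Z : ℝ} {x y z : ι → ℝ} (hX : 0 ≤ X) (hY : 0 ≤ Y) (hZ : 0 ≤ Z)
    (hx : ∀ i, 0 ≤ x i) (hy : ∀ i, 0 ≤ y i) (hz : ∀ i, 0 ≤ z i)
    (hXYZ : Y ^ 2 ≤ X * Z) (hxyz : ∀ i, y i ^ 2 ≤ x i * z i)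
    (hxX : ∑ i ∈ s, x i ^ p ≤ X ^ p) (hyY : Y ^ p ≤ ∑ i ∈ s, y i ^ p)
    (hzZ : ∑ i ∈ s, z i ^ p ≤ Z ^ p) :
    ∫ l in Ioi (0 : ℝ), logDefect X Y Z (l ^ (-(1 / p))) ≤
      ∑ i ∈ s, ∫ l in Ioi (0 : ℝ), logDefect (x i) (y i) (z i) (l ^ (-(1 / p))) := by
  have hnn : ∀ {a b c : ℝ}, 0 ≤ a → 0 ≤ c → b ^ 2 ≤ a * c →
      0 ≤ᵐ[volume.restrict (Ioi 0)] fun l : ℝ => logDefect a b c (l ^ (-(1 / p))) :=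
    fun ha hc habc => (ae_restrict_iff' measurableSet_Ioi).2
      (Filter.Eventually.of_forall fun l hl =>
        logDefect_nonneg ha hc habc (Real.rpow_nonneg (le_of_lt hl) _))
  have hs0 : ∀ i ∈ s, 0 ≤ ∫ l in Ioi (0 : ℝ), logDefect (x i) (y i) (z i) (l ^ (-(1 / p))) :=
    fun i _ => integral_nonneg_of_ae (hnn (hx i) (hz i) (hxyz i))
  rw [← ENNReal.ofReal_le_ofReal_iff (Finset.sum_nonneg hs0), ENNReal.ofReal_sum_of_nonneg hs0,
    ofReal_integral_eq_lintegral_ofReal (integrableOn_logDefect h1 h2 hX hZ hXYZ)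
      (hnn hX hZ hXYZ), lintegral_logDefect hX hZ hXYZ]
  have h3 : ∀ i, ENNReal.ofReal (∫ l in Ioi (0 : ℝ), logDefect (x i) (y i) (z i) (l ^ (-(1 / p)))) =
      ∫⁻ t in Ioi (0 : ℝ), volume (defectSet p (1 - Real.exp (-t)) (x i) (y i) (z i)) := fun i => by
    rw [ofReal_integral_eq_lintegral_ofReal (integrableOn_logDefect h1 h2 (hx i) (hz i) (hxyz i))
      (hnn (hx i) (hz i) (hxyz i)), lintegral_logDefect (hx i) (hz i) (hxyz i)]
  rw [Finset.sum_congr rfl fun i _ => h3 i, ← lintegral_finsetSum s fun i _ =>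
    (antitone_volume_defectSet (hx i) (hz i)).measurable]
  -- The comparison holds separately at each height `t`.
  refine setLIntegral_mono' measurableSet_Ioi fun t ht => ?_
  refine volume_defectSet_le h1.le s ?_ hX hY hZ hx hy hz hxX hyY hzZ
  rw [sub_nonneg]
  exact Real.exp_le_one_iff.2 (by simpa using le_of_lt ht)

end TraceKernel

/-! ### Block matrices against the 2×2 matrices of their block norms. -/

section Blocks

open MeasureTheory Set

variable {n : Type*} [Fintype n] [DecidableEq n] {p q : ℝ}

set_option linter.unusedSectionVars false

theorem trace_fromBlocks_eq (A B C D : Matrix n n ℂ) :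
    (fromBlocks A B C D).trace = A.trace + D.trace := by
  simp [trace]

theorem PosSemidef.fromBlocks_left {X Y Y' Z : Matrix n n ℂ} (h : (fromBlocks X Y Y' Z).PosSemidef) :
    X.PosSemidef := h.submatrix Sum.inl

theorem PosSemidef.fromBlocks_right {X Y Y' Z : Matrix n n ℂ}
    (h : (fromBlocks X Y Y' Z).PosSemidef) : Z.PosSemidef := h.submatrix Sum.inr

/-- The negative logarithm of the block determinant bound for `1 + κ N`: each factor contributes one
`logDefect`, and the trace terms match. -/
theorem traceKernel_fromBlocks_diagonal_ge {P R : Matrix n n ℂ} {s : n → ℝ}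
    (hN : (fromBlocks P (diagonal fun i => (s i : ℂ)) (diagonal fun i => (s i : ℂ)) R).PosSemidef)
    {κ : ℝ} (hκ : 0 ≤ κ) :
    traceKernel P κ + traceKernel R κ + ∑ i, logDefect (P i i).re (s i) (R i i).re κ ≤
      traceKernel (fromBlocks P (diagonal fun i => (s i : ℂ)) (diagonal fun i => (s i : ℂ)) R) κ := by
  have hP := PosSemidef.fromBlocks_left hN
  have hR := PosSemidef.fromBlocks_right hN
  have hκ' : (0 : ℂ) ≤ (κ : ℂ) := by exact_mod_cast hκ
  have pd : ∀ {m : Type _} [Fintype m] [DecidableEq m] {H : Matrix m m ℂ}, H.PosSemidef →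
      (1 + (κ : ℂ) • H).PosDef := fun hH => PosDef.one.add_posSemidef (hH.smul hκ')
  have hD₁ := pd hP
  have hD₂ := pd hR
  have hT := pd hN
  have hTe : 1 + (κ : ℂ) • fromBlocks P (diagonal fun i => (s i : ℂ))
      (diagonal fun i => (s i : ℂ)) R = fromBlocks (1 + (κ : ℂ) • P)
        (diagonal fun i => ((κ * s i : ℝ) : ℂ)) (diagonal fun i => ((κ * s i : ℝ) : ℂ))
          (1 + (κ : ℂ) • R) := by
    have h1 : (κ : ℂ) • (diagonal fun i => (s i : ℂ) : Matrix n n ℂ) =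
        diagonal fun i => ((κ * s i : ℝ) : ℂ) := by
      rw [← diagonal_smul]
      congr 1
      ext i
      simp
    rw [← fromBlocks_one, fromBlocks_smul, fromBlocks_add, h1, zero_add]
  have hdet := PosDef.det_fromBlocks_diagonal_le hD₁ hD₂ (hTe ▸ hT.posSemidef)
  have hre : ∀ (H : Matrix n n ℂ) (i : n), ((1 + (κ : ℂ) • H) i i).re = 1 + κ * (H i i).re :=
    fun H i => by simp
  have hnn : ∀ {H : Matrix n n ℂ}, H.PosSemidef → ∀ i, 0 ≤ (H i i).re := fun hH i =>
    (Complex.nonneg_iff.1 (hH.diag_nonneg (i := i))).1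
  have hs : ∀ i, s i ^ 2 ≤ (P i i).re * (R i i).re := fun i => by
    have h1 := PosSemidef.normSq_apply_le hN (Sum.inl i) (Sum.inr i)
    simp only [fromBlocks_apply₁₁, fromBlocks_apply₁₂, fromBlocks_apply₂₂, diagonal_apply_eq,
      Complex.norm_real, Real.norm_eq_abs, sq_abs] at h1
    rwa [← Complex.re_eq_norm.2 (hP.diag_nonneg (i := i)),
      ← Complex.re_eq_norm.2 (hR.diag_nonneg (i := i))] at h1
  have hfac : ∀ i, 0 < 1 - (κ * s i) ^ 2 / ((1 + κ * (P i i).re) * (1 + κ * (R i i).re)) ∧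
      Real.log (1 - (κ * s i) ^ 2 / ((1 + κ * (P i i).re) * (1 + κ * (R i i).re))) =
        -logDefect (P i i).re (s i) (R i i).re κ := fun i => by
    have h1 := mul_nonneg hκ (hnn hP i)
    have h2 := mul_nonneg hκ (hnn hR i)
    have h3 := defect_pos (hnn hP i) (hnn hR i) (hs i) hκ
    have h4 : 0 < (1 + κ * (P i i).re) * (1 + κ * (R i i).re) :=
      mul_pos (by linarith) (by linarith)
    have h5 : 1 - (κ * s i) ^ 2 / ((1 + κ * (P i i).re) * (1 + κ * (R i i).re)) =
        ((1 + κ * (P i i).re) * (1 + κ * (R i i).re) - (κ * s i) ^ 2) /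
          ((1 + κ * (P i i).re) * (1 + κ * (R i i).re)) := by
      rw [sub_div, div_self h4.ne']
    rw [h5]
    refine ⟨div_pos h3 h4, ?_⟩
    rw [Real.log_div h3.ne' h4.ne', logDefect, Real.log_mul (by linarith) (by linarith)]
    ring
  have hd1 : 0 < (1 + (κ : ℂ) • P).det.re := (Complex.pos_iff.1 hD₁.det_pos).1
  have hd2 : 0 < (1 + (κ : ℂ) • R).det.re := (Complex.pos_iff.1 hD₂.det_pos).1
  have hdT : 0 < (1 + (κ : ℂ) • fromBlocks P (diagonal fun i => (s i : ℂ))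
      (diagonal fun i => (s i : ℂ)) R).det.re := (Complex.pos_iff.1 hT.det_pos).1
  have hlog := Real.log_le_log hdT (hTe ▸ hdet)
  simp only [hre] at hlog
  rw [Real.log_mul (mul_pos hd1 hd2).ne' (Finset.prod_pos fun i _ => (hfac i).1).ne',
    Real.log_mul hd1.ne' hd2.ne', Real.log_prod fun i _ => (hfac i).1.ne',
    Finset.sum_congr rfl fun i _ => (hfac i).2, Finset.sum_neg_distrib] at hlog
  have htr : (fromBlocks P (diagonal fun i => (s i : ℂ)) (diagonal fun i => (s i : ℂ)) R).trace.re =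
      P.trace.re + R.trace.re := by
    rw [trace_fromBlocks_eq, Complex.add_re]
  rw [traceKernel, traceKernel, traceKernel, htr]
  linarith

/-- The lower block norm inequality in the case of a diagonal off-diagonal block. -/
theorem schattenNorm_symmMatrix_le_of_diagonal (h1 : 1 < p) (h2 : p < 2) {P R : Matrix n n ℂ}
    {s : n → ℝ} (hs : ∀ i, 0 ≤ s i)
    (hN : (fromBlocks P (diagonal fun i => (s i : ℂ)) (diagonal fun i => (s i : ℂ)) R).PosSemidef)
    {y : ℝ} (hy : 0 ≤ y) (hys : y ^ p = ∑ i, s i ^ p)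
    (hy2 : y ^ 2 ≤ schattenNorm p P * schattenNorm p R) :
    schattenNorm p (symmMatrix (schattenNorm p P) y (schattenNorm p R)) ≤ schattenNorm p
      (fromBlocks P (diagonal fun i => (s i : ℂ)) (diagonal fun i => (s i : ℂ)) R) := by
  have hP := PosSemidef.fromBlocks_left hN
  have hR := PosSemidef.fromBlocks_right hN
  have hnn : ∀ {H : Matrix n n ℂ}, H.PosSemidef → ∀ i, 0 ≤ (H i i).re := fun hH i =>
    (Complex.nonneg_iff.1 (hH.diag_nonneg (i := i))).1
  have hsi : ∀ i, s i ^ 2 ≤ (P i i).re * (R i i).re := fun i => by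
    have h1 := PosSemidef.normSq_apply_le hN (Sum.inl i) (Sum.inr i)
    simp only [fromBlocks_apply₁₁, fromBlocks_apply₁₂, fromBlocks_apply₂₂, diagonal_apply_eq,
      Complex.norm_real, Real.norm_eq_abs, sq_abs] at h1
    rwa [← Complex.re_eq_norm.2 (hP.diag_nonneg (i := i)),
      ← Complex.re_eq_norm.2 (hR.diag_nonneg (i := i))] at h1
  have hdiag : ∀ {H : Matrix n n ℂ}, H.PosSemidef → ∑ i, (H i i).re ^ p ≤ schattenNorm p H ^ p :=
    fun {H} hH => by
      refine le_trans (le_of_eq ?_) (sum_norm_diag_rpow_le h1.le H)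
      exact Finset.sum_congr rfl fun i _ => by rw [Complex.re_eq_norm.2 (hH.diag_nonneg (i := i))]
  have hx0 := schattenNorm_nonneg p P
  have hz0 := schattenNorm_nonneg p R
  -- The `ℓ^p` norms of the diagonals of `P` and `R` are at most their Schatten norms, and that of
  -- `s` is `y`. So the sum of the entrywise defects dominates the single defect of the norms.
  have hsub := integral_logDefect_le_sum h1 h2 Finset.univ hx0 hy hz0 (hnn hP) hs (hnn hR) hy2 hsi
    (hdiag hP) hys.le (hdiag hR)
  have hint : ∀ i, IntegrableOn
      (fun l : ℝ => logDefect (P i i).re (s i) (R i i).re (l ^ (-(1 / p)))) (Ioi 0) := fun i =>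
    integrableOn_logDefect h1 h2 (hnn hP i) (hnn hR i) (hsi i)
  have hPR := (integrableOn_traceKernel h1 h2 hP).add (integrableOn_traceKernel h1 h2 hR)
  have hS : IntegrableOn
      (fun l : ℝ => ∑ i, logDefect (P i i).re (s i) (R i i).re (l ^ (-(1 / p)))) (Ioi 0) :=
    integrable_finsetSum _ fun i _ => hint i
  have hmono := setIntegral_mono_on (hPR.add hS) (integrableOn_traceKernel h1 h2 hN)
    measurableSet_Ioi fun l hl =>
      traceKernel_fromBlocks_diagonal_ge hN (Real.rpow_nonneg (le_of_lt hl) (-(1 / p)))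
  rw [integral_traceKernel h1 h2 hN, integral_add' hPR hS,
    integral_add' (integrableOn_traceKernel h1 h2 hP) (integrableOn_traceKernel h1 h2 hR),
    integral_traceKernel h1 h2 hP, integral_traceKernel h1 h2 hR,
    integral_finsetSum _ fun i _ => hint i] at hmono
  rw [integral_logDefect h1 h2 hx0 hz0 hy2] at hsub
  have hc := powConst_pos h1 h2
  have hfin := hmono.trans' (add_le_add_right hsub _)
  rw [← add_mul, ← add_mul, mul_le_mul_iff_left₀ hc] at hfin
  refine (Real.rpow_le_rpow_iff (schattenNorm_nonneg _ _) (schattenNorm_nonneg _ _)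
    (by linarith : 0 < p)).1 ?_
  linarith

/-- For `1 < p < 2`, the norm of a positive semidefinite block matrix is at least the norm of the
matrix of the norms of its blocks. -/
theorem PosSemidef.schattenNorm_symmMatrix_le (h1 : 1 < p) (h2 : p < 2) {P Q R : Matrix n n ℂ}
    (hN : (fromBlocks P Q Qᴴ R).PosSemidef) :
    schattenNorm p (symmMatrix (schattenNorm p P) (schattenNorm p Q) (schattenNorm p R)) ≤
      schattenNorm p (fromBlocks P Q Qᴴ R) := by
  obtain ⟨U, hU, V, hV, s, hs, h⟩ := exists_svd_complex Q
  -- Conjugation by the block-diagonal unitary built from the singular vectors of `Q` makes the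
  -- off-diagonal blocks diagonal and changes none of the norms.
  have hW := fromBlocks_mem_unitaryGroup hU hV
  have hQ : Uᴴ * Q * V = diagonal (fun i => (s i : ℂ)) := by
    calc _ = (Uᴴ * U) * diagonal (fun i => (s i : ℂ)) * (Vᴴ * V) := by
          rw [h]; simp only [Matrix.mul_assoc]
      _ = _ := by
          rw [star_mul_self_of_mem_unitaryGroup hU, star_mul_self_of_mem_unitaryGroup hV,
            Matrix.one_mul, Matrix.mul_one]
  have hQ' : Vᴴ * Qᴴ * U = diagonal (fun i => (s i : ℂ)) := by
    have := congrArg conjTranspose hQ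
    rw [conjTranspose_mul, conjTranspose_mul, conjTranspose_conjTranspose, ← Matrix.mul_assoc,
      diagonal_conjTranspose] at this
    rw [this]
    congr 1
    ext i
    simp
  have hb : (fromBlocks U 0 0 V)ᴴ * fromBlocks P Q Qᴴ R * fromBlocks U 0 0 V =
      fromBlocks (Uᴴ * P * U) (diagonal fun i => (s i : ℂ)) (diagonal fun i => (s i : ℂ))
        (Vᴴ * R * V) := by
    rw [fromBlocks_conjTranspose, fromBlocks_multiply, fromBlocks_multiply]
    simp [hQ, hQ']
  have hN' := hb ▸ hN.conjTranspose_mul_mul_same (fromBlocks U 0 0 V)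
  have hNn : schattenNorm p (fromBlocks (Uᴴ * P * U) (diagonal fun i => (s i : ℂ))
      (diagonal fun i => (s i : ℂ)) (Vᴴ * R * V)) = schattenNorm p (fromBlocks P Q Qᴴ R) := by
    rw [← hb, schattenNorm_unitary_mul_mul (conjTranspose_mem_unitaryGroup hW) hW]
  have hPn := schattenNorm_unitary_mul_mul (conjTranspose_mem_unitaryGroup hU) hU p P
  have hRn := schattenNorm_unitary_mul_mul (conjTranspose_mem_unitaryGroup hV) hV p R
  have := schattenNorm_symmMatrix_le_of_diagonal h1 h2 hs hN' (schattenNorm_nonneg p Q)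
    (schattenNorm_rpow_of_svd hU hV hs h (by linarith))
    (by rw [hPn, hRn]; exact PosSemidef.schattenNorm_offDiag_sq_le h1 hN)
  rwa [hPn, hRn, hNn] at this

theorem schattenNorm_two_sq (A : Matrix n n ℂ) : schattenNorm 2 A ^ 2 = (Aᴴ * A).trace.re := by
  have h := isHermitian_conjTranspose_mul_self A
  have h0 := (posSemidef_conjTranspose_mul_self A).eigenvalues_nonneg
  rw [schattenNorm_eq_sum, h.trace_eq_sum_eigenvalues, ← Real.sqrt_eq_rpow, Real.sq_sqrt]
  · simp
  · exact Finset.sum_nonneg fun i _ => Real.rpow_nonneg (h0 i) _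

theorem schattenNorm_two_fromBlocks_sq (A B C : Matrix n n ℂ) :
    schattenNorm 2 (fromBlocks A B Bᴴ C) ^ 2 =
      schattenNorm 2 A ^ 2 + 2 * schattenNorm 2 B ^ 2 + schattenNorm 2 C ^ 2 := by
  simp only [schattenNorm_two_sq]
  rw [fromBlocks_conjTranspose, fromBlocks_multiply, trace_fromBlocks_eq, trace_add, trace_add,
    conjTranspose_conjTranspose, trace_mul_comm B]
  simp only [Complex.add_re]
  ring

theorem schattenNorm_two_symmMatrix_sq (a b c : ℝ) :
    schattenNorm 2 (symmMatrix a b c) ^ 2 = a ^ 2 + 2 * b ^ 2 + c ^ 2 := by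
  rw [schattenNorm_two_sq, (isHermitian_symmMatrix a b c).eq]
  simp [symmMatrix, trace, Fin.sum_univ_two]
  ring

theorem schattenNorm_two_fromBlocks_le {A B C : Matrix n n ℂ} {a b c : ℝ}
    (hA : schattenNorm 2 A ≤ a) (hB : schattenNorm 2 B ≤ b) (hC : schattenNorm 2 C ≤ c) :
    schattenNorm 2 (fromBlocks A B Bᴴ C) ≤ schattenNorm 2 (symmMatrix a b c) := by
  refine le_of_sq_le_sq ?_ (schattenNorm_nonneg _ _)
  rw [schattenNorm_two_fromBlocks_sq, schattenNorm_two_symmMatrix_sq]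
  have hA0 := schattenNorm_nonneg 2 A
  have hB0 := schattenNorm_nonneg 2 B
  have hC0 := schattenNorm_nonneg 2 C
  gcongr

/-- For `q ≥ 2`, the norm of a positive semidefinite block matrix is at most the norm of the
matrix of the norms of its blocks. -/
theorem PosSemidef.schattenNorm_fromBlocks_le (hq : 2 ≤ q) {X Y Z : Matrix n n ℂ} {x y z : ℝ}
    (hM : (fromBlocks X Y Yᴴ Z).PosSemidef) (hX : schattenNorm q X ≤ x)
    (hY : schattenNorm q Y ≤ y) (hZ : schattenNorm q Z ≤ z) :
    schattenNorm q (fromBlocks X Y Yᴴ Z) ≤ schattenNorm q (symmMatrix x y z) := by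
  rcases hq.eq_or_lt with rfl | hq
  · exact schattenNorm_two_fromBlocks_le hX hY hZ
  have hq1 : 1 < q := by linarith
  have hpq := Real.HolderConjugate.conjExponent hq1
  set p := q.conjExponent with hp
  have hp1 : 1 < p := hpq.symm.lt
  have hp2 : p < 2 := by
    rw [hp, Real.conjExponent, div_lt_iff₀ (by linarith)]
    linarith
  -- A positive norming matrix is needed, since the lower block bound at the conjugate exponent `1 <
  -- p < 2` is for positive matrices.
  obtain ⟨N, hN, hN1, hMN⟩ := PosSemidef.exists_trace_mul_eq_schattenNorm hpq hM
  obtain ⟨P, Q, R, rfl⟩ : ∃ P Q R : Matrix n n ℂ, N = fromBlocks P Q Qᴴ R := by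
    refine ⟨N.toBlocks₁₁, N.toBlocks₁₂, N.toBlocks₂₂, ?_⟩
    conv_lhs => rw [← fromBlocks_toBlocks N]
    congr 1
    ext i j
    exact (hN.1.apply (Sum.inr i) (Sum.inl j)).symm
  have hlow := PosSemidef.schattenNorm_symmMatrix_le hp1 hp2 hN
  -- Hölder on the four blocks bounds the pairing with `N` by the trace of the product of the two
  -- 2×2 matrices; Hölder for those matrices finishes.
  have hsym := norm_trace_mul_le hpq (symmMatrix x y z)
    (symmMatrix (schattenNorm p P) (schattenNorm p Q) (schattenNorm p R))
  have hsymtr : (symmMatrix x y z *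
      symmMatrix (schattenNorm p P) (schattenNorm p Q) (schattenNorm p R)).trace =
      ((x * schattenNorm p P + 2 * (y * schattenNorm p Q) + z * schattenNorm p R : ℝ) : ℂ) := by
    simp [symmMatrix, trace, Fin.sum_univ_two]
    ring
  have htr : (fromBlocks X Y Yᴴ Z * fromBlocks P Q Qᴴ R).trace =
      (X * P).trace + (Y * Qᴴ).trace + ((Yᴴ * Q).trace + (Z * R).trace) := by
    rw [fromBlocks_multiply, trace_fromBlocks_eq, trace_add, trace_add]
  have hnP := schattenNorm_nonneg p P
  have hnQ := schattenNorm_nonneg p Q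
  have hnR := schattenNorm_nonneg p R
  have hholder : ∀ {A B : Matrix n n ℂ} {a b : ℝ}, schattenNorm q A ≤ a → schattenNorm p B = b →
      ‖(A * B).trace‖ ≤ a * b := fun {A B a b} hA hB => by
    refine (norm_trace_mul_le hpq A B).trans ?_
    rw [hB]
    exact mul_le_mul_of_nonneg_right hA (hB ▸ schattenNorm_nonneg _ _)
  have e1 := hholder hX (rfl : schattenNorm p P = _)
  have e2 := hholder hY (schattenNorm_conjTranspose p Q)
  have e3 := hholder ((schattenNorm_conjTranspose q Y).trans_le hY) (rfl : schattenNorm p Q = _)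
  have e4 := hholder hZ (rfl : schattenNorm p R = _)
  have hle : schattenNorm q (fromBlocks X Y Yᴴ Z) ≤
      x * schattenNorm p P + 2 * (y * schattenNorm p Q) + z * schattenNorm p R := by
    have h3 : schattenNorm q (fromBlocks X Y Yᴴ Z) =
        ‖(fromBlocks X Y Yᴴ Z * fromBlocks P Q Qᴴ R).trace‖ := by
      rw [hMN, Complex.norm_real, Real.norm_of_nonneg (schattenNorm_nonneg _ _)]
    rw [h3, htr]
    refine (norm_add_le _ _).trans ?_
    have f1 := norm_add_le (X * P).trace (Y * Qᴴ).trace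
    have f2 := norm_add_le (Yᴴ * Q).trace (Z * R).trace
    linarith
  rw [hsymtr, Complex.norm_real] at hsym
  refine hle.trans ((le_abs_self _).trans (hsym.trans ?_))
  exact mul_le_of_le_one_right (schattenNorm_nonneg _ _) (hlow.trans hN1)

/-- For `p = 2` and `p ≥ 4`, the norm of a Hermitian block matrix is at most the norm of the
matrix of the norms of its blocks. -/
theorem schattenNorm_fromBlocks_le (hp : p = 2 ∨ 4 ≤ p) {A B C : Matrix n n ℂ} {a b c : ℝ}
    (hAh : A.IsHermitian) (hCh : C.IsHermitian) (hA : schattenNorm p A ≤ a)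
    (hB : schattenNorm p B ≤ b) (hC : schattenNorm p C ≤ c) :
    schattenNorm p (fromBlocks A B Bᴴ C) ≤ schattenNorm p (symmMatrix a b c) := by
  rcases hp with rfl | hp
  · exact schattenNorm_two_fromBlocks_le hA hB hC
  obtain ⟨q, rfl⟩ : ∃ q, p = 2 * q := ⟨p / 2, by ring⟩
  have hq : 2 ≤ q := by linarith
  have hq1 : 1 < q := by linarith
  have hq0 : q ≠ 0 := by linarith
  have hA0 := schattenNorm_nonneg (2 * q) A
  have hB0 := schattenNorm_nonneg (2 * q) B
  have hC0 := schattenNorm_nonneg (2 * q) C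
  -- `M Mᴴ` is positive even when `M` is only Hermitian, so the positive case applies with exponent
  -- `q = p/2`; this is where `p ≥ 4` enters. The blocks of `M Mᴴ` are bounded by the entries of the
  -- squared 2×2 matrix.
  refine le_of_sq_le_sq ?_ (schattenNorm_nonneg _ _)
  rw [← schattenNorm_mul_conjTranspose_self hq0, ← schattenNorm_mul_conjTranspose_self hq0]
  have h1 : fromBlocks A B Bᴴ C * (fromBlocks A B Bᴴ C)ᴴ = fromBlocks (A * Aᴴ + B * Bᴴ)
      (A * B + B * C) (A * B + B * C)ᴴ (Bᴴ * B + C * Cᴴ) := by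
    rw [fromBlocks_conjTranspose, fromBlocks_multiply, conjTranspose_add, conjTranspose_mul,
      conjTranspose_mul, conjTranspose_conjTranspose, hAh.eq, hCh.eq]
  have h2 : symmMatrix a b c * (symmMatrix a b c)ᴴ =
      symmMatrix (a ^ 2 + b ^ 2) (a * b + b * c) (b ^ 2 + c ^ 2) := by
    rw [(isHermitian_symmMatrix a b c).eq]
    ext i j
    fin_cases i <;> fin_cases j <;> simp [symmMatrix] <;> ring
  rw [h1, h2]
  refine PosSemidef.schattenNorm_fromBlocks_le hq (h1 ▸ posSemidef_self_mul_conjTranspose _)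
    ((schattenNorm_add_le hq1 _ _).trans ?_) ((schattenNorm_add_le hq1 _ _).trans ?_)
    ((schattenNorm_add_le hq1 _ _).trans ?_)
  · rw [schattenNorm_mul_conjTranspose_self hq0, schattenNorm_mul_conjTranspose_self hq0]
    gcongr
  · refine add_le_add ((schattenNorm_mul_le hq1 _ _).trans ?_)
      ((schattenNorm_mul_le hq1 _ _).trans ?_) <;>
    exact mul_le_mul ‹_› ‹_› (schattenNorm_nonneg _ _) (le_trans (schattenNorm_nonneg _ _) ‹_›)
  · rw [schattenNorm_conjTranspose_mul_self hq0, schattenNorm_mul_conjTranspose_self hq0]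
    gcongr

end Blocks

/-! ### Tensor products of maps in block form. -/

section Tensor

set_option linter.unusedSectionVars false

variable {d e d' e' d'' : Type*} [Fintype d] [DecidableEq d] [Fintype e] [DecidableEq e]
  [Fintype d'] [DecidableEq d'] [Fintype e'] [DecidableEq e'] [Fintype d''] [DecidableEq d'']

theorem linearMap_ext_kronecker {V : Type*} [AddCommMonoid V] [Module ℂ V]
    {f g : Matrix (d × d') (d × d') ℂ →ₗ[ℂ] V}
    (h : ∀ (A : Matrix d d ℂ) (B : Matrix d' d' ℂ), f (A ⊗ₖ B) = g (A ⊗ₖ B)) : f = g := by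
  have h1 : f ∘ₗ (kroneckerLinearEquiv d d d' d' ℂ).toLinearMap =
      g ∘ₗ (kroneckerLinearEquiv d d d' d' ℂ).toLinearMap :=
    TensorProduct.ext' fun A B => by simpa using h A B
  ext1 M
  have := LinearMap.congr_fun h1 ((kroneckerLinearEquiv d d d' d' ℂ).symm M)
  simpa using this

/-- The blocks of a matrix indexed by a product. -/
def blk (τ : Matrix (d × d') (d × d') ℂ) (i j : d) : Matrix d' d' ℂ :=
  τ.submatrix (fun a => (i, a)) (fun a => (j, a))

theorem eq_sum_single_kronecker_blk (τ : Matrix (d × d') (d × d') ℂ) :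
    τ = ∑ i, ∑ j, single i j (1 : ℂ) ⊗ₖ blk τ i j := by
  ext ⟨k, a⟩ ⟨l, b⟩
  simp [Matrix.sum_apply, blk, single_apply, ite_and]

theorem tensorMap_apply (Ψ : Matrix d d ℂ →ₗ[ℂ] Matrix e e ℂ)
    (Ω : Matrix d' d' ℂ →ₗ[ℂ] Matrix e' e' ℂ) (τ : Matrix (d × d') (d × d') ℂ) :
    tensorMap Ψ Ω τ = ∑ i, ∑ j, Ψ (single i j 1) ⊗ₖ Ω (blk τ i j) := by
  conv_lhs => rw [eq_sum_single_kronecker_blk τ]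
  simp only [map_sum, tensorMap_kronecker]

theorem tensorMap_apply_apply (Ψ : Matrix d d ℂ →ₗ[ℂ] Matrix e e ℂ)
    (Ω : Matrix d' d' ℂ →ₗ[ℂ] Matrix e' e' ℂ) (τ : Matrix (d × d') (d × d') ℂ) (k l : e) (a b : e') :
    tensorMap Ψ Ω τ (k, a) (l, b) =
      ∑ i, ∑ j, Ψ (single i j 1) k l * Ω (blk τ i j) a b := by
  simp [tensorMap_apply, Matrix.sum_apply]

/-- Conjugation by a matrix, as a linear map. -/
def conjMap (U : Matrix d d ℂ) : Matrix d d ℂ →ₗ[ℂ] Matrix d d ℂ :=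
  LinearMap.mulRight ℂ Uᴴ ∘ₗ LinearMap.mulLeft ℂ U

theorem conjMap_apply (U X : Matrix d d ℂ) : conjMap U X = U * X * Uᴴ := rfl

theorem tensorMap_conjMap_comp (U : Matrix e e ℂ) (V : Matrix d d ℂ)
    (Ψ : Matrix d d ℂ →ₗ[ℂ] Matrix e e ℂ)
    (Ω : Matrix d' d' ℂ →ₗ[ℂ] Matrix e' e' ℂ) (τ : Matrix (d × d') (d × d') ℂ) :
    tensorMap (conjMap U ∘ₗ Ψ ∘ₗ conjMap V) Ω τ =
      conjMap (U ⊗ₖ 1) (tensorMap Ψ Ω (conjMap (V ⊗ₖ 1) τ)) := by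
  have : tensorMap (conjMap U ∘ₗ Ψ ∘ₗ conjMap V) Ω =
      conjMap (U ⊗ₖ 1) ∘ₗ tensorMap Ψ Ω ∘ₗ conjMap (V ⊗ₖ 1) := by
    refine linearMap_ext_kronecker fun A B => ?_
    simp only [LinearMap.comp_apply, conjMap_apply, tensorMap_kronecker, conjTranspose_kronecker,
      ← mul_kronecker_mul, conjTranspose_one, Matrix.one_mul, Matrix.mul_one]
  rw [this]
  rfl

theorem conjMap_mem_states {U : Matrix d d ℂ} (hU : U ∈ unitaryGroup d ℂ) {ρ : Matrix d d ℂ}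
    (hρ : ρ ∈ states d) : conjMap U ρ ∈ states d := by
  refine ⟨hρ.1.mul_mul_conjTranspose_same U, ?_⟩
  rw [conjMap_apply, trace_mul_comm, ← Matrix.mul_assoc, star_mul_self_of_mem_unitaryGroup hU,
    Matrix.one_mul, hρ.2]

theorem schattenNorm_conjMap {U : Matrix d d ℂ} (hU : U ∈ unitaryGroup d ℂ) (p : ℝ)
    (X : Matrix d d ℂ) : schattenNorm p (conjMap U X) = schattenNorm p X :=
  schattenNorm_unitary_mul_mul hU (conjTranspose_mem_unitaryGroup hU) p X

/-- The equivalence under which matrices of blocks become block matrices. -/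
def sumEquivFinTwoProd (e : Type*) : e ⊕ e ≃ Fin 2 × e where
  toFun := Sum.elim (fun a => (0, a)) (fun a => (1, a))
  invFun x := if x.1 = 0 then Sum.inl x.2 else Sum.inr x.2
  left_inv x := by rcases x with a | a <;> simp
  right_inv x := by
    obtain ⟨i, a⟩ := x
    fin_cases i <;> simp

theorem submatrix_sumEquivFinTwoProd (M : Matrix (Fin 2 × e) (Fin 2 × e) ℂ) :
    M.submatrix (sumEquivFinTwoProd e) (sumEquivFinTwoProd e) =
      fromBlocks (blk M 0 0) (blk M 0 1) (blk M 1 0) (blk M 1 1) := by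
  ext (a | a) (b | b) <;> rfl

theorem blk_tensorMap (Ψ : Matrix d d ℂ →ₗ[ℂ] Matrix e e ℂ)
    (Ω : Matrix d' d' ℂ →ₗ[ℂ] Matrix e' e' ℂ) (τ : Matrix (d × d') (d × d') ℂ) (k l : e) :
    blk (tensorMap Ψ Ω τ) k l = ∑ i, ∑ j, Ψ (single i j 1) k l • Ω (blk τ i j) := by
  ext a b
  simp [blk, tensorMap_apply_apply, Matrix.sum_apply]

/-- Complete positivity at dimension two. The definition puts the identity on the second factor,
while blocks are indexed by the first, hence the swaps. -/
theorem IsCompletelyPositive.posSemidef_fromBlocks {Ω : Matrix d d ℂ →ₗ[ℂ] Matrix e e ℂ}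
    (hΩ : IsCompletelyPositive Ω) {τ : Matrix (Fin 2 × d) (Fin 2 × d) ℂ} (hτ : τ.PosSemidef) :
    (fromBlocks (Ω (blk τ 0 0)) (Ω (blk τ 0 1)) (Ω (blk τ 1 0)) (Ω (blk τ 1 1))).PosSemidef := by
  have h1 := hΩ.2 2 (τ.submatrix Prod.swap Prod.swap) (hτ.submatrix _)
  have h2 := h1.submatrix (Prod.swap ∘ sumEquivFinTwoProd e)
  convert h2 using 1
  have key : ∀ (k l : Fin 2) (a b : e), tensorMap Ω (LinearMap.id :
      Matrix (Fin 2) (Fin 2) ℂ →ₗ[ℂ] Matrix (Fin 2) (Fin 2) ℂ) (τ.submatrix Prod.swap Prod.swap)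
        (a, k) (b, l) = Ω (blk τ k l) a b := by
    intro k l a b
    rw [tensorMap_apply_apply, matrix_eq_sum_single (blk τ k l)]
    simp only [map_sum, Matrix.sum_apply]
    refine Finset.sum_congr rfl fun i _ => Finset.sum_congr rfl fun j _ => ?_
    have h3 : single i j (blk τ k l i j) = blk τ k l i j • single i j (1 : ℂ) := by
      simp [smul_single]
    rw [h3, map_smul, Matrix.smul_apply, smul_eq_mul, mul_comm]
    rfl
  ext (a | a) (b | b) <;> exact (key _ _ _ _).symm

end Tensor

/-! ### Homogeneous bounds by the maximal output norm. -/

section OutputNorm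

set_option linter.unusedSectionVars false

variable {d e : Type*} [Fintype d] [DecidableEq d] [Fintype e] [DecidableEq e] {p : ℝ}

theorem schattenNorm_le_maxOutputNorm (hp : 0 ≤ p) (Ω : Matrix d d ℂ →ₗ[ℂ] Matrix e e ℂ)
    {ρ : Matrix d d ℂ} (hρ : ρ ∈ states d) : schattenNorm p (Ω ρ) ≤ maxOutputNorm p Ω :=
  le_csSup (bddAbove_schattenNorm_image hp Ω) (Set.mem_image_of_mem _ hρ)

theorem maxOutputNorm_nonneg (p : ℝ) (Ω : Matrix d d ℂ →ₗ[ℂ] Matrix e e ℂ) :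
    0 ≤ maxOutputNorm p Ω :=
  Real.sSup_nonneg (by rintro _ ⟨ρ, -, rfl⟩; exact schattenNorm_nonneg _ _)

theorem schattenNorm_zero (hp : 1 < p) : schattenNorm p (0 : Matrix e e ℂ) = 0 := by
  have := schattenNorm_smul_le hp 0 (0 : Matrix e e ℂ)
  rw [norm_zero, zero_mul, smul_zero] at this
  exact le_antisymm this (schattenNorm_nonneg _ _)

theorem schattenNorm_le_maxOutputNorm_mul_trace (hp : 1 < p)
    (Ω : Matrix d d ℂ →ₗ[ℂ] Matrix e e ℂ) {X : Matrix d d ℂ} (hX : X.PosSemidef) :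
    schattenNorm p (Ω X) ≤ maxOutputNorm p Ω * X.trace.re := by
  have htr := hX.trace_nonneg
  obtain ⟨t, ht⟩ : ∃ t : ℝ, X.trace = (t : ℂ) :=
    ⟨X.trace.re, (Complex.eq_re_of_ofReal_le htr)⟩
  have ht0 : 0 ≤ t := by
    rw [ht] at htr
    exact_mod_cast htr
  rw [ht, Complex.ofReal_re]
  rcases ht0.eq_or_lt with rfl | ht0
  · have : X = 0 := hX.trace_eq_zero_iff.1 (by simpa using ht)
    rw [this, map_zero, schattenNorm_zero hp, mul_zero]
  · have ht0' : (t : ℂ) ≠ 0 := by exact_mod_cast ht0.ne'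
    have hρ : (t⁻¹ : ℂ) • X ∈ states d := by
      refine ⟨hX.smul ?_, ?_⟩
      · rw [← Complex.ofReal_inv]
        exact_mod_cast (inv_pos.2 ht0).le
      · rw [trace_smul, ht, smul_eq_mul, inv_mul_cancel₀ ht0']
    have h1 : Ω X = (t : ℂ) • Ω ((t⁻¹ : ℂ) • X) := by
      rw [map_smul, smul_smul, mul_inv_cancel₀ ht0', one_smul]
    rw [h1]
    refine (schattenNorm_smul_le hp _ _).trans ?_
    rw [Complex.norm_real, Real.norm_of_nonneg ht0.le, mul_comm]
    exact mul_le_mul_of_nonneg_right (schattenNorm_le_maxOutputNorm (by linarith) Ω hρ) ht0.le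

end OutputNorm

/-! ### Norms of trace-one 2×2 matrices in terms of the Bloch radius. -/

section TwoByTwo

variable {p : ℝ}

/-- Trace and determinant force the eigenvalues to be `(1 ± r) / 2`, in one order or the other. -/
theorem schattenNorm_rpow_of_trace_eq_one (hp : p ≠ 0) {H : Matrix (Fin 2) (Fin 2) ℂ}
    (hH : H.IsHermitian) (htr : H.trace = 1) {r : ℝ} (hr : |r| ≤ 1)
    (hdet : H.det = (((1 - r ^ 2) / 4 : ℝ) : ℂ)) :
    schattenNorm p H ^ p = ((1 + r) / 2) ^ p + ((1 - r) / 2) ^ p := by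
  rw [schattenNorm_rpow_of_isHermitian hH hp, Fin.sum_univ_two]
  have h1 : hH.eigenvalues 0 + hH.eigenvalues 1 = 1 := by
    have := hH.trace_eq_sum_eigenvalues
    rw [htr, Fin.sum_univ_two] at this
    refine Complex.ofReal_injective ?_
    push_cast
    exact this.symm
  have h2 : hH.eigenvalues 0 * hH.eigenvalues 1 = (1 - r ^ 2) / 4 := by
    have := hH.det_eq_prod_eigenvalues
    rw [hdet, Fin.prod_univ_two] at this
    refine Complex.ofReal_injective ?_
    rw [this]
    push_cast
    rfl
  obtain ⟨hr1, hr2⟩ := abs_le.1 hr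
  have h3 : (hH.eigenvalues 0 - (1 + r) / 2) * (hH.eigenvalues 0 - (1 - r) / 2) = 0 := by
    have h4 : hH.eigenvalues 1 = 1 - hH.eigenvalues 0 := by linarith
    rw [h4] at h2
    nlinarith
  rcases mul_eq_zero.1 h3 with h4 | h4
  · have h5 : hH.eigenvalues 0 = (1 + r) / 2 := by linarith
    have h6 : hH.eigenvalues 1 = (1 - r) / 2 := by linarith
    rw [h5, h6, abs_of_nonneg (by linarith), abs_of_nonneg (by linarith)]
  · have h5 : hH.eigenvalues 0 = (1 - r) / 2 := by linarith
    have h6 : hH.eigenvalues 1 = (1 + r) / 2 := by linarith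
    rw [h5, h6, abs_of_nonneg (by linarith), abs_of_nonneg (by linarith), add_comm]

/-- The points `(1 ± ρ) / 2` are convex combinations of `(1 ± r) / 2` with exchanged weights, so
adding the two convexity inequalities suffices. -/
theorem add_rpow_sub_rpow_mono (hp : 1 ≤ p) {ρ r : ℝ} (hρ : |ρ| ≤ r) (hr : r ≤ 1) :
    ((1 + ρ) / 2) ^ p + ((1 - ρ) / 2) ^ p ≤ ((1 + r) / 2) ^ p + ((1 - r) / 2) ^ p := by
  obtain ⟨h1, h2⟩ := abs_le.1 hρ
  have hr0 : 0 ≤ r := (abs_nonneg _).trans hρ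
  rcases hr0.eq_or_lt with rfl | hr0
  · have : ρ = 0 := by linarith
    rw [this]
  have hc := convexOn_rpow hp
  set w := (r + ρ) / (2 * r) with hw
  have hw0 : 0 ≤ w := div_nonneg (by linarith) (by linarith)
  have hw1 : 0 ≤ 1 - w := by
    rw [hw, sub_nonneg, div_le_one (by linarith)]
    linarith
  have e : w * (2 * r) = r + ρ := by
    rw [hw]
    field_simp
  have m1 : (1 + r) / 2 ∈ Set.Ici (0 : ℝ) := by
    rw [Set.mem_Ici]; linarith
  have m2 : (1 - r) / 2 ∈ Set.Ici (0 : ℝ) := by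
    rw [Set.mem_Ici]; linarith
  have k1 := hc.2 m1 m2 hw0 hw1 (by ring)
  have k2 := hc.2 m1 m2 hw1 hw0 (by ring)
  simp only [smul_eq_mul] at k1 k2
  have e1 : w * ((1 + r) / 2) + (1 - w) * ((1 - r) / 2) = (1 + ρ) / 2 := by linarith
  have e2 : (1 - w) * ((1 + r) / 2) + w * ((1 - r) / 2) = (1 - ρ) / 2 := by linarith
  rw [e1] at k1
  rw [e2] at k2
  linarith

theorem schattenNorm_symmMatrix_le (hp : 1 ≤ p) {a b c r N : ℝ} (hac : a + c = 1)
    (habc : (a - c) ^ 2 + 4 * b ^ 2 ≤ r ^ 2) (hr0 : 0 ≤ r) (hr : r ≤ 1) (hN : 0 ≤ N)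
    (hNr : N ^ p = ((1 + r) / 2) ^ p + ((1 - r) / 2) ^ p) :
    schattenNorm p (symmMatrix a b c) ≤ N := by
  have hq : 0 ≤ (a - c) ^ 2 + 4 * b ^ 2 := by positivity
  set ρ := √((a - c) ^ 2 + 4 * b ^ 2) with hρ
  have hρr : |ρ| ≤ r := by
    rw [abs_of_nonneg (Real.sqrt_nonneg _)]
    exact Real.sqrt_le_iff.2 ⟨hr0, habc⟩
  have hρ2 : ρ ^ 2 = (a - c) ^ 2 + 4 * b ^ 2 := Real.sq_sqrt hq
  refine (Real.rpow_le_rpow_iff (schattenNorm_nonneg _ _) hN (by linarith : 0 < p)).1 ?_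
  rw [hNr, schattenNorm_rpow_of_trace_eq_one (by linarith) (isHermitian_symmMatrix a b c)
    (r := ρ) _ (hρr.trans hr)]
  · exact add_rpow_sub_rpow_mono hp hρr hr
  · rw [hρ2, det_fin_two]
    have : c = 1 - a := by linarith
    simp [symmMatrix, this]
    ring
  · simp only [symmMatrix, trace, Fin.sum_univ_two, diag_apply, of_apply, cons_val_zero,
      cons_val_one]
    exact_mod_cast hac

end TwoByTwo

/-! ### The Lagrange multiplier of the longest output vector. -/

section TrustRegion

variable {E F : Type*} [NormedAddCommGroup E] [InnerProductSpace ℝ E]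
  [NormedAddCommGroup F] [InnerProductSpace ℝ F]

/-- The first- and second-order conditions for a maximum at zero. -/
theorem coeff_of_forall_quartic_nonpos {a b c k : ℝ}
    (h : ∀ x : ℝ, a * x + b * x ^ 2 + c * x ^ 3 + k * x ^ 4 ≤ 0) : a = 0 ∧ b ≤ 0 := by
  have ha : a = 0 := by
    have hd : HasDerivAt (fun x : ℝ => a * x + b * x ^ 2 + c * x ^ 3 + k * x ^ 4) a 0 := by
      have := ((((hasDerivAt_id (0 : ℝ)).const_mul a).add ((hasDerivAt_pow 2 (0 : ℝ)).const_mul b)).add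
        ((hasDerivAt_pow 3 (0 : ℝ)).const_mul c)).add ((hasDerivAt_pow 4 (0 : ℝ)).const_mul k)
      refine (this.congr_deriv ?_)
      norm_num
    refine IsLocalMax.hasDerivAt_eq_zero (Filter.Eventually.of_forall fun x => ?_) hd
    simpa using h x
  refine ⟨ha, ?_⟩
  subst ha
  by_contra! hb
  -- Averaging the bounds at `±√y` removes the odd terms; this `y` is small enough that `|k| y < b`.
  set y : ℝ := b / (|k| + b) with hy
  have hkb : 0 < |k| + b := by positivity
  have hy0 : 0 < y := div_pos hb hkb
  have h1 := h (√y)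
  have h2 := h (-√y)
  have e2 : √y ^ 2 = y := Real.sq_sqrt hy0.le
  have e4 : √y ^ 4 = y ^ 2 := by
    calc √y ^ 4 = (√y ^ 2) ^ 2 := by ring
      _ = y ^ 2 := by rw [e2]
  have h3 : b * y + k * y ^ 2 ≤ 0 := by
    have e2' : (-√y) ^ 2 = y := by rw [neg_sq, e2]
    have e4' : (-√y) ^ 4 = y ^ 2 := by
      rw [← e4]
      ring
    have e3' : (-√y) ^ 3 = -√y ^ 3 := by ring
    rw [e2, e4] at h1
    rw [e2', e4', e3'] at h2
    linarith
  have h4 : b + k * y ≤ 0 := by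
    by_contra! h5
    nlinarith
  have h5 : y * (|k| + b) = b := by rw [hy]; field_simp
  have h6 : -|k| ≤ k := neg_abs_le k
  nlinarith [mul_pos hy0 hb]

theorem norm_sq_smul_add_smul_add {y t z : F} (h : inner ℝ y z = (0 : ℝ)) (c δ : ℝ) :
    ‖c • y + δ • t + z‖ ^ 2 = c ^ 2 * ‖y‖ ^ 2 + δ ^ 2 * ‖t‖ ^ 2 + ‖z‖ ^ 2 +
      2 * c * δ * inner ℝ y t + 2 * δ * inner ℝ t z := by
  rw [norm_add_sq_real, norm_add_sq_real, inner_add_left, real_inner_smul_left,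
    real_inner_smul_left, real_inner_smul_left, real_inner_smul_right, norm_smul, norm_smul, h,
    mul_pow, mul_pow, Real.norm_eq_abs, Real.norm_eq_abs, sq_abs, sq_abs]
  ring

/-- The Lagrange multiplier of the maximum of `‖t + T w‖` over the unit sphere. -/
theorem exists_multiplier (t : F) (T : E →ₗ[ℝ] F) {w : E} (hw : ‖w‖ = 1)
    (hmax : ∀ v, ‖v‖ = 1 → ‖t + T v‖ ≤ ‖t + T w‖) :
    ∃ μ : ℝ, 0 ≤ μ ∧ μ ≤ ‖t + T w‖ ^ 2 ∧
      ∀ (a : ℝ) (x : E), ‖a • t + T x‖ ^ 2 ≤ (‖t + T w‖ ^ 2 - μ) * a ^ 2 + μ * ‖x‖ ^ 2 := by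
  obtain ⟨y, hy⟩ : ∃ y, y = t + T w := ⟨_, rfl⟩
  rw [← hy] at hmax ⊢
  set r := ‖y‖ with hr
  -- The maximality on the sphere, made homogeneous on the cone `‖x‖ = |a|`.
  have hom : ∀ (a : ℝ) (x : E), ‖x‖ ^ 2 = a ^ 2 → ‖a • t + T x‖ ^ 2 ≤ r ^ 2 * a ^ 2 := by
    intro a x hx
    by_cases ha : a = 0
    · subst ha
      have : x = 0 := by
        rw [zero_pow two_ne_zero] at hx
        exact norm_eq_zero.1 (pow_eq_zero_iff two_ne_zero |>.1 hx)
      simp [this]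
    · have h1 : ‖a⁻¹ • x‖ = 1 := by
        rw [norm_smul, norm_inv, Real.norm_eq_abs, ← abs_of_nonneg (norm_nonneg x),
          (sq_eq_sq_iff_abs_eq_abs _ _).1 hx, inv_mul_cancel₀ (abs_ne_zero.2 ha)]
      have h2 : a • t + T x = a • (t + T (a⁻¹ • x)) := by
        rw [smul_add, map_smul, smul_smul, mul_inv_cancel₀ ha, one_smul]
      rw [h2, norm_smul, mul_pow, Real.norm_eq_abs, sq_abs, mul_comm]
      exact mul_le_mul_of_nonneg_right (pow_le_pow_left₀ (norm_nonneg _) (hmax _ h1) 2) (sq_nonneg a)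
  -- Stationarity reads `T* y = μ w`; pairing with the unit vector `w` gives this value.
  set μ : ℝ := inner ℝ y (T w) with hμ
  have hyt : inner ℝ y t = r ^ 2 - μ := by
    have : inner ℝ y y = r ^ 2 := real_inner_self_eq_norm_sq y
    rw [← this]
    have h2 : inner ℝ y y = inner ℝ y t + inner ℝ y (T w) := by rw [← inner_add_right, ← hy]
    linarith
  have orth : ∀ u : E, inner ℝ w u = (0 : ℝ) →
      inner ℝ y (T u) = (0 : ℝ) ∧ ‖T u‖ ^ 2 ≤ μ * ‖u‖ ^ 2 := by
    intro u hu
    set N := ‖u‖ ^ 2 with hN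
    -- The rational parametrisation of the circle through `w` in direction `u`, with denominators
    -- cleared. The linear coefficient gives stationarity, the quadratic one the second-order
    -- condition.
    have key := coeff_of_forall_quartic_nonpos (a := 4 * inner ℝ y (T u))
      (b := 4 * ‖T u‖ ^ 2 - 4 * μ * N) (c := 4 * N * inner ℝ (t - T w) (T u))
      (k := N ^ 2 * (‖t - T w‖ ^ 2 - r ^ 2)) (fun x => by
        have h1 := hom (1 + x ^ 2 * N) ((1 - x ^ 2 * N) • w + (2 * x) • u) (by
          rw [norm_add_sq_real, norm_smul, norm_smul, mul_pow, mul_pow, real_inner_smul_left,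
            real_inner_smul_right, hu, hw, Real.norm_eq_abs, Real.norm_eq_abs, sq_abs, sq_abs, ← hN]
          ring)
        have h2 : (1 + x ^ 2 * N) • t + T ((1 - x ^ 2 * N) • w + (2 * x) • u) =
            y + (x ^ 2 * N) • (t - T w) + (2 * x) • T u := by
          rw [map_add, map_smul, map_smul, hy]
          module
        rw [h2, norm_add_sq_real, norm_add_sq_real, inner_add_left, real_inner_smul_left,
          real_inner_smul_right, real_inner_smul_right, real_inner_smul_right, norm_smul, norm_smul,
          mul_pow, mul_pow, Real.norm_eq_abs, Real.norm_eq_abs, sq_abs, sq_abs, inner_sub_right,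
          hyt, ← hμ, ← hr] at h1
        linarith)
    exact ⟨by linarith [key.1], by linarith [key.2]⟩
  have main : ∀ (a : ℝ) (x : E), ‖a • t + T x‖ ^ 2 ≤ (r ^ 2 - μ) * a ^ 2 + μ * ‖x‖ ^ 2 := by
    intro a x
    obtain ⟨c, u, hu, rfl⟩ : ∃ (c : ℝ) (u : E), inner ℝ w u = (0 : ℝ) ∧ x = c • w + u := by
      refine ⟨inner ℝ w x, x - (inner ℝ w x : ℝ) • w, ?_, by module⟩
      rw [inner_sub_right, real_inner_smul_right, real_inner_self_eq_norm_sq, hw]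
      ring
    obtain ⟨ho1, ho2⟩ := orth u hu
    obtain ⟨δ, rfl⟩ : ∃ δ, a = c + δ := ⟨a - c, by ring⟩
    have hx : ∀ b : ℝ, ‖b • w + u‖ ^ 2 = b ^ 2 + ‖u‖ ^ 2 := fun b => by
      rw [norm_add_sq_real, norm_smul, mul_pow, real_inner_smul_left, hu, hw, Real.norm_eq_abs,
        sq_abs]
      ring
    have hv : ∀ b : ℝ, (b + δ) • t + T (b • w + u) = b • y + δ • t + T u := fun b => by
      rw [map_add, map_smul, hy]
      module
    rw [hx, hv, norm_sq_smul_add_smul_add ho1, hyt]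
    -- The gap between the two sides does not depend on `c`. For `δ ≠ 0`, replace `c` by the `b`
    -- that puts the point on the cone, where `hom` is the claim.
    by_cases hδ : δ = 0
    · subst hδ
      nlinarith
    · set b := (‖u‖ ^ 2 - δ ^ 2) / (2 * δ) with hb
      have hb2 : 2 * b * δ = ‖u‖ ^ 2 - δ ^ 2 := by
        rw [hb]
        field_simp
      have h1 := hom (b + δ) (b • w + u) (by rw [hx]; linarith [hb2])
      rw [hv, norm_sq_smul_add_smul_add ho1, hyt] at h1
      rw [← hr] at h1 ⊢
      linear_combination h1 + μ * hb2
  refine ⟨μ, ?_, ?_, main⟩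
  · have h := main 0 w
    rw [hw, zero_smul, zero_add] at h
    nlinarith [sq_nonneg ‖T w‖]
  · have h := main 1 0
    rw [map_zero, norm_zero, one_smul, add_zero] at h
    nlinarith [sq_nonneg ‖t‖]

end TrustRegion

/-! ### Contractions of `ℝ³` and factorization of affine maps. -/

section Contraction

theorem dotProduct_mulVec_self_of_mem_orthogonalGroup {f : Matrix (Fin 3) (Fin 3) ℝ}
    (hf : f ∈ orthogonalGroup (Fin 3) ℝ) (x : Fin 3 → ℝ) : (f *ᵥ x) ⬝ᵥ (f *ᵥ x) = x ⬝ᵥ x := by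
  have h : fᵀ * f = 1 := (mem_orthogonalGroup_iff' (Fin 3) ℝ).1 hf
  rw [dotProduct_mulVec, ← mulVec_transpose, mulVec_mulVec, h, one_mulVec]

theorem transpose_mem_orthogonalGroup {f : Matrix (Fin 3) (Fin 3) ℝ}
    (hf : f ∈ orthogonalGroup (Fin 3) ℝ) : fᵀ ∈ orthogonalGroup (Fin 3) ℝ := by
  rw [mem_orthogonalGroup_iff]
  have : fᵀ * f = 1 := (mem_orthogonalGroup_iff' (Fin 3) ℝ).1 hf
  simpa [star_eq_conjTranspose] using this

/-- A `3 × 3` contraction is a convex combination of orthogonal matrices. -/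
theorem mem_convexHull_orthogonalGroup {G : Matrix (Fin 3) (Fin 3) ℝ}
    (hG : ∀ x, (G *ᵥ x) ⬝ᵥ (G *ᵥ x) ≤ x ⬝ᵥ x) :
    G ∈ convexHull ℝ (orthogonalGroup (Fin 3) ℝ : Set (Matrix (Fin 3) (Fin 3) ℝ)) := by
  obtain ⟨U, hU, V, hV, s, hs, h⟩ := exists_svd G
  have h' : G = U * diagonal s * Vᵀ := by
    simpa [conjTranspose_eq_transpose_of_trivial] using h
  have hs1 : ∀ i, s i ≤ 1 := by
    intro i
    have h1 := hG (V *ᵥ Pi.single i 1)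
    rw [dotProduct_mulVec_self_of_mem_orthogonalGroup hV, h', mulVec_mulVec, Matrix.mul_assoc,
      (mem_orthogonalGroup_iff' (Fin 3) ℝ).1 hV, Matrix.mul_one, ← mulVec_mulVec,
      dotProduct_mulVec_self_of_mem_orthogonalGroup hU, diagonal_mulVec_single] at h1
    simp only [mul_one, dotProduct_single, Pi.single_eq_same] at h1
    nlinarith [hs i]
  -- The singular values lie in the cube `[-1, 1]³`, the hull of the sign vectors; sign vectors give
  -- orthogonal matrices.
  have hbox : s ∈ convexHull ℝ (Set.univ.pi fun _ : Fin 3 => ({-1, 1} : Set ℝ)) := by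
    rw [convexHull_pi]
    intro i _
    rw [convexHull_pair, segment_eq_Icc (by norm_num)]
    exact ⟨by linarith [hs i], hs1 i⟩
  let L : (Fin 3 → ℝ) →ₗ[ℝ] Matrix (Fin 3) (Fin 3) ℝ :=
    LinearMap.mulRight ℝ Vᵀ ∘ₗ LinearMap.mulLeft ℝ U ∘ₗ diagonalLinearMap (Fin 3) ℝ ℝ
  have hL : ∀ x, L x = U * diagonal x * Vᵀ := fun x => rfl
  have hsub : convexHull ℝ (Set.univ.pi fun _ : Fin 3 => ({-1, 1} : Set ℝ)) ⊆
      L ⁻¹' convexHull ℝ (orthogonalGroup (Fin 3) ℝ : Set (Matrix (Fin 3) (Fin 3) ℝ)) := by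
    refine convexHull_min (fun x hx => subset_convexHull ℝ _ ?_)
      ((convex_convexHull ℝ _).linear_preimage L)
    rw [hL]
    refine mul_mem (mul_mem hU ?_) (transpose_mem_orthogonalGroup hV)
    rw [mem_orthogonalGroup_iff]
    change diagonal x * (diagonal x)ᴴ = 1
    rw [conjTranspose_eq_transpose_of_trivial, diagonal_transpose, diagonal_mul_diagonal, ← diagonal_one]
    congr 1
    ext i
    rcases hx i (Set.mem_univ i) with h1 | h1
    · simp [h1]
    · rw [Set.mem_singleton_iff] at h1
      simp [h1]
  rw [h']
  exact hsub hbox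

theorem exists_orthogonalGroup_row {u : Fin 3 → ℝ} (hu : u ⬝ᵥ u = 1) :
    ∃ f ∈ orthogonalGroup (Fin 3) ℝ, f 2 = u := by
  have h1 : Orthonormal ℝ (({2} : Set (Fin 3)).domRestrict
      fun _ => (WithLp.toLp 2 u : EuclideanSpace ℝ (Fin 3))) := by
    rw [orthonormal_iff_ite]
    rintro ⟨i, hi⟩ ⟨j, hj⟩
    rw [Set.mem_singleton_iff] at hi hj
    subst hi hj
    simp only [Set.domRestrict_apply, if_true]
    rw [EuclideanSpace.inner_eq_star_dotProduct]
    simpa using hu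
  obtain ⟨b, hb⟩ := h1.exists_orthonormalBasis_extension_of_card_eq (by simp)
  have hm := (EuclideanSpace.basisFun (Fin 3) ℝ).toMatrix_orthonormalBasis_mem_unitary b
  refine ⟨_, transpose_mem_orthogonalGroup hm, ?_⟩
  ext j
  rw [transpose_apply, Module.Basis.toMatrix_apply]
  simp [hb 2 rfl]

/-- An affine map of `ℝ³` bounded by a diagonal quadratic form factors through a contraction and an
affine map that is diagonal in an orthonormal basis. -/
theorem exists_contraction_factorization {t : Fin 3 → ℝ} {T : Matrix (Fin 3) (Fin 3) ℝ} {α β : ℝ}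
    (h : ∀ (a : ℝ) (x : Fin 3 → ℝ), (a • t + T *ᵥ x) ⬝ᵥ (a • t + T *ᵥ x) ≤
      α ^ 2 * a ^ 2 + β ^ 2 * (x ⬝ᵥ x)) :
    ∃ (G f : Matrix (Fin 3) (Fin 3) ℝ) (n s : ℝ), (∀ x, (G *ᵥ x) ⬝ᵥ (G *ᵥ x) ≤ x ⬝ᵥ x) ∧
      f ∈ orthogonalGroup (Fin 3) ℝ ∧ n ^ 2 + s ^ 2 = 1 ∧ t = G *ᵥ ![0, 0, α * s] ∧
      T = G * diagonal ![β, β, -(β * n)] * f := by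
  -- Rescaling makes `(t', T')` a contraction on `ℝ × ℝ³`. If `α = 0` or `β = 0`, the bound forces
  -- `t = 0` or `T = 0`, so the convention `0⁻¹ = 0` is harmless.
  obtain ⟨t', ht'⟩ : ∃ t', t' = α⁻¹ • t := ⟨_, rfl⟩
  obtain ⟨T', hT'⟩ : ∃ T', T' = β⁻¹ • T := ⟨_, rfl⟩
  have ht : t = α • t' := by
    by_cases hα : α = 0
    · have := h 1 0
      rw [mulVec_zero, add_zero, one_smul, hα] at this
      have h0 : t ⬝ᵥ t = 0 := le_antisymm (by simpa using this)
        (Finset.sum_nonneg fun i _ => mul_self_nonneg _)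
      rw [hα, zero_smul]
      exact dotProduct_self_eq_zero.1 h0
    · rw [ht', smul_smul, mul_inv_cancel₀ hα, one_smul]
  have hT : T = β • T' := by
    by_cases hβ : β = 0
    · rw [hβ, zero_smul]
      refine Matrix.ext_of_mulVec_single fun j => ?_
      have := h 0 (Pi.single j 1)
      rw [zero_smul, zero_add, hβ] at this
      have h0 : (T *ᵥ Pi.single j 1) ⬝ᵥ (T *ᵥ Pi.single j 1) = 0 := le_antisymm (by simpa using this)
        (Finset.sum_nonneg fun i _ => mul_self_nonneg _)
      rw [zero_mulVec]
      exact dotProduct_self_eq_zero.1 h0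
    · rw [hT', smul_smul, mul_inv_cancel₀ hβ, one_smul]
  have hc : ∀ (a : ℝ) (x : Fin 3 → ℝ), (a • t' + T' *ᵥ x) ⬝ᵥ (a • t' + T' *ᵥ x) ≤
      a ^ 2 + x ⬝ᵥ x := by
    intro a x
    have h1 := h (α⁻¹ * a) (β⁻¹ • x)
    have h2 : (α⁻¹ * a) • t + T *ᵥ (β⁻¹ • x) = a • t' + T' *ᵥ x := by
      rw [ht', hT', mulVec_smul, smul_mulVec, smul_smul, mul_comm]
    rw [h2] at h1
    refine h1.trans (add_le_add ?_ ?_)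
    · have : α ^ 2 * (α⁻¹ * a) ^ 2 = (α * α⁻¹) ^ 2 * a ^ 2 := by ring
      rw [this]
      refine mul_le_of_le_one_left (sq_nonneg a) ?_
      by_cases hα : α = 0 <;> simp [hα]
    · have : β ^ 2 * ((β⁻¹ • x) ⬝ᵥ (β⁻¹ • x)) = (β * β⁻¹) ^ 2 * (x ⬝ᵥ x) := by
        rw [smul_dotProduct, dotProduct_smul, smul_eq_mul, smul_eq_mul]
        ring
      rw [this]
      refine mul_le_of_le_one_left (Finset.sum_nonneg fun i _ => mul_self_nonneg _) ?_
      by_cases hβ : β = 0 <;> simp [hβ]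
  -- A linear map from four dimensions to three has a unit kernel vector.
  obtain ⟨n, v, hnv, hker⟩ : ∃ (n : ℝ) (v : Fin 3 → ℝ), n ^ 2 + v ⬝ᵥ v = 1 ∧
      n • t' + T' *ᵥ v = 0 := by
    let L : ℝ × (Fin 3 → ℝ) →ₗ[ℝ] (Fin 3 → ℝ) :=
      (LinearMap.toSpanSingleton ℝ _ t').coprod (mulVecLin T')
    have hL : ∀ x, L x = x.1 • t' + T' *ᵥ x.2 := fun x => by simp [L]
    have hk := LinearMap.ker_ne_bot_of_finrank_lt (f := L) (by simp)
    obtain ⟨⟨m, z⟩, hm, hz⟩ := (Submodule.ne_bot_iff _).1 hk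
    rw [LinearMap.mem_ker, hL] at hm
    have hz0 : 0 ≤ z ⬝ᵥ z := Finset.sum_nonneg fun i _ => mul_self_nonneg _
    have hpos : 0 < m ^ 2 + z ⬝ᵥ z := by
      refine lt_of_le_of_ne (by positivity) fun h0 => hz ?_
      have h1 : m = 0 := by nlinarith
      have h2 : z ⬝ᵥ z = 0 := by nlinarith
      rw [h1, dotProduct_self_eq_zero.1 h2]
      rfl
    set k := (√(m ^ 2 + z ⬝ᵥ z))⁻¹ with hk
    have hk2 : k ^ 2 * (m ^ 2 + z ⬝ᵥ z) = 1 := by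
      rw [hk, inv_pow, Real.sq_sqrt hpos.le, inv_mul_cancel₀ hpos.ne']
    refine ⟨k * m, k • z, ?_, ?_⟩
    · rw [smul_dotProduct, dotProduct_smul, smul_eq_mul, smul_eq_mul, ← hk2]
      ring
    · rw [mulVec_smul, ← smul_smul, ← smul_add]
      simp only at hm
      rw [hm, smul_zero]
  have hv0 : 0 ≤ v ⬝ᵥ v := Finset.sum_nonneg fun i _ => mul_self_nonneg _
  set s := √(v ⬝ᵥ v) with hs
  have hs2 : s ^ 2 = v ⬝ᵥ v := Real.sq_sqrt hv0
  obtain ⟨f, hf, hfv⟩ : ∃ f ∈ orthogonalGroup (Fin 3) ℝ, v = s • f 2 := by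
    by_cases h0 : s = 0
    · refine ⟨1, one_mem _, ?_⟩
      rw [h0, zero_smul]
      exact dotProduct_self_eq_zero.1 (by rw [← hs2, h0]; ring)
    · obtain ⟨f, hf, hf2⟩ := exists_orthogonalGroup_row (u := s⁻¹ • v) (by
        rw [smul_dotProduct, dotProduct_smul, smul_eq_mul, smul_eq_mul, ← hs2]
        field_simp)
      refine ⟨f, hf, ?_⟩
      rw [hf2, smul_smul, mul_inv_cancel₀ h0, one_smul]
  have hff : fᵀ * f = 1 := (mem_orthogonalGroup_iff' (Fin 3) ℝ).1 hf
  have hns : n ^ 2 + s ^ 2 = 1 := by rw [hs2]; exact hnv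
  have hTv : T' *ᵥ v = -(n • t') := by
    rw [eq_neg_iff_add_eq_zero, add_comm]
    exact hker
  -- With `v = s • f 2`, the vectors `(0, f 0)`, `(0, f 1)`, `(s, -n • f 2)` are an orthonormal
  -- basis of the complement of `(n, v)`. `G` is the contraction `(t', T')` in this basis.
  set G : Matrix (Fin 3) (Fin 3) ℝ :=
    vecMulVec t' ![0, 0, s] + T' * fᵀ * diagonal ![1, 1, -n] with hGdef
  have hG : ∀ x : Fin 3 → ℝ,
      G *ᵥ x = (s * x 2) • t' + T' *ᵥ (fᵀ *ᵥ ![x 0, x 1, -(n * x 2)]) := by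
    intro x
    have h1 : diagonal ![1, 1, -n] *ᵥ x = ![x 0, x 1, -(n * x 2)] := by
      ext i
      rw [mulVec_diagonal]
      fin_cases i <;> simp
    have h2 : ![0, 0, s] ⬝ᵥ x = s * x 2 := by
      simp [dotProduct, Fin.sum_univ_three]
    rw [hGdef, add_mulVec, vecMulVec_mulVec, h2, ← mulVec_mulVec, ← mulVec_mulVec, h1,
      op_smul_eq_smul]
  refine ⟨G, f, n, s, fun x => ?_, hf, hns, ?_, ?_⟩
  · rw [hG]
    refine (hc _ _).trans (le_of_eq ?_)
    rw [dotProduct_mulVec_self_of_mem_orthogonalGroup (transpose_mem_orthogonalGroup hf)]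
    simp only [dotProduct, Fin.sum_univ_three, cons_val_zero, cons_val_one, cons_val]
    linear_combination (x 2 ^ 2) * hns
  · have h1 : fᵀ *ᵥ ![0, 0, -(n * (α * s))] = (-(n * α)) • v := by
      rw [hfv, smul_smul]
      ext i
      simp [mulVec, dotProduct, Fin.sum_univ_three]
      ring
    rw [hG]
    simp only [cons_val_zero, cons_val_one, cons_val]
    rw [h1, mulVec_smul, hTv, ht]
    ext i
    simp only [Pi.smul_apply, Pi.add_apply, Pi.neg_apply, smul_eq_mul]
    linear_combination (-(α * t' i)) * hns
  · refine Matrix.ext_of_mulVec_single fun j => ?_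
    set x : Fin 3 → ℝ := Pi.single j 1
    set c := f *ᵥ x with hcdef
    have hcx : fᵀ *ᵥ c = x := by rw [hcdef, mulVec_mulVec, hff, one_mulVec]
    have h1 : diagonal ![β, β, -(β * n)] *ᵥ c = ![β * c 0, β * c 1, -(β * n) * c 2] := by
      ext i
      rw [mulVec_diagonal]
      fin_cases i <;> simp
    have h2 : fᵀ *ᵥ ![β * c 0, β * c 1, -(n * (-(β * n) * c 2))] =
        β • x - (β * s * c 2) • v := by
      rw [← hcx, hfv]
      ext i
      simp only [mulVec, dotProduct, Fin.sum_univ_three, transpose_apply, cons_val_zero,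
        cons_val_one, cons_val, Pi.sub_apply, Pi.smul_apply, smul_eq_mul]
      linear_combination (f 2 i * β * c 2) * hns
    rw [← mulVec_mulVec, ← mulVec_mulVec, ← hcdef, h1, hG]
    simp only [cons_val_zero, cons_val_one, cons_val]
    rw [h2, mulVec_sub, mulVec_smul, mulVec_smul, hTv, hT, smul_mulVec]
    ext i
    simp only [Pi.smul_apply, Pi.add_apply, Pi.neg_apply, Pi.sub_apply, smul_eq_mul]
    ring

end Contraction

/-! ### Bloch representation of qubit maps. -/

section Bloch

/-- The traceless Hermitian matrix `∑ v_j σ_j` with Bloch vector `v`. -/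
def pauliVec (v : Fin 3 → ℝ) : Matrix (Fin 2) (Fin 2) ℂ :=
  !![(v 2 : ℂ), v 0 - v 1 * Complex.I; v 0 + v 1 * Complex.I, -(v 2 : ℂ)]

theorem pauliVec_add (v w : Fin 3 → ℝ) : pauliVec (v + w) = pauliVec v + pauliVec w := by
  ext i j
  fin_cases i <;> fin_cases j <;> simp [pauliVec] <;> ring

theorem pauliVec_smul (c : ℝ) (v : Fin 3 → ℝ) : pauliVec (c • v) = (c : ℂ) • pauliVec v := by
  ext i j
  fin_cases i <;> fin_cases j <;> simp [pauliVec] <;> ring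

theorem isHermitian_pauliVec (v : Fin 3 → ℝ) : (pauliVec v).IsHermitian := by
  ext i j
  fin_cases i <;> fin_cases j <;> simp [pauliVec, sub_eq_add_neg]

theorem trace_pauliVec (v : Fin 3 → ℝ) : (pauliVec v).trace = 0 := by
  simp [pauliVec, trace, Fin.sum_univ_two]

/-- The Clifford relation, which encodes the Euclidean structure of Bloch vectors in matrix
products. -/
theorem pauliVec_mul_add_mul (v w : Fin 3 → ℝ) :
    pauliVec v * pauliVec w + pauliVec w * pauliVec v = ((2 * (v ⬝ᵥ w) : ℝ) : ℂ) • 1 := by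
  have hI : Complex.I ^ 2 = -1 := Complex.I_sq
  ext i j
  fin_cases i <;> fin_cases j <;> simp [pauliVec, dotProduct, Fin.sum_univ_three]
  · linear_combination (-2 * (v 1 : ℂ) * w 1) * hI
  · ring
  · ring
  · linear_combination (-2 * (v 1 : ℂ) * w 1) * hI

theorem pauliVec_mul_self (v : Fin 3 → ℝ) :
    pauliVec v * pauliVec v = ((v ⬝ᵥ v : ℝ) : ℂ) • 1 := by
  have h := pauliVec_mul_add_mul v v
  rw [← two_smul ℂ (pauliVec v * pauliVec v)] at h
  have h2 : (2 : ℂ) • (pauliVec v * pauliVec v) = (2 : ℂ) • (((v ⬝ᵥ v : ℝ) : ℂ) • 1) := by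
    rw [h, smul_smul]
    push_cast
    rfl
  exact smul_right_injective _ two_ne_zero h2

theorem IsHermitian.exists_eq_add_pauliVec {H : Matrix (Fin 2) (Fin 2) ℂ} (hH : H.IsHermitian) :
    ∃ v, H = (H.trace / 2) • 1 + pauliVec v := by
  refine ⟨![(H 0 1).re, -(H 0 1).im, ((H 0 0).re - (H 1 1).re) / 2], ?_⟩
  have h0 : ((H 0 0).re : ℂ) = H 0 0 := Complex.conj_eq_iff_re.1 (hH.apply 0 0)
  have h1 : ((H 1 1).re : ℂ) = H 1 1 := Complex.conj_eq_iff_re.1 (hH.apply 1 1)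
  have h2 : H 1 0 = star (H 0 1) := (hH.apply 1 0).symm
  have h3 : ((H 0 1).re : ℂ) + (H 0 1).im * Complex.I = H 0 1 := Complex.re_add_im _
  ext i j
  fin_cases i <;> fin_cases j
  · simp [pauliVec, trace, Fin.sum_univ_two, h0, h1]
    ring
  · simp [pauliVec, h3]
  · have h4 : H 1 0 = (H 0 1).re - (H 0 1).im * Complex.I := by
      rw [h2]
      apply Complex.ext <;> simp
    simp [pauliVec, h4, sub_eq_add_neg]
  · simp [pauliVec, trace, Fin.sum_univ_two, h0, h1]
    ring

theorem linearMap_ext_pauliVec {f g : Matrix (Fin 2) (Fin 2) ℂ →ₗ[ℂ] Matrix (Fin 2) (Fin 2) ℂ}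
    (h1 : f 1 = g 1) (h : ∀ v, f (pauliVec v) = g (pauliVec v)) : f = g := by
  have hh : ∀ H : Matrix (Fin 2) (Fin 2) ℂ, H.IsHermitian → f H = g H := by
    intro H hH
    obtain ⟨v, hv⟩ := IsHermitian.exists_eq_add_pauliVec hH
    rw [hv, map_add, map_add, map_smul, map_smul, h1, h]
  ext1 X
  obtain ⟨A, B, hA, hB, rfl⟩ : ∃ A B : Matrix (Fin 2) (Fin 2) ℂ, A.IsHermitian ∧ B.IsHermitian ∧
      X = (1 / 2 : ℂ) • A + (-Complex.I / 2) • B := by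
    refine ⟨X + Xᴴ, Complex.I • (X - Xᴴ), isHermitian_add_transpose_self X, ?_, ?_⟩
    · rw [IsHermitian, conjTranspose_smul, conjTranspose_sub, conjTranspose_conjTranspose]
      ext i j
      simp
      ring
    · ext i j
      simp
      linear_combination ((1 / 2 : ℂ) * (X i j - (starRingEnd ℂ) (X j i))) * Complex.I_sq
  rw [map_add, map_add, map_smul, map_smul, map_smul, map_smul, hh A hA, hh B hB]

/-- The qubit map `½(1 + x·σ) ↦ ½(1 + (t + T x)·σ)`. -/
def blochMap (t : Fin 3 → ℝ) (T : Matrix (Fin 3) (Fin 3) ℝ) :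
    Matrix (Fin 2) (Fin 2) ℂ →ₗ[ℂ] Matrix (Fin 2) (Fin 2) ℂ :=
  (1 / 2 : ℂ) • ((traceLinearMap (Fin 2) ℂ ℂ).smulRight (1 + pauliVec t) +
    ∑ j, (traceLinearMap (Fin 2) ℂ ℂ ∘ₗ
      LinearMap.mulLeft ℂ (pauliVec (Pi.single j 1))).smulRight (pauliVec fun i => T i j))

theorem blochMap_apply (t : Fin 3 → ℝ) (T : Matrix (Fin 3) (Fin 3) ℝ)
    (X : Matrix (Fin 2) (Fin 2) ℂ) :
    blochMap t T X = (1 / 2 : ℂ) • (X.trace • (1 + pauliVec t) +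
      ∑ j, (pauliVec (Pi.single j 1) * X).trace • pauliVec fun i => T i j) := by
  simp [blochMap]

theorem trace_pauliVec_mul (v w : Fin 3 → ℝ) :
    (pauliVec v * pauliVec w).trace = ((2 * (v ⬝ᵥ w) : ℝ) : ℂ) := by
  have h := congrArg trace (pauliVec_mul_add_mul v w)
  rw [trace_add, trace_mul_comm (pauliVec w), trace_smul, trace_one, Fintype.card_fin,
    smul_eq_mul] at h
  push_cast at h ⊢
  linear_combination h / 2

theorem blochMap_one (t : Fin 3 → ℝ) (T : Matrix (Fin 3) (Fin 3) ℝ) :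
    blochMap t T 1 = 1 + pauliVec t := by
  rw [blochMap_apply]
  simp [trace_pauliVec, smul_smul]

theorem blochMap_pauliVec (t : Fin 3 → ℝ) (T : Matrix (Fin 3) (Fin 3) ℝ) (v : Fin 3 → ℝ) :
    blochMap t T (pauliVec v) = pauliVec (T *ᵥ v) := by
  rw [blochMap_apply, trace_pauliVec, zero_smul, zero_add]
  have h : T *ᵥ v = ∑ j, v j • fun i => T i j := by
    ext i
    simp [mulVec, dotProduct, mul_comm]
  rw [h, Fin.sum_univ_three, Fin.sum_univ_three, pauliVec_add, pauliVec_add, pauliVec_smul,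
    pauliVec_smul, pauliVec_smul, trace_pauliVec_mul, trace_pauliVec_mul, trace_pauliVec_mul]
  simp only [single_dotProduct, one_mul]
  push_cast
  module

/-- Preservation of trace and Hermiticity sends traceless Hermitian matrices to such matrices, and
`1` to `1` plus one of them. -/
theorem exists_eq_blochMap {Φ : Matrix (Fin 2) (Fin 2) ℂ →ₗ[ℂ] Matrix (Fin 2) (Fin 2) ℂ}
    (htr : IsTracePreserving Φ) (hΦ : ∀ H, H.IsHermitian → (Φ H).IsHermitian) :
    ∃ t T, Φ = blochMap t T := by
  obtain ⟨t, ht⟩ := IsHermitian.exists_eq_add_pauliVec (hΦ 1 isHermitian_one)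
  have h : ∀ v, ∃ u, Φ (pauliVec v) = pauliVec u := by
    intro v
    obtain ⟨u, hu⟩ := IsHermitian.exists_eq_add_pauliVec (hΦ _ (isHermitian_pauliVec v))
    rw [htr, trace_pauliVec, zero_div, zero_smul, zero_add] at hu
    exact ⟨u, hu⟩
  choose u hu using fun j : Fin 3 => h (Pi.single j 1)
  refine ⟨t, of fun i j => u j i, linearMap_ext_pauliVec ?_ fun v => ?_⟩
  · rw [blochMap_one, ht, htr, trace_one]
    simp
  · have h : v = ∑ j, v j • Pi.single j (1 : ℝ) := by
      ext i
      simp [Finset.sum_apply, Pi.single_apply]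
    rw [blochMap_pauliVec]
    have h2 : (of fun i j => u j i : Matrix (Fin 3) (Fin 3) ℝ) *ᵥ v = ∑ j, v j • u j := by
      ext i
      simp [mulVec, dotProduct, mul_comm]
    rw [h2]
    conv_lhs => rw [h]
    simp only [Fin.sum_univ_three, pauliVec_add, pauliVec_smul, map_add, map_smul, hu]

/-- `pauliVec w` squares to `1`, so `1 + pauliVec w` is half its own square. -/
theorem posSemidef_one_add_pauliVec {w : Fin 3 → ℝ} (hw : w ⬝ᵥ w = 1) :
    (1 + pauliVec w).PosSemidef := by
  have h1 : (1 + pauliVec w)ᴴ = 1 + pauliVec w := by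
    rw [conjTranspose_add, conjTranspose_one, (isHermitian_pauliVec w).eq]
  have h2 : 1 + pauliVec w = (1 / 2 : ℂ) • ((1 + pauliVec w)ᴴ * (1 + pauliVec w)) := by
    rw [h1, Matrix.add_mul, Matrix.mul_add, Matrix.mul_add, pauliVec_mul_self, hw]
    simp only [Matrix.mul_one, Matrix.one_mul, Complex.ofReal_one]
    module
  rw [h2]
  exact (posSemidef_conjTranspose_mul_self _).smul (by
    rw [one_div, ← Complex.ofReal_ofNat, ← Complex.ofReal_inv]
    exact_mod_cast (by norm_num : (0 : ℝ) ≤ 2⁻¹))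

/-- Each Pauli matrix is a difference of positive matrices, and real combinations with `1` give all
Hermitian ones. -/
theorem IsPositivityPreserving.map_isHermitian
    {Φ : Matrix (Fin 2) (Fin 2) ℂ →ₗ[ℂ] Matrix (Fin 2) (Fin 2) ℂ} (hΦ : IsPositivityPreserving Φ)
    (H : Matrix (Fin 2) (Fin 2) ℂ) (hH : H.IsHermitian) : (Φ H).IsHermitian := by
  have hp : ∀ v, (Φ (pauliVec v)).IsHermitian := by
    intro v
    have h1 : ∀ j : Fin 3, (Φ (pauliVec (Pi.single j 1))).IsHermitian := by
      intro j
      have h2 : pauliVec (Pi.single j 1) = (1 + pauliVec (Pi.single j 1)) - 1 := by abel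
      rw [h2, map_sub]
      exact (hΦ _ (posSemidef_one_add_pauliVec (by simp))).isHermitian.sub
        (hΦ _ PosSemidef.one).isHermitian
    have h : v = ∑ j, v j • Pi.single j (1 : ℝ) := by
      ext i
      simp [Finset.sum_apply, Pi.single_apply]
    rw [h]
    simp only [Fin.sum_univ_three, pauliVec_add, pauliVec_smul, map_add, map_smul]
    have hs : ∀ (c : ℝ) (j : Fin 3),
        ((c : ℂ) • Φ (pauliVec (Pi.single j 1))).IsHermitian := by
      intro c j
      rw [IsHermitian, conjTranspose_smul, (h1 j).eq]
      simp
    exact ((hs _ _).add (hs _ _)).add (hs _ _)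
  obtain ⟨v, hv⟩ := IsHermitian.exists_eq_add_pauliVec hH
  rw [hv, map_add, map_smul]
  refine IsHermitian.add ?_ (hp v)
  have ht : star H.trace = H.trace := by rw [← trace_conjTranspose, hH.eq]
  rw [IsHermitian, conjTranspose_smul, (hΦ _ PosSemidef.one).isHermitian.eq, star_div₀, ht]
  simp

end Bloch

/-! ### Orthogonal matrices as unitary conjugations. -/

section Rotation

/-- The eigenvalues are `1` and `-1` in an unknown order, which a swap corrects. -/
theorem exists_unitary_of_mul_self_eq_one {S : Matrix (Fin 2) (Fin 2) ℂ} (hS : S.IsHermitian)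
    (htr : S.trace = 0) (hS2 : S * S = 1) :
    ∃ U ∈ unitaryGroup (Fin 2) ℂ, S = U * diagonal ![1, -1] * Uᴴ := by
  have h1 : hS.eigenvalues 0 + hS.eigenvalues 1 = 0 := by
    have := hS.trace_eq_sum_eigenvalues
    rw [htr, Fin.sum_univ_two] at this
    refine Complex.ofReal_injective ?_
    push_cast
    exact this.symm
  obtain ⟨U, hU, h⟩ := IsHermitian.exists_unitary_diagonal_complex hS
  have h2 : hS.eigenvalues 0 ^ 2 = 1 := by
    have hUU : Uᴴ * U = 1 := star_mul_self_of_mem_unitaryGroup hU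
    have h3 : (diagonal fun i => (hS.eigenvalues i : ℂ)) = Uᴴ * S * U := by
      conv_rhs => rw [h]
      simp only [Matrix.mul_assoc, hUU, Matrix.mul_one]
      rw [← Matrix.mul_assoc, hUU, Matrix.one_mul]
    have h4 : (diagonal fun i => (hS.eigenvalues i : ℂ)) *
        (diagonal fun i => (hS.eigenvalues i : ℂ)) = 1 := by
      rw [h3]
      calc Uᴴ * S * U * (Uᴴ * S * U) = Uᴴ * S * (U * Uᴴ) * S * U := by
            simp only [Matrix.mul_assoc]
        _ = Uᴴ * (S * S) * U := by
            rw [mul_star_self_of_mem_unitaryGroup hU, Matrix.mul_one, Matrix.mul_assoc Uᴴ]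
        _ = 1 := by rw [hS2, Matrix.mul_one, hUU]
    rw [diagonal_mul_diagonal] at h4
    have h5 := congrFun (congrFun h4 0) 0
    rw [diagonal_apply_eq, one_apply_eq] at h5
    rw [sq]
    exact_mod_cast h5
  rcases (sq_eq_one_iff.1 h2) with h3 | h3
  · have h4 : hS.eigenvalues 1 = -1 := by linarith
    refine ⟨U, hU, ?_⟩
    conv_lhs => rw [h]
    congr 3
    ext i
    fin_cases i
    · simp [h3]
    · simp [h4]
  · have h4 : hS.eigenvalues 1 = 1 := by linarith
    have hX : (!![0, 1; 1, 0] : Matrix (Fin 2) (Fin 2) ℂ)ᴴ = !![0, 1; 1, 0] := by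
      ext i j
      fin_cases i <;> fin_cases j <;> simp
    refine ⟨U * !![0, 1; 1, 0], mul_mem hU ?_, ?_⟩
    · rw [mem_unitaryGroup_iff, star_eq_conjTranspose, hX]
      ext i j
      fin_cases i <;> fin_cases j <;> simp
    · have h5 : (diagonal fun i => (hS.eigenvalues i : ℂ)) =
          !![0, 1; 1, 0] * diagonal ![1, -1] * (!![0, 1; 1, 0] : Matrix (Fin 2) (Fin 2) ℂ)ᴴ := by
        rw [hX]
        ext i j
        fin_cases i <;> fin_cases j <;> simp [Matrix.mul_apply, vecMul_diagonal, h3, h4]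
      conv_lhs => rw [h, h5]
      simp only [conjTranspose_mul, Matrix.mul_assoc]

/-- Orthogonal maps of Bloch vectors are unitary conjugations, up to a reflection. -/
theorem exists_unitary_pauliVec_mulVec {R : Matrix (Fin 3) (Fin 3) ℝ}
    (hR : R ∈ orthogonalGroup (Fin 3) ℝ) :
    ∃ U ∈ unitaryGroup (Fin 2) ℂ, ∃ ε : ℝ, (ε = 1 ∨ ε = -1) ∧
      ∀ v, pauliVec (R *ᵥ v) = conjMap U (pauliVec ![v 0, ε * v 1, v 2]) := by
  have hRR : Rᵀ * R = 1 := (mem_orthogonalGroup_iff' (Fin 3) ℝ).1 hR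
  -- The images of the Pauli matrices under `R` again satisfy the Clifford relations; such a triple
  -- is unitarily a Pauli triple, up to one sign.
  obtain ⟨S, hS⟩ : ∃ S : Fin 3 → Matrix (Fin 2) (Fin 2) ℂ, ∀ j, S j = pauliVec fun i => R i j :=
    ⟨_, fun _ => rfl⟩
  have hSS : ∀ i j, S i * S j + S j * S i = if i = j then (2 : ℂ) • 1 else 0 := by
    intro i j
    have h1 : ((fun k => R k i) ⬝ᵥ fun k => R k j) = (1 : Matrix (Fin 3) (Fin 3) ℝ) i j := by
      rw [← hRR]
      rfl
    rw [hS, hS, pauliVec_mul_add_mul, h1, one_apply]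
    split_ifs <;> simp
  have hSh : ∀ j, (S j).IsHermitian := fun j => by
    rw [hS]
    exact isHermitian_pauliVec _
  have hS1 : ∀ j, S j * S j = 1 := fun j => by
    have := hSS j j
    rw [if_pos rfl, ← two_smul ℂ] at this
    exact smul_right_injective _ two_ne_zero this
  obtain ⟨U, hU, h2⟩ := exists_unitary_of_mul_self_eq_one (hSh 2) (by rw [hS, trace_pauliVec]) (hS1 2)
  have hUU : Uᴴ * U = 1 := star_mul_self_of_mem_unitaryGroup hU
  have hUU' : U * Uᴴ = 1 := mul_star_self_of_mem_unitaryGroup hU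
  obtain ⟨A, hA⟩ : ∃ A : Fin 3 → Matrix (Fin 2) (Fin 2) ℂ, ∀ j, A j = Uᴴ * S j * U :=
    ⟨_, fun _ => rfl⟩
  have hSA : ∀ j, S j = U * A j * Uᴴ := fun j => by
    rw [hA]
    calc S j = (U * Uᴴ) * S j * (U * Uᴴ) := by rw [hUU', Matrix.one_mul, Matrix.mul_one]
      _ = _ := by simp only [Matrix.mul_assoc]
  have hAmul : ∀ i j, A i * A j = Uᴴ * (S i * S j) * U := fun i j => by
    rw [hA, hA]
    calc Uᴴ * S i * U * (Uᴴ * S j * U) = Uᴴ * S i * (U * Uᴴ) * S j * U := by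
          simp only [Matrix.mul_assoc]
      _ = _ := by rw [hUU', Matrix.mul_one]; simp only [Matrix.mul_assoc]
  have hAA : ∀ i j, A i * A j + A j * A i = if i = j then (2 : ℂ) • 1 else 0 := by
    intro i j
    rw [hAmul, hAmul, ← Matrix.add_mul, ← Matrix.mul_add, hSS]
    split_ifs <;> simp [hUU]
  have hA2 : A 2 = diagonal ![1, -1] := by
    rw [hA, h2]
    simp only [Matrix.mul_assoc, hUU, Matrix.mul_one]
    rw [← Matrix.mul_assoc, hUU, Matrix.one_mul]
  have hAh : ∀ j, (A j).IsHermitian := fun j => by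
    rw [hA]
    exact isHermitian_conjTranspose_mul_mul U (hSh j)
  -- Anticommuting with `diagonal ![1, -1]` kills the diagonal, and squaring to `1` makes the
  -- off-diagonal entry unimodular.
  have hoff : ∀ j, j ≠ 2 → ∃ z : ℂ, A j = !![0, z; star z, 0] ∧ z * star z = 1 := by
    intro j hj
    have h3 := hAA j 2
    rw [if_neg hj, hA2] at h3
    have e0 := congrFun (congrFun h3 0) 0
    have e1 := congrFun (congrFun h3 1) 1
    simp [Matrix.mul_apply, Fin.sum_univ_two] at e0 e1
    have e2 : A j = !![0, A j 0 1; star (A j 0 1), 0] := by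
      ext k l
      fin_cases k <;> fin_cases l
      · simpa using e0
      · rfl
      · exact ((hAh j).apply 1 0).symm
      · simp
        linear_combination e1
    refine ⟨A j 0 1, e2, ?_⟩
    have e3 := congrFun (congrFun (hAA j j) 0) 0
    rw [e2] at e3
    simp at e3 ⊢
    linear_combination e3 / 2
  obtain ⟨z, hz, hz1⟩ := hoff 0 (by decide)
  obtain ⟨w, hw, hw1⟩ := hoff 1 (by decide)
  have hzw : z * star w + w * star z = 0 := by
    have := congrFun (congrFun (hAA 0 1) 0) 0
    rw [hz, hw] at this
    simpa [Matrix.mul_apply, Fin.sum_univ_two] using this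
  -- Anticommutation of `A 0` and `A 1` leaves `w = ± i z`. The phase `diagonal ![z, 1]` normalises
  -- `z`, and the sign is the reflection.
  obtain ⟨k, hk⟩ : ∃ k : ℝ, w * star z = Complex.I * k := by
    refine ⟨(w * star z).im, ?_⟩
    have : (w * star z).re = 0 := by
      have h3 := congrArg Complex.re hzw
      simp at h3 ⊢
      linarith
    apply Complex.ext
    · rw [this]; simp
    · simp
  have hk1 : k ^ 2 = 1 := by
    have h3 : (w * star z) * star (w * star z) = 1 := by
      rw [star_mul, star_star]
      linear_combination (z * star z) * hw1 + hz1
    rw [hk] at h3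
    have h4 : ((k ^ 2 : ℝ) : ℂ) = 1 := by
      simp at h3
      push_cast
      linear_combination h3 + (k : ℂ) ^ 2 * Complex.I_sq
    exact_mod_cast h4
  have hwz : w = Complex.I * k * z := by
    rw [← hk]
    linear_combination (-w) * hz1
  have hP : diagonal ![z, 1] ∈ unitaryGroup (Fin 2) ℂ := by
    rw [mem_unitaryGroup_iff, star_eq_conjTranspose, diagonal_conjTranspose, diagonal_mul_diagonal,
      ← diagonal_one]
    congr 1
    ext i
    fin_cases i
    · simpa using hz1
    · simp
  refine ⟨U * diagonal ![z, 1], mul_mem hU hP, -k, ?_, fun v => ?_⟩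
  · rcases (sq_eq_one_iff.1 hk1) with h | h <;> simp [h]
  · have h : R *ᵥ v = ∑ j, v j • fun i => R i j := by
      ext i
      simp [mulVec, dotProduct, mul_comm]
    have h4 : conjMap (diagonal ![z, 1]) (pauliVec ![v 0, -k * v 1, v 2]) =
        (v 0 : ℂ) • A 0 + (v 1 : ℂ) • A 1 + (v 2 : ℂ) • A 2 := by
      rw [hA2, hz, hw, conjMap_apply, diagonal_conjTranspose, hwz]
      ext i j
      fin_cases i <;> fin_cases j <;> simp [pauliVec, diagonal_mul, mul_diagonal]
      · rw [Complex.star_def] at hz1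
        linear_combination (v 2 : ℂ) * hz1
      · ring
      · ring
    have h5 : ∀ X, conjMap (U * diagonal ![z, 1]) X = conjMap U (conjMap (diagonal ![z, 1]) X) := by
      intro X
      simp only [conjMap_apply, conjTranspose_mul, Matrix.mul_assoc]
    rw [h5, h4, h]
    simp only [Fin.sum_univ_three, pauliVec_add, pauliVec_smul, ← hS, map_add, map_smul]
    simp only [conjMap_apply, ← hSA]

/-- A qubit map that is diagonal in orthonormal bases is, up to unitaries, a diagonal one. -/
theorem exists_blochMap_eq_conjMap {R f : Matrix (Fin 3) (Fin 3) ℝ}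
    (hR : R ∈ orthogonalGroup (Fin 3) ℝ) (hf : f ∈ orthogonalGroup (Fin 3) ℝ) (t a b c : ℝ) :
    ∃ U ∈ unitaryGroup (Fin 2) ℂ, ∃ V ∈ unitaryGroup (Fin 2) ℂ, ∃ η : ℝ, (η = 1 ∨ η = -1) ∧
      blochMap (R *ᵥ ![0, 0, t]) (R * diagonal ![a, b, c] * f) =
        conjMap U ∘ₗ blochMap ![0, 0, t] (diagonal ![a, η * b, c]) ∘ₗ conjMap V := by
  obtain ⟨U, hU, ε, hε, h1⟩ := exists_unitary_pauliVec_mulVec hR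
  obtain ⟨V, hV, δ, hδ, h2⟩ := exists_unitary_pauliVec_mulVec (transpose_mem_orthogonalGroup hf)
  have hVV : Vᴴ * V = 1 := star_mul_self_of_mem_unitaryGroup hV
  have hUU : U * Uᴴ = 1 := mul_star_self_of_mem_unitaryGroup hU
  have hff : fᵀ * f = 1 := (mem_orthogonalGroup_iff' (Fin 3) ℝ).1 hf
  -- Both reflections act on the second axis and commute with the diagonal matrix, so they merge
  -- into one sign on `b`.
  refine ⟨U, hU, Vᴴ, conjTranspose_mem_unitaryGroup hV, ε * δ, ?_, linearMap_ext_pauliVec ?_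
    fun v => ?_⟩
  · rcases hε with rfl | rfl <;> rcases hδ with rfl | rfl <;> simp
  · rw [blochMap_one, h1, LinearMap.comp_apply, LinearMap.comp_apply, conjMap_apply Vᴴ,
      conjTranspose_conjTranspose, Matrix.mul_one, hVV, blochMap_one, map_add, conjMap_apply U 1,
      Matrix.mul_one, hUU]
    simp
  · have h3 : conjMap Vᴴ (pauliVec v) = pauliVec ![(f *ᵥ v) 0, δ * (f *ᵥ v) 1, (f *ᵥ v) 2] := by
      have h4 := h2 (f *ᵥ v)
      rw [mulVec_mulVec, hff, one_mulVec] at h4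
      rw [h4, conjMap_apply, conjMap_apply, conjTranspose_conjTranspose]
      simp only [Matrix.mul_assoc, hVV, Matrix.mul_one]
      rw [← Matrix.mul_assoc, hVV, Matrix.one_mul]
    rw [blochMap_pauliVec, ← mulVec_mulVec, ← mulVec_mulVec, h1, LinearMap.comp_apply,
      LinearMap.comp_apply, h3, blochMap_pauliVec]
    congr 2
    ext i
    rw [mulVec_diagonal]
    fin_cases i
    · simp [mulVec_diagonal]
    · rcases hδ with rfl | rfl <;> simp [mulVec_diagonal, mul_assoc]
    · simp [mulVec_diagonal]

end Rotation

/-! ### The output norm bound and the two inequalities. -/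

section Multiplicativity

set_option linter.unusedSectionVars false

variable {d e : Type*} [Fintype d] [DecidableEq d] [Fintype e] [DecidableEq e] {p : ℝ}

theorem blochMap_diagonal_apply (t a b c : ℝ) (X : Matrix (Fin 2) (Fin 2) ℂ) :
    blochMap ![0, 0, t] (diagonal ![a, b, c]) X =
      !![((1 + t + c) * X 0 0 + (1 + t - c) * X 1 1) / 2,
        ((a + b) * X 0 1 + (a - b) * X 1 0) / 2;
        ((a - b) * X 0 1 + (a + b) * X 1 0) / 2,
        ((1 - t - c) * X 0 0 + (1 - t + c) * X 1 1) / 2] := by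
  rw [blochMap_apply, Fin.sum_univ_three]
  ext i j
  fin_cases i <;> fin_cases j <;>
    simp [pauliVec, trace, Fin.sum_univ_two, vecMul, dotProduct]
  · ring
  · linear_combination (-(1 / 2 : ℂ) * b * (X 0 1 - X 1 0)) * Complex.I_sq
  · linear_combination ((1 / 2 : ℂ) * b * (X 0 1 - X 1 0)) * Complex.I_sq
  · ring

theorem schattenNorm_symmMatrix_smul_le (hp : 1 < p) {k : ℝ} (hk : 0 ≤ k) (a b c : ℝ) :
    schattenNorm p (symmMatrix (k * a) (k * b) (k * c)) ≤ k * schattenNorm p (symmMatrix a b c) := by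
  have h : symmMatrix (k * a) (k * b) (k * c) = (k : ℂ) • symmMatrix a b c := by
    ext i j
    fin_cases i <;> fin_cases j <;> simp [symmMatrix]
  rw [h]
  refine (schattenNorm_smul_le hp _ _).trans ?_
  rw [Complex.norm_real, Real.norm_of_nonneg hk]

theorem schattenNorm_real_add_le (hp : 1 < p) {x y u v : ℝ} (hx : 0 ≤ x) (hy : 0 ≤ y)
    {A C : Matrix e e ℂ} (hA : schattenNorm p A ≤ u) (hC : schattenNorm p C ≤ v) :
    schattenNorm p ((x : ℂ) • A + (y : ℂ) • C) ≤ x * u + y * v := by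
  refine (schattenNorm_add_le hp _ _).trans (add_le_add ?_ ?_)
  · refine (schattenNorm_smul_le hp _ _).trans ?_
    rw [Complex.norm_real, Real.norm_of_nonneg hx]
    exact mul_le_mul_of_nonneg_left hA hx
  · refine (schattenNorm_smul_le hp _ _).trans ?_
    rw [Complex.norm_real, Real.norm_of_nonneg hy]
    exact mul_le_mul_of_nonneg_left hC hy

/-- The output norm bound for a qubit map that is diagonal in the Pauli basis and has its
translation along an axis. -/
theorem schattenNorm_tensorMap_blochMap_diagonal_le (hp : p = 2 ∨ 4 ≤ p)
    {Ω : Matrix d d ℂ →ₗ[ℂ] Matrix e e ℂ} (hΩ : IsCompletelyPositive Ω) {t l β η r N : ℝ}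
    (hη : η = 1 ∨ η = -1) (hβ : 0 ≤ β)
    (hq : ∀ w : ℝ, |w| ≤ 1 → (t + l * w) ^ 2 + β ^ 2 * (1 - w ^ 2) ≤ r ^ 2)
    (hr0 : 0 ≤ r) (hr : r ≤ 1) (hN : 0 ≤ N)
    (hNr : N ^ p = ((1 + r) / 2) ^ p + ((1 - r) / 2) ^ p)
    {τ : Matrix (Fin 2 × d) (Fin 2 × d) ℂ} (hτ : τ ∈ states (Fin 2 × d)) :
    schattenNorm p (tensorMap (blochMap ![0, 0, t] (diagonal ![β, η * β, l])) Ω τ) ≤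
      N * maxOutputNorm p Ω := by
  have hp1 : 1 < p := by rcases hp with h | h <;> linarith
  -- The endpoints `w = ±1` of `hq` make the coefficients of the diagonal output blocks nonnegative.
  have hplus : |t + l| ≤ 1 := by
    have := hq 1 (by norm_num)
    rw [← sq_le_one_iff_abs_le_one]
    nlinarith
  have hminus : |t - l| ≤ 1 := by
    have := hq (-1) (by norm_num)
    rw [← sq_le_one_iff_abs_le_one]
    nlinarith
  obtain ⟨hp1', hp2'⟩ := abs_le.1 hplus
  obtain ⟨hm1', hm2'⟩ := abs_le.1 hminus
  set ν := maxOutputNorm p Ω with hν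
  have hν0 : 0 ≤ ν := maxOutputNorm_nonneg p Ω
  have hblk0 : (blk τ 0 0).PosSemidef := hτ.1.submatrix _
  have hblk1 : (blk τ 1 1).PosSemidef := hτ.1.submatrix _
  set x := (blk τ 0 0).trace.re with hx
  set z := (blk τ 1 1).trace.re with hz
  have hx0 : 0 ≤ x := (Complex.le_def.1 hblk0.trace_nonneg).1
  have hz0 : 0 ≤ z := (Complex.le_def.1 hblk1.trace_nonneg).1
  have hxz : x + z = 1 := by
    have h := congrArg Complex.re hτ.2
    rw [trace, Fintype.sum_prod_type, Fin.sum_univ_two, Complex.add_re, Complex.one_re] at h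
    exact h
  have hΩ0 := schattenNorm_le_maxOutputNorm_mul_trace hp1 Ω hblk0
  have hΩ1 := schattenNorm_le_maxOutputNorm_mul_trace hp1 Ω hblk1
  rw [← hν, ← hx] at hΩ0
  rw [← hν, ← hz] at hΩ1
  have hM := hΩ.posSemidef_fromBlocks hτ.1
  have h10 : Ω (blk τ 1 0) = (Ω (blk τ 0 1))ᴴ := by
    have h := hM.isHermitian
    rw [isHermitian_fromBlocks_iff] at h
    exact h.2.1.symm
  rw [h10] at hM
  have hΩ00 := (PosSemidef.fromBlocks_left hM).isHermitian
  have hΩ11 := (PosSemidef.fromBlocks_right hM).isHermitian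
  set P := Ω (blk τ 0 0) with hP
  set Q := Ω (blk τ 0 1) with hQ
  set Z := Ω (blk τ 1 1) with hZ
  have hoff : schattenNorm p Q ≤ ν * √(x * z) := by
    have h := PosSemidef.schattenNorm_offDiag_sq_le hp1 hM
    have h2 : schattenNorm p P * schattenNorm p Z ≤ (ν * x) * (ν * z) :=
      mul_le_mul hΩ0 hΩ1 (schattenNorm_nonneg _ _) (by positivity)
    refine le_of_sq_le_sq (h.trans (h2.trans (le_of_eq ?_))) (by positivity)
    rw [mul_pow, Real.sq_sqrt (by positivity)]
    ring
  -- For `η = -1` the qubit map exchanges the off-diagonal blocks, so `Q` is replaced by its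
  -- adjoint, of the same norm. Positivity may be lost here, but Hermiticity is not.
  obtain ⟨B, hB, hBn⟩ : ∃ B : Matrix e e ℂ, (B = Q ∧ η = 1 ∨ B = Qᴴ ∧ η = -1) ∧
      schattenNorm p B ≤ ν * √(x * z) := by
    rcases hη with h | h
    · exact ⟨Q, Or.inl ⟨rfl, h⟩, hoff⟩
    · exact ⟨Qᴴ, Or.inr ⟨rfl, h⟩, by rwa [schattenNorm_conjTranspose]⟩
  have hb0 : blk (tensorMap (blochMap ![0, 0, t] (diagonal ![β, η * β, l])) Ω τ) 0 0 =
      (((1 + t + l) / 2 : ℝ) : ℂ) • P + (((1 + t - l) / 2 : ℝ) : ℂ) • Z := by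
    rw [blk_tensorMap]
    simp only [blochMap_diagonal_apply, Fin.sum_univ_two, ← hP, ← hQ, ← hZ, h10]
    simp
  have hb1 : blk (tensorMap (blochMap ![0, 0, t] (diagonal ![β, η * β, l])) Ω τ) 1 1 =
      (((1 - t - l) / 2 : ℝ) : ℂ) • P + (((1 - t + l) / 2 : ℝ) : ℂ) • Z := by
    rw [blk_tensorMap]
    simp only [blochMap_diagonal_apply, Fin.sum_univ_two, ← hP, ← hQ, ← hZ, h10]
    simp
  have hb01 : blk (tensorMap (blochMap ![0, 0, t] (diagonal ![β, η * β, l])) Ω τ) 0 1 =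
      (β : ℂ) • B := by
    rw [blk_tensorMap]
    simp only [blochMap_diagonal_apply, Fin.sum_univ_two, ← hP, ← hQ, ← hZ, h10]
    rcases hB with ⟨rfl, h⟩ | ⟨rfl, h⟩ <;> simp [h]
  have hb10 : blk (tensorMap (blochMap ![0, 0, t] (diagonal ![β, η * β, l])) Ω τ) 1 0 =
      ((β : ℂ) • B)ᴴ := by
    rw [blk_tensorMap]
    simp only [blochMap_diagonal_apply, Fin.sum_univ_two, ← hP, ← hQ, ← hZ, h10]
    rcases hB with ⟨rfl, h⟩ | ⟨rfl, h⟩ <;> simp [h]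
  have hsm : ∀ (c : ℝ) {A : Matrix e e ℂ}, A.IsHermitian → ((c : ℂ) • A).IsHermitian := by
    intro c A hA
    rw [IsHermitian, conjTranspose_smul, hA.eq]
    simp
  rw [← schattenNorm_submatrix_equiv p _ (sumEquivFinTwoProd e), submatrix_sumEquivFinTwoProd,
    hb0, hb1, hb01, hb10]
  have hBb : schattenNorm p ((β : ℂ) • B) ≤ ν * (β * √(x * z)) := by
    refine (schattenNorm_smul_le hp1 _ _).trans ?_
    rw [Complex.norm_real, Real.norm_of_nonneg hβ]
    calc β * schattenNorm p B ≤ β * (ν * √(x * z)) := mul_le_mul_of_nonneg_left hBn hβ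
      _ = _ := by ring
  refine (schattenNorm_fromBlocks_le hp ((hsm _ hΩ00).add (hsm _ hΩ11))
    ((hsm _ hΩ00).add (hsm _ hΩ11))
    (a := ν * ((1 + (t + l * (x - z))) / 2)) (b := ν * (β * √(x * z)))
    (c := ν * ((1 - (t + l * (x - z))) / 2)) ?_ hBb ?_).trans ?_
  · refine (schattenNorm_real_add_le hp1 (by linarith) (by linarith) hΩ0 hΩ1).trans (le_of_eq ?_)
    linear_combination (ν * (1 + t) / 2) * hxz
  · refine (schattenNorm_real_add_le hp1 (by linarith) (by linarith) hΩ0 hΩ1).trans (le_of_eq ?_)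
    linear_combination (ν * (1 - t) / 2) * hxz
  · refine (schattenNorm_symmMatrix_smul_le hp1 hν0 _ _ _).trans ?_
    rw [mul_comm]
    refine mul_le_mul_of_nonneg_right (schattenNorm_symmMatrix_le hp1.le (by ring) ?_ hr0 hr hN hNr)
      hν0
    -- Since `x + z = 1`, `4 x z = 1 - (x - z) ^ 2`: the squared Bloch radius of the norm matrix is
    -- the left side of `hq` at `w = x - z`.
    refine le_trans (le_of_eq ?_) (hq (x - z) (abs_le.2 ⟨by linarith, by linarith⟩))
    rw [mul_pow, Real.sq_sqrt (by positivity)]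
    linear_combination (β ^ 2 * (x + z + 1)) * hxz

theorem blochMap_convexComb {a b : ℝ} (hab : a + b = 1) (t t' : Fin 3 → ℝ)
    (T T' : Matrix (Fin 3) (Fin 3) ℝ) :
    blochMap (a • t + b • t') (a • T + b • T') =
      (a : ℂ) • blochMap t T + (b : ℂ) • blochMap t' T' := by
  have hab' : (a : ℂ) + b = 1 := by exact_mod_cast hab
  refine linearMap_ext_pauliVec ?_ fun v => ?_
  · rw [LinearMap.add_apply, LinearMap.smul_apply, LinearMap.smul_apply, blochMap_one, blochMap_one,
      blochMap_one, pauliVec_add, pauliVec_smul, pauliVec_smul, smul_add, smul_add]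
    have : (1 : Matrix (Fin 2) (Fin 2) ℂ) = (a : ℂ) • 1 + (b : ℂ) • 1 := by
      rw [← add_smul, hab', one_smul]
    conv_lhs => rw [this]
    abel
  · rw [LinearMap.add_apply, LinearMap.smul_apply, LinearMap.smul_apply, blochMap_pauliVec,
      blochMap_pauliVec, blochMap_pauliVec, add_mulVec, smul_mulVec, smul_mulVec,
      pauliVec_add, pauliVec_smul, pauliVec_smul]

theorem tensorMap_smul_add_smul (a b : ℂ)
    (Ψ Ψ' : Matrix (Fin 2) (Fin 2) ℂ →ₗ[ℂ] Matrix (Fin 2) (Fin 2) ℂ)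
    (Ω : Matrix d d ℂ →ₗ[ℂ] Matrix e e ℂ) (τ : Matrix (Fin 2 × d) (Fin 2 × d) ℂ) :
    tensorMap (a • Ψ + b • Ψ') Ω τ = a • tensorMap Ψ Ω τ + b • tensorMap Ψ' Ω τ := by
  simp only [tensorMap_apply, LinearMap.add_apply, LinearMap.smul_apply, add_kronecker,
    smul_kronecker, Finset.sum_add_distrib, Finset.smul_sum]

/-- The output norm bound when the Bloch map factors through a contraction. -/
theorem schattenNorm_tensorMap_blochMap_le (hp : p = 2 ∨ 4 ≤ p)
    {Ω : Matrix d d ℂ →ₗ[ℂ] Matrix e e ℂ} (hΩ : IsCompletelyPositive Ω) {t l β r N : ℝ}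
    (hβ : 0 ≤ β) (hq : ∀ w : ℝ, |w| ≤ 1 → (t + l * w) ^ 2 + β ^ 2 * (1 - w ^ 2) ≤ r ^ 2)
    (hr0 : 0 ≤ r) (hr : r ≤ 1) (hN : 0 ≤ N)
    (hNr : N ^ p = ((1 + r) / 2) ^ p + ((1 - r) / 2) ^ p)
    {G f : Matrix (Fin 3) (Fin 3) ℝ} (hG : ∀ x, (G *ᵥ x) ⬝ᵥ (G *ᵥ x) ≤ x ⬝ᵥ x)
    (hf : f ∈ orthogonalGroup (Fin 3) ℝ)
    {τ : Matrix (Fin 2 × d) (Fin 2 × d) ℂ} (hτ : τ ∈ states (Fin 2 × d)) :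
    schattenNorm p (tensorMap (blochMap (G *ᵥ ![0, 0, t]) (G * diagonal ![β, β, l] * f)) Ω τ) ≤
      N * maxOutputNorm p Ω := by
  have hp1 : 1 < p := by rcases hp with h | h <;> linarith
  -- The output depends affinely on `R`, so by convexity of the norm this set is convex; it remains
  -- to see that it contains the orthogonal matrices.
  set S : Set (Matrix (Fin 3) (Fin 3) ℝ) := {R | schattenNorm p
    (tensorMap (blochMap (R *ᵥ ![0, 0, t]) (R * diagonal ![β, β, l] * f)) Ω τ) ≤
      N * maxOutputNorm p Ω} with hS
  have hconv : Convex ℝ S := by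
    intro R hR R' hR' a b ha hb hab
    rw [hS, Set.mem_ofPred_eq] at hR hR' ⊢
    rw [add_mulVec, smul_mulVec, smul_mulVec, Matrix.add_mul, Matrix.add_mul, Matrix.smul_mul,
      Matrix.smul_mul, Matrix.smul_mul, Matrix.smul_mul, blochMap_convexComb hab,
      tensorMap_smul_add_smul]
    refine (schattenNorm_real_add_le hp1 ha hb hR hR').trans (le_of_eq ?_)
    rw [← add_mul, hab, one_mul]
  refine convexHull_min (fun R hR => ?_) hconv (mem_convexHull_orthogonalGroup hG)
  obtain ⟨U, hU, V, hV, η, hη, h⟩ := exists_blochMap_eq_conjMap hR hf t β β l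
  rw [hS, Set.mem_ofPred_eq, h, tensorMap_conjMap_comp,
    schattenNorm_conjMap (kronecker_mem_unitaryGroup hU (one_mem _))]
  exact schattenNorm_tensorMap_blochMap_diagonal_le hp hΩ hη hβ hq hr0 hr hN hNr
    (conjMap_mem_states (kronecker_mem_unitaryGroup hV (one_mem _)) hτ)

/-- The longest vector in the image of the unit sphere under an affine map of `ℝ³`, with its
multiplier. -/
theorem exists_dotProduct_bound (t : Fin 3 → ℝ) (T : Matrix (Fin 3) (Fin 3) ℝ) :
    ∃ (w : Fin 3 → ℝ) (r μ : ℝ), w ⬝ᵥ w = 1 ∧ 0 ≤ r ∧ (t + T *ᵥ w) ⬝ᵥ (t + T *ᵥ w) = r ^ 2 ∧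
      0 ≤ μ ∧ μ ≤ r ^ 2 ∧ ∀ (a : ℝ) (x : Fin 3 → ℝ),
        (a • t + T *ᵥ x) ⬝ᵥ (a • t + T *ᵥ x) ≤ (r ^ 2 - μ) * a ^ 2 + μ * (x ⬝ᵥ x) := by
  have hn : ∀ x : EuclideanSpace ℝ (Fin 3), ‖x‖ ^ 2 = x.ofLp ⬝ᵥ x.ofLp := fun x => by
    rw [EuclideanSpace.real_norm_sq_eq]
    simp [dotProduct, sq]
  set T' := Matrix.toEuclideanLin T with hT'
  set t' : EuclideanSpace ℝ (Fin 3) := WithLp.toLp 2 t with ht'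
  have hcont : Continuous fun x : EuclideanSpace ℝ (Fin 3) => ‖t' + T' x‖ :=
    (continuous_const.add T'.continuous_of_finiteDimensional).norm
  obtain ⟨w, hw, hmax⟩ := (isCompact_sphere (0 : EuclideanSpace ℝ (Fin 3)) 1).exists_isMaxOn
    (NormedSpace.sphere_nonempty.2 zero_le_one) hcont.continuousOn
  have hw1 : ‖w‖ = 1 := by simpa using hw
  obtain ⟨μ, hμ0, hμ1, hμ⟩ := exists_multiplier t' T' hw1
    fun v hv => hmax (by simpa using hv)
  refine ⟨w.ofLp, ‖t' + T' w‖, μ, ?_, norm_nonneg _, ?_, hμ0, hμ1, fun a x => ?_⟩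
  · rw [← hn, hw1, one_pow]
  · rw [hn]
    rfl
  · have h := hμ a (WithLp.toLp 2 x)
    rw [hn (a • t' + _), hn (WithLp.toLp 2 x)] at h
    exact h

/-- Positivity of `Φ` enters only through Hermiticity and `r ≤ 1`. The output at the pure state with
Bloch vector `w` has norm equal to the bound `N` at radius `r`. -/
theorem maxOutputNorm_tensorMap_le (hp : p = 2 ∨ 4 ≤ p)
    {Φ : Matrix (Fin 2) (Fin 2) ℂ →ₗ[ℂ] Matrix (Fin 2) (Fin 2) ℂ}
    (hΦtr : IsTracePreserving Φ) (hΦpos : IsPositivityPreserving Φ)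
    {Ω : Matrix d d ℂ →ₗ[ℂ] Matrix e e ℂ} (hΩ : IsCompletelyPositive Ω) :
    maxOutputNorm p (tensorMap Φ Ω) ≤ maxOutputNorm p Φ * maxOutputNorm p Ω := by
  have hp1 : 1 < p := by rcases hp with h | h <;> linarith
  obtain ⟨t, T, hΦ⟩ := exists_eq_blochMap hΦtr hΦpos.map_isHermitian
  obtain ⟨w, r, μ, hw, hr0, hr2, hμ0, hμ1, hμ⟩ := exists_dotProduct_bound t T
  have hρ : (1 / 2 : ℂ) • (1 + pauliVec w) ∈ states (Fin 2) := by
    refine ⟨(posSemidef_one_add_pauliVec hw).smul ?_, ?_⟩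
    · rw [one_div, ← Complex.ofReal_ofNat, ← Complex.ofReal_inv]
      exact_mod_cast (by norm_num : (0 : ℝ) ≤ 2⁻¹)
    · rw [trace_smul, trace_add, trace_one, trace_pauliVec]
      simp
  obtain ⟨H, hH⟩ : ∃ H, H = Φ ((1 / 2 : ℂ) • (1 + pauliVec w)) := ⟨_, rfl⟩
  have hHpos : H.PosSemidef := hH ▸ hΦpos _ hρ.1
  have hHtr : H.trace = 1 := by rw [hH, hΦtr, hρ.2]
  have hHeq : H = (1 / 2 : ℂ) • (1 + pauliVec (t + T *ᵥ w)) := by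
    rw [hH, hΦ, map_smul, map_add, blochMap_one, blochMap_pauliVec, pauliVec_add, add_assoc]
  have hHdet : H.det = (((1 - r ^ 2) / 4 : ℝ) : ℂ) := by
    rw [hHeq, ← hr2, det_smul, det_fin_two]
    simp [pauliVec, dotProduct, Fin.sum_univ_three]
    linear_combination ((t 1 + (T *ᵥ w) 1 : ℂ) ^ 2 / 4) * Complex.I_sq
  have hr : r ≤ 1 := by
    have h := hHpos.det_nonneg
    rw [hHdet] at h
    have h2 : (0 : ℝ) ≤ (1 - r ^ 2) / 4 := by exact_mod_cast h
    nlinarith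
  have hNr := schattenNorm_rpow_of_trace_eq_one (by linarith : p ≠ 0) hHpos.isHermitian hHtr
    (abs_le.2 ⟨by linarith, hr⟩) hHdet
  have hN : schattenNorm p H ≤ maxOutputNorm p Φ := by
    rw [hH]
    exact schattenNorm_le_maxOutputNorm (by linarith) Φ hρ
  have hα2 : √(r ^ 2 - μ) ^ 2 = r ^ 2 - μ := Real.sq_sqrt (by linarith)
  have hβ2 : √μ ^ 2 = μ := Real.sq_sqrt hμ0
  obtain ⟨G, f, n, s, hG, hf, hns, ht, hT⟩ :=
    exists_contraction_factorization (t := t) (T := T) (α := √(r ^ 2 - μ)) (β := √μ) (by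
      intro a x
      rw [hα2, hβ2]
      exact hμ a x)
  refine Real.sSup_le ?_ (mul_nonneg (maxOutputNorm_nonneg _ _) (maxOutputNorm_nonneg _ _))
  rintro _ ⟨τ, hτ, rfl⟩
  refine le_trans ?_ (mul_le_mul_of_nonneg_right hN (maxOutputNorm_nonneg _ _))
  simp only [hΦ]
  rw [ht, hT]
  refine schattenNorm_tensorMap_blochMap_le hp hΩ (Real.sqrt_nonneg _) (fun v _ => ?_) hr0 hr
    (schattenNorm_nonneg _ _) hNr hG hf hτ
  generalize √(r ^ 2 - μ) = α at hα2 ⊢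
  generalize √μ = β at hβ2 ⊢
  -- A rotation of `(α, β v)` by the unit vector `(s, n)`; dropping the second square gives the
  -- bound by `α² + β² = r²`.
  have h1 : (α * s + -(β * n) * v) ^ 2 + (α * n + β * v * s) ^ 2 = (α ^ 2 + β ^ 2 * v ^ 2) := by
    linear_combination (α ^ 2 + β ^ 2 * v ^ 2) * hns
  nlinarith [sq_nonneg (α * n + β * v * s)]

/-- On product states the output is a Kronecker product, and its norm is multiplicative. -/
theorem maxOutputNorm_mul_le_tensorMap (hp : 1 < p)
    (Φ : Matrix (Fin 2) (Fin 2) ℂ →ₗ[ℂ] Matrix (Fin 2) (Fin 2) ℂ)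
    (Ω : Matrix d d ℂ →ₗ[ℂ] Matrix e e ℂ) :
    maxOutputNorm p Φ * maxOutputNorm p Ω ≤ maxOutputNorm p (tensorMap Φ Ω) := by
  have key : ∀ ρ ∈ states (Fin 2), ∀ σ ∈ states d,
      schattenNorm p (Φ ρ) * schattenNorm p (Ω σ) ≤ maxOutputNorm p (tensorMap Φ Ω) := by
    intro ρ hρ σ hσ
    rw [← schattenNorm_kronecker, ← tensorMap_kronecker]
    refine schattenNorm_le_maxOutputNorm (by linarith) _ ⟨hρ.1.kronecker hσ.1, ?_⟩
    rw [trace_kronecker, hρ.2, hσ.2, mul_one]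
  have hR := maxOutputNorm_nonneg p (tensorMap Φ Ω)
  have step : ∀ ρ ∈ states (Fin 2),
      schattenNorm p (Φ ρ) * maxOutputNorm p Ω ≤ maxOutputNorm p (tensorMap Φ Ω) := by
    intro ρ hρ
    rcases (schattenNorm_nonneg p (Φ ρ)).eq_or_lt with h | h
    · rw [← h, zero_mul]
      exact hR
    · rw [mul_comm, ← le_div_iff₀ h]
      refine Real.sSup_le ?_ (div_nonneg hR h.le)
      rintro _ ⟨σ, hσ, rfl⟩
      rw [le_div_iff₀ h, mul_comm]
      exact key ρ hρ σ hσ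
  rcases (maxOutputNorm_nonneg p Ω).eq_or_lt with h | h
  · rw [← h, mul_zero]
    exact hR
  · rw [← le_div_iff₀ h]
    refine Real.sSup_le ?_ (div_nonneg hR h.le)
    rintro _ ⟨ρ, hρ, rfl⟩
    rw [le_div_iff₀ h]
    exact step ρ hρ

end Multiplicativity

end QuantumMap

end

/-- Multiplicativity of the maximal output `p`-norm of `Φ ⊗ Ω` for a trace-preserving,
positivity-preserving qubit map `Φ` and a completely positive map `Ω`, for `p = 2` and `p ≥ 4`. -/
theorem theorem1 {d e : Type*} [Fintype d] [DecidableEq d] [Fintype e] [DecidableEq e]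
    (Φ : Matrix (Fin 2) (Fin 2) ℂ →ₗ[ℂ] Matrix (Fin 2) (Fin 2) ℂ)
    (hΦtr : QuantumMap.IsTracePreserving Φ) (hΦpos : QuantumMap.IsPositivityPreserving Φ)
    (Ω : Matrix d d ℂ →ₗ[ℂ] Matrix e e ℂ) (hΩ : QuantumMap.IsCompletelyPositive Ω)
    (p : ℝ) (hp : p = 2 ∨ 4 ≤ p) :
    QuantumMap.maxOutputNorm p (QuantumMap.tensorMap Φ Ω) =
      QuantumMap.maxOutputNorm p Φ * QuantumMap.maxOutputNorm p Ω := by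
  have hp1 : 1 < p := by rcases hp with h | h <;> linarith
  exact le_antisymm (QuantumMap.maxOutputNorm_tensorMap_le hp hΦtr hΦpos hΩ)
    (QuantumMap.maxOutputNorm_mul_le_tensorMap hp1 Φ Ω)
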